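/- Consider the rational function $z(w)=\dfrac{w^2-\frac13}{w(w^2-1)}$. Put $\omega_{24}=e^{2\pi i/24}$ and let $$z_1=3^{-1/4}\omega_{24}^{7},\qquad z_2=3^{-1/4}\omega_{24}^{17},\qquad z_3=3^{-1/4}\omega_{24}^{19},\qquad z_4=3^{-1/4}\omega_{24}^{5}$$ be its finite branch points. Then there are a simple analytic arc $\Gamma_P$ from $z_1$ to $z_2$ lying in the open left half-plane and a simple analytic arc $\Gamma_R$ from $z_3$ to $z_4$ lying in the open right half-plane (analytic arc: the trace of a real analytic injective map on $[0,1]$ with non-vanishing derivative, end points included) such that the following hold. (a) There are three inverse mappings $\psi_P,\psi_Q,\psi_R$ of $z=z(w)$ such that $\psi_P$ is defined and analytic on $\mathbb C\setminus\Gamma_P$; $\psi_Q$ is defined and analytic on $\mathbb C\setminus(\Gamma_P\cup\Gamma_R)$ as a map to the Riemann sphere, being finite except at $0$, where it has a simple pole; and $\psi_R$ is defined and analytic on $\mathbb C\setminus\Gamma_R$. For every $z\in\mathbb C\setminus(\Gamma_P\cup\Gamma_R\cup\{0\})$ the solutions $w$ of $z(w)=z$ are exactly the three distinct numbers $\psi_P(z)$,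 $\psi_Q(z)$, $\psi_R(z)$; moreover $z(\psi_P(z))=z$ for all $z\in\mathbb C\setminus\Gamma_P$, $z(\psi_R(z))=z$ for all $z\in\mathbb C\setminus\Gamma_R$, and $\psi_P(0)\ne\psi_R(0)$. (b) As $z\to\infty$, $\psi_P(z)\to-1$, $\psi_Q(z)\to0$ and $\psi_R(z)\to1$. (c) For every $z\in\Gamma_P$, $$\frac{3}{2\pi i}\int_{z_1}^{z}(\psi_Q-\psi_P)_+(s)\,ds\in\mathbb R .$$ (d) For every $z\in\Gamma_R$, $$\frac{3}{2\pi i}\int_{z_3}^{z}(\psi_Q-\psi_R)_+(s)\,ds\in\mathbb R .$$ Here $f_+(s)$ denotes the limiting value of $f$ at the point $s$ of the arc, other than an end point, from the side that is on the left when the arc is traversed from $z_1$ to $z_2$, respectively from $z_3$ to $z_4$. The integrals are taken along the arcs; it is part of the claim that these limiting values exist and that $f_+(s)\,ds$ is integrable along the arc. -/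

import Mathlib

open Set Filter Topology MeasureTheory

noncomputable section

namespace HermitePade

/-- The rational function `z(w) = (w² - 1/3) / (w (w² - 1))`; its finite values are those at the
points `w` with `w * (w ^ 2 - 1) ≠ 0`. -/
def zMap (w : ℂ) : ℂ := (w ^ 2 - 1 / 3) / (w * (w ^ 2 - 1))

/-- The finite points `w` that the rational function sends to `z`. -/
def zFiber (z : ℂ) : Set ℂ := {w | w * (w ^ 2 - 1) ≠ 0 ∧ zMap w = z}

/-- The primitive 24th root of unity `e^{2πi/24}`. -/
def omega24 : ℂ := Complex.exp (2 * (Real.pi : ℂ) * Complex.I / 24)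

/-- The positive real number `3^{-1/4}`, as a complex number. -/
def rho : ℂ := (((3 : ℝ) ^ (-(1 / 4) : ℝ) : ℝ) : ℂ)

/-- The four branch points. -/
def z₁ : ℂ := rho * omega24 ^ 7

/-- See `z₁`. -/
def z₂ : ℂ := rho * omega24 ^ 17

/-- See `z₁`. -/
def z₃ : ℂ := rho * omega24 ^ 19

/-- See `z₁`. -/
def z₄ : ℂ := rho * omega24 ^ 5

/-- `γ`, restricted to `[0, 1]`, is a simple regular analytic arc from `a` to `b`
(analytic up to and including the end points). -/
structure IsAnalyticArc (γ : ℝ → ℂ) (a b : ℂ) : Prop where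
  analytic : AnalyticOnNhd ℝ γ (Icc 0 1)
  regular : ∀ t ∈ Icc (0 : ℝ) 1, deriv γ t ≠ 0
  simple : InjOn γ (Icc 0 1)
  source : γ 0 = a
  target : γ 1 = b

/-- The trace of the arc. -/
def trace (γ : ℝ → ℂ) : Set ℂ := γ '' Icc 0 1

/-- The filter of (one-sided) neighbourhoods of the point `γ t` in the `+` side of the arc, the side
on the left when the arc is traversed in its direction: since `I * γ'(s)` is the left normal,
these are the points `γ s + ε * (I * γ'(s))` with `s` close to `t` and `ε > 0` small. -/
def plusSide (γ : ℝ → ℂ) (t : ℝ) : Filter ℂ :=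
  Filter.map (fun p : ℝ × ℝ => γ p.1 + (p.2 : ℂ) * (Complex.I * deriv γ p.1))
    (𝓝 t ×ˢ 𝓝[>] (0 : ℝ))

/-- `g t` is the boundary value `f₊(γ t)` of `f` from the `+` side, at every point of the arc
other than its end points. -/
def IsPlusBoundaryFunction (f : ℂ → ℂ) (γ g : ℝ → ℂ) : Prop :=
  ∀ t ∈ Ioo (0 : ℝ) 1, Tendsto f (plusSide γ t) (𝓝 (g t))

/-- The boundary values `f₊` exist on the (open) arc, `f₊(s) ds` is integrable along the arc, and
`(3 / (2πi)) ∫_{γ 0}^{z} f₊(s) ds`, taken along the arc, is real for every `z` on the arc. -/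
def HasRealPlusIntegrals (f : ℂ → ℂ) (γ : ℝ → ℂ) : Prop :=
  ∃ g : ℝ → ℂ, IsPlusBoundaryFunction f γ g ∧
    IntervalIntegrable (fun s => g s * deriv γ s) volume 0 1 ∧
    ∀ t ∈ Icc (0 : ℝ) 1, ∃ r : ℝ,
      3 / (2 * (Real.pi : ℂ) * Complex.I) * ∫ s in (0 : ℝ)..t, g s * deriv γ s = (r : ℂ)

end HermitePade

end

noncomputable section

namespace HermitePade

/-! ### The cubic equation for the fibers -/

/-! Since (z, w) ↦ (-z, -w) maps fibers to fibers, only the left arc has to be built: Γ_R is -Γ_P,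
and ψ_R(z) = -ψ_P(-z).

The key fact is that for Re z ≤ 0 exactly one fiber point lies in the open right half-plane, and
that it is a simple root. Uniqueness is a positivity argument with a Gram kernel
(`re_pos_of_mem_zFiber`), existence an argument with symmetric functions
(`IsRootTriple.exists_re_pos`), simplicity a direct computation (`re_pos_of_critical`). This point
`rightRoot z` is ψ_R on the closed left half-plane, whatever the arcs are. Separating the two
remaining points for Re z < 0 amounts to choosing a square root of the discriminant z⁴ + z² + 1/3,
whose zeros are the four branch points; a branch exists off Γ_P ∪ -Γ_P. The resulting formula for
ψ_P continues -`rightRoot (-z)` across the imaginary axis, because the axis is connected and the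
signs agree at 0 (`discSqrt_eq_of_re_zero`). So every analytic arc from z₁ to z₂ in the left
half-plane yields (a) and (b).

Claim (c) holds if the arc is a trajectory, that is, (ψ_Q - ψ_P)² dz² ≤ 0 along it
(`IsAnalyticArc.hasRealPlusIntegrals`). The square `gapSq` of the difference is analytic in the
whole left half-plane and independent of the arc, so the trajectory can be sought beforehand.

To find it, take as coordinate x = √3 times the product of the two other fiber points, and x = exp
ξ. The differential becomes √3 `quadDiff (exp ξ)` dξ² in the strip |Im ξ| < π/2. It is symmetric
under conjugation and has simple zeros at ±iπ/2, which correspond to z₁ and z₂. Its square root has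
positive real part for Re ξ ≥ 0, so the real part of a primitive increases strictly along horizontal
rays, and each of its level sets there is a graph over Im ξ. A local normal form at iπ/2
(`exists_trajectory_of_simple_zero`) gives a trajectory leaving that point into the right part of
the strip; it fixes the level c. The local trajectory and the level curve agree by uniqueness on
horizontal rays, so the curve is analytic up to its end, and conjugation carries it to -iπ/2
(`exists_trajectory`, `exists_arc`). -/

lemma mem_zFiber_iff {z w : ℂ} : w ∈ zFiber z ↔ z * (w ^ 3 - w) = w ^ 2 - 1 / 3 := by
  unfold zFiber zMap
  constructor
  · rintro ⟨h, rfl⟩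
    rw [show w ^ 3 - w = w * (w ^ 2 - 1) by ring, div_mul_cancel₀ _ h]
  · intro h
    have h0 : w * (w ^ 2 - 1) ≠ 0 := by
      intro h1
      have h2 : w ^ 2 = 1 / 3 := by linear_combination z * h1 - h
      rw [h2] at h1
      have h3 : w = 0 := by linear_combination (-3 / 2) * h1
      rw [h3] at h2
      norm_num at h2
    refine ⟨h0, ?_⟩
    rw [div_eq_iff h0]
    linear_combination -h

lemma neg_mem_zFiber_iff {z w : ℂ} : -w ∈ zFiber (-z) ↔ w ∈ zFiber z := by
  rw [mem_zFiber_iff, mem_zFiber_iff]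
  constructor <;> intro h <;> linear_combination h

lemma neg_mem_zFiber {z w : ℂ} (h : w ∈ zFiber (-z)) : -w ∈ zFiber z := by
  rw [← neg_mem_zFiber_iff]; simpa using h

/-- `u`, `v`, `s` are the three points of the fiber over `z`, with multiplicity. -/
structure IsRootTriple (z u v s : ℂ) : Prop where
  sum : z * (u + v + s) = 1
  sum_mul : u * v + u * s + v * s = -1
  prod : z * (u * v * s) = -1 / 3

namespace IsRootTriple

variable {z u v s : ℂ}

lemma ne_zero (h : IsRootTriple z u v s) : z ≠ 0 := by
  rintro rfl
  simpa using h.sum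

lemma rotate (h : IsRootTriple z u v s) : IsRootTriple z v s u :=
  ⟨by linear_combination h.sum, by linear_combination h.sum_mul, by linear_combination h.prod⟩

lemma swap (h : IsRootTriple z u v s) : IsRootTriple z v u s :=
  ⟨by linear_combination h.sum, by linear_combination h.sum_mul, by linear_combination h.prod⟩

lemma factor (h : IsRootTriple z u v s) (w : ℂ) :
    z * (w ^ 3 - w) - (w ^ 2 - 1 / 3) = z * ((w - u) * (w - v) * (w - s)) := by
  linear_combination w ^ 2 * h.sum - z * w * h.sum_mul + h.prod

lemma mem_iff (h : IsRootTriple z u v s) (w : ℂ) : w ∈ zFiber z ↔ w = u ∨ w = v ∨ w = s := by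
  rw [mem_zFiber_iff, ← sub_eq_zero, h.factor w]
  simp [h.ne_zero, sub_eq_zero, or_assoc]

lemma zFiber_eq (h : IsRootTriple z u v s) : zFiber z = {u, v, s} := by
  ext w
  rw [h.mem_iff]
  simp

lemma deriv_eq (h : IsRootTriple z u v s) :
    3 * z * u ^ 2 - 2 * u - z = z * ((u - v) * (u - s)) := by
  linear_combination (2 * u) * h.sum - z * h.sum_mul

end IsRootTriple

lemma isRootTriple_of_ne {z u v s : ℂ} (hz : z ≠ 0) (hu : u ∈ zFiber z) (hv : v ∈ zFiber z)
    (huv : u ≠ v) (hs : z * (u + v + s) = 1) : IsRootTriple z u v s := by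
  rw [mem_zFiber_iff] at hu hv
  have h1 : z * (u ^ 2 + u * v + v ^ 2 - 1) = u + v :=
    mul_left_cancel₀ (sub_ne_zero.2 huv) (by linear_combination hu - hv)
  refine ⟨hs, mul_left_cancel₀ hz ?_, ?_⟩
  · linear_combination (u + v) * hs - h1
  · linear_combination u * v * hs - u * h1 + hu

lemma exists_isRootTriple {z : ℂ} (hz : z ≠ 0) : ∃ u v s, IsRootTriple z u v s := by
  obtain ⟨u, hu⟩ : ∃ u, z * (u ^ 3 - u) = u ^ 2 - 1 / 3 := by
    let p : Polynomial ℂ := Polynomial.C z * Polynomial.X ^ 3 + Polynomial.C (-1) * Polynomial.X ^ 2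
      + Polynomial.C (-z) * Polynomial.X + Polynomial.C (1 / 3)
    have hp : p.degree = 3 := Polynomial.degree_cubic hz
    obtain ⟨u, hu⟩ := IsAlgClosed.exists_root p (by rw [hp]; norm_num)
    refine ⟨u, ?_⟩
    have : z * u ^ 3 + -1 * u ^ 2 + -z * u + 1 / 3 = 0 := by
      simpa [p, Polynomial.IsRoot.def] using hu
    linear_combination this
  obtain ⟨d, hd⟩ := IsAlgClosed.exists_pow_nat_eq ((1 / z - u) ^ 2 + 4 * (1 + u * (1 / z - u)))
    (n := 2) (by norm_num)
  refine ⟨u, (1 / z - u + d) / 2, (1 / z - u - d) / 2, ?_, ?_, ?_⟩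
  · field_simp; ring
  · linear_combination (-1 / 4) * hd
  · have h1 : (1 / z - u + d) / 2 * ((1 / z - u - d) / 2) = -(1 + u * (1 / z - u)) := by
      linear_combination (-1 / 4) * hd
    rw [mul_assoc u, h1]
    field_simp
    linear_combination 3 * hu

/-! ### The location of the fibers with respect to the imaginary axis -/

/-- With b the conjugate of a fiber point over z, the left side is 2 Re z times a Gram kernel, and
the right side is a sum of rank-one kernels apart from the constant -2/3. That constant disappears
on vectors whose coordinates add up to 0. -/
lemma kernel_aux {z z' a b : ℂ} (ha : a ∈ zFiber z) (hb : b ∈ zFiber z') (hab : a + b ≠ 0) :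
    (z + z') * ((a ^ 2 - 1) * (b ^ 2 - 1) / (a + b)) =
      1 / 3 * ((a ^ 2 - 1) / a * ((b ^ 2 - 1) / b) + 2 * (a * b - 1)) := by
  obtain ⟨h1, rfl⟩ := ha
  obtain ⟨h2, rfl⟩ := hb
  obtain ⟨ha, hA⟩ := mul_ne_zero_iff.1 h1
  obtain ⟨hb, hB⟩ := mul_ne_zero_iff.1 h2
  unfold zMap
  field_simp
  ring

lemma conj_mem_zFiber {z w : ℂ} (h : w ∈ zFiber z) :
    (starRingEnd ℂ) w ∈ zFiber ((starRingEnd ℂ) z) := by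
  rw [mem_zFiber_iff] at *
  simpa [map_ofNat] using congrArg (starRingEnd ℂ) h

/-- The kernel 1/(a + b̄) is positive semidefinite on the right half-plane, being the Gram kernel of
the functions exp(-at) in L²(0, ∞); this is its quadratic form at (A, -B). The proof replaces |a +
b̄| by the smaller Re a + Re b and completes squares. -/
lemma gram_aux {a b A B : ℂ} (ha : 0 < a.re) (hb : 0 < b.re) :
    0 ≤ ‖A‖ ^ 2 / (2 * a.re) + ‖B‖ ^ 2 / (2 * b.re)
      - 2 * (A * (starRingEnd ℂ) B / (a + (starRingEnd ℂ) b)).re := by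
  have h1 : (A * (starRingEnd ℂ) B / (a + (starRingEnd ℂ) b)).re ≤ ‖A‖ * ‖B‖ / (a.re + b.re) := by
    refine (Complex.re_le_norm _).trans ?_
    rw [norm_div, norm_mul, RCLike.norm_conj]
    have : a.re + b.re ≤ ‖a + (starRingEnd ℂ) b‖ := by
      refine le_trans (le_of_eq ?_) (Complex.re_le_norm _)
      simp
    gcongr
  have h2 : 2 * (‖A‖ * ‖B‖ / (a.re + b.re)) ≤ ‖A‖ ^ 2 / (2 * a.re) + ‖B‖ ^ 2 / (2 * b.re) := by
    rw [← sub_nonneg]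
    have : ‖A‖ ^ 2 / (2 * a.re) + ‖B‖ ^ 2 / (2 * b.re) - 2 * (‖A‖ * ‖B‖ / (a.re + b.re)) =
        ((‖A‖ * b.re - ‖B‖ * a.re) ^ 2 + a.re * b.re * (‖A‖ - ‖B‖) ^ 2) /
          (2 * a.re * b.re * (a.re + b.re)) := by
      field_simp
      ring
    rw [this]
    positivity
  linarith

/-- Evaluating the identity of `kernel_aux` on the vector (1, -1) gives 2 Re z · Q = (positive
number), where Q ≥ 0 by `gram_aux`. Hence Re z > 0. -/
lemma re_pos_of_mem_zFiber {z a b : ℂ} (ha : a ∈ zFiber z) (hb : b ∈ zFiber z) (hab : a ≠ b)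
    (ha0 : 0 < a.re) (hb0 : 0 < b.re) : 0 < z.re := by
  set c := starRingEnd ℂ
  have hsum : ∀ {x y : ℂ}, 0 < x.re → 0 < y.re → x + c y ≠ 0 := by
    intro x y hx hy h
    have := congrArg Complex.re h
    simp [c] at this
    linarith
  have kaa := kernel_aux ha (conj_mem_zFiber ha) (hsum ha0 ha0)
  have kab := kernel_aux ha (conj_mem_zFiber hb) (hsum ha0 hb0)
  have kba := kernel_aux hb (conj_mem_zFiber ha) (hsum hb0 ha0)
  have kbb := kernel_aux hb (conj_mem_zFiber hb) (hsum hb0 hb0)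
  set A := a ^ 2 - 1
  set B := b ^ 2 - 1
  have cA : c a ^ 2 - 1 = c A := by simp [A]
  have cB : c b ^ 2 - 1 = c B := by simp [B]
  rw [cA] at kaa kba
  rw [cB] at kab kbb
  change (z + c z) * (A * c A / (a + c a)) = 1 / 3 * (A / a * (c A / c a) + 2 * (a * c a - 1)) at kaa
  change (z + c z) * (A * c B / (a + c b)) = 1 / 3 * (A / a * (c B / c b) + 2 * (a * c b - 1)) at kab
  change (z + c z) * (B * c A / (b + c a)) = 1 / 3 * (B / b * (c A / c a) + 2 * (b * c a - 1)) at kba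
  change (z + c z) * (B * c B / (b + c b)) = 1 / 3 * (B / b * (c B / c b) + 2 * (b * c b - 1)) at kbb
  have key : (z + c z) * (A * c A / (a + c a) + B * c B / (b + c b)
      - (A * c B / (a + c b) + B * c A / (b + c a))) =
      1 / 3 * ((A / a - B / b) * c (A / a - B / b) + 2 * ((a - b) * c (a - b))) := by
    simp only [map_sub, map_div₀]
    linear_combination kaa + kbb - kab - kba
  have e1 : A * c A / (a + c a) = ((‖A‖ ^ 2 / (2 * a.re) : ℝ) : ℂ) := by
    rw [Complex.mul_conj', Complex.add_conj]; push_cast; ring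
  have e2 : B * c B / (b + c b) = ((‖B‖ ^ 2 / (2 * b.re) : ℝ) : ℂ) := by
    rw [Complex.mul_conj', Complex.add_conj]; push_cast; ring
  have e3 : A * c B / (a + c b) + B * c A / (b + c a) =
      ((2 * (A * c B / (a + c b)).re : ℝ) : ℂ) := by
    rw [← Complex.add_conj]
    simp [c, mul_comm, add_comm]
  rw [e1, e2, e3, Complex.mul_conj', Complex.mul_conj', Complex.add_conj] at key
  have key' : 2 * z.re * (‖A‖ ^ 2 / (2 * a.re) + ‖B‖ ^ 2 / (2 * b.re)
      - 2 * (A * c B / (a + c b)).re) = 1 / 3 * (‖A / a - B / b‖ ^ 2 + 2 * ‖a - b‖ ^ 2) := by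
    have : ((1 / 3 : ℝ) : ℂ) = 1 / 3 := by norm_num
    rw [← this] at key
    exact_mod_cast key
  have hpos : 0 < 1 / 3 * (‖A / a - B / b‖ ^ 2 + 2 * ‖a - b‖ ^ 2) := by
    have : 0 < ‖a - b‖ := norm_pos_iff.2 (sub_ne_zero.2 hab)
    positivity
  rw [← key'] at hpos
  have := pos_of_mul_pos_left hpos (gram_aux ha0 hb0)
  linarith

/-- The real part of (uv + s(u + v)) · conj(u + v) = -conj(u + v) is a vanishing sum of real parts
with nonnegative weights. All terms are ≤ 0, and the weight of Re u is at least 1. -/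
lemma IsRootTriple.re_eq_zero {z u v s : ℂ} (h : IsRootTriple z u v s) (hu : u.re ≤ 0)
    (hv : v.re ≤ 0) (hs : s.re ≤ 0) : u.re = 0 := by
  have h1 := congrArg (fun w : ℂ => (w * (starRingEnd ℂ) (u + v)).re) h.sum_mul
  simp only [Complex.mul_re, Complex.add_re, Complex.conj_re, Complex.conj_im, Complex.add_im,
    Complex.mul_im, map_add, Complex.neg_re, Complex.one_re, Complex.neg_im, Complex.one_im] at h1
  have h2 : s.re * ((u.re + v.re) ^ 2 + (u.im + v.im) ^ 2) + u.re * (1 + v.re ^ 2 + v.im ^ 2)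
    + v.re * (1 + u.re ^ 2 + u.im ^ 2) = 0 := by linear_combination h1
  have h3 : s.re * ((u.re + v.re) ^ 2 + (u.im + v.im) ^ 2) ≤ 0 :=
    mul_nonpos_of_nonpos_of_nonneg hs (by positivity)
  have h4 : v.re * (1 + u.re ^ 2 + u.im ^ 2) ≤ 0 :=
    mul_nonpos_of_nonpos_of_nonneg hv (by positivity)
  nlinarith [sq_nonneg v.re, sq_nonneg v.im]

/-- Otherwise all three points are purely imaginary. For the imaginary parts the elementary
symmetric functions satisfy e₂ = 1 and e₁ = 3e₃, while 3e₂ ≤ e₁² and 3e₁e₃ ≤ e₂² hold for all reals;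
these give 3 ≤ e₁² ≤ 1. -/
lemma IsRootTriple.exists_re_pos {z u v s : ℂ} (h : IsRootTriple z u v s) :
    0 < u.re ∨ 0 < v.re ∨ 0 < s.re := by
  by_contra! hc
  obtain ⟨hu, hv, hs⟩ := hc
  have h1 := h.re_eq_zero hu hv hs
  have h2 := h.rotate.re_eq_zero hv hs hu
  have h3 := h.rotate.rotate.re_eq_zero hs hu hv
  have e2 := congrArg Complex.re h.sum_mul
  have e13 : u + v + s = -3 * (u * v * s) :=
    mul_left_cancel₀ h.ne_zero (by linear_combination h.sum + 3 * h.prod)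
  have e13' := congrArg Complex.im e13
  simp [h1, h2, h3] at e2 e13'
  set α := u.im
  set β := v.im
  set γ := s.im
  have i1 : 3 * (α * β + α * γ + β * γ) ≤ (α + β + γ) ^ 2 := by
    nlinarith [sq_nonneg (α - β), sq_nonneg (α - γ), sq_nonneg (β - γ)]
  have i2 : 3 * (α + β + γ) * (α * β * γ) ≤ (α * β + α * γ + β * γ) ^ 2 := by
    nlinarith [sq_nonneg (α * β - α * γ), sq_nonneg (α * β - β * γ), sq_nonneg (α * γ - β * γ)]
  have e2' : α * β + α * γ + β * γ = 1 := by linarith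
  have i3 : 3 * (α + β + γ) * (α * β * γ) = (α + β + γ) ^ 2 := by
    linear_combination (-(α + β + γ)) * e13'
  rw [e2'] at i1 i2
  linarith

lemma inv_sqrt_three_sq : ((1 / Real.sqrt 3 : ℝ) : ℂ) ^ 2 = 1 / 3 := by
  rw [← Complex.ofReal_pow, div_pow, Real.sq_sqrt (by norm_num)]
  norm_num

lemma exists_mem_zFiber_re_pos (z : ℂ) : ∃ w ∈ zFiber z, 0 < w.re := by
  by_cases hz : z = 0
  · refine ⟨((1 / Real.sqrt 3 : ℝ) : ℂ), ?_, ?_⟩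
    · rw [mem_zFiber_iff, hz, inv_sqrt_three_sq]; ring
    · rw [Complex.ofReal_re]; positivity
  · obtain ⟨u, v, s, h⟩ := exists_isRootTriple hz
    rcases h.exists_re_pos with h1 | h1 | h1
    · exact ⟨u, by simp [h.mem_iff], h1⟩
    · exact ⟨v, by simp [h.mem_iff], h1⟩
    · exact ⟨s, by simp [h.mem_iff], h1⟩

/-- The first factor is the derivative of the cubic at w, so double points of fibers satisfy w⁴ =
-1/3. -/
lemma deriv_mul_eq {z w : ℂ} (h : w ∈ zFiber z) :
    (3 * z * w ^ 2 - 2 * w - z) * (w * (w ^ 2 - 1)) = w ^ 4 + 1 / 3 := by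
  rw [mem_zFiber_iff] at h
  linear_combination (3 * w ^ 2 - 1) * h

lemma re_pos_of_critical {z w : ℂ} (h : w ∈ zFiber z) (hw : 0 < w.re) (hc : w ^ 4 = -1 / 3) :
    0 < z.re := by
  have hsq : (w ^ 2).re = 0 ∧ (w ^ 2).im ^ 2 = 1 / 3 := by
    have h1 := congrArg Complex.re (show w ^ 2 * w ^ 2 = -1 / 3 by rw [← hc]; ring)
    have h2 := congrArg Complex.im (show w ^ 2 * w ^ 2 = -1 / 3 by rw [← hc]; ring)
    simp only [Complex.mul_re, Complex.mul_im] at h1 h2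
    have h3 : ((-1 / 3 : ℂ)).re = -1 / 3 := by norm_num
    have h4 : ((-1 / 3 : ℂ)).im = 0 := by norm_num
    rw [h3] at h1
    rw [h4] at h2
    have h5 : (w ^ 2).re = 0 := by
      by_contra h6
      have : (w ^ 2).im = 0 := by
        have : (w ^ 2).re * (w ^ 2).im = 0 := by linarith
        exact (mul_eq_zero.1 this).resolve_left h6
      nlinarith [sq_nonneg (w ^ 2).re]
    exact ⟨h5, by rw [h5] at h1; linarith⟩
  obtain ⟨hre, him⟩ := hsq
  set y := (w ^ 2).im with hy
  have hq : w ^ 2 = (y : ℂ) * Complex.I := by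
    apply Complex.ext <;> simp [hre, hy]
  have hab : w.re ^ 2 = w.im ^ 2 := by
    have : (w ^ 2).re = w.re ^ 2 - w.im ^ 2 := by rw [sq, Complex.mul_re]; ring
    linarith
  obtain ⟨h0, hz⟩ := h
  rw [← hz, zMap, hq, Complex.div_re, ← add_div]
  apply div_pos
  · rw [hq] at h0
    simp
    -- Here w² = iy with |y| = 1/√3, so |Re w| = |Im w|; the bound |y| < 1 makes Re w dominate in
    -- the numerator of Re z.
    have hy1 : |y| < 1 := by
      rw [← sq_lt_one_iff_abs_lt_one, him]; norm_num
    have hb : |w.im| = w.re := by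
      rw [← abs_of_pos hw]; exact (sq_eq_sq_iff_abs_eq_abs _ _).1 hab.symm
    have : y * w.im < w.re := by
      calc y * w.im ≤ |y * w.im| := le_abs_self _
        _ = |y| * w.re := by rw [abs_mul, hb]
        _ < 1 * w.re := by gcongr
        _ = w.re := one_mul _
    nlinarith
  · rw [← hq]; exact Complex.normSq_pos.2 h0

/-- A point of the fiber over `z` in the right half-plane. -/
def rightRoot (z : ℂ) : ℂ := (exists_mem_zFiber_re_pos z).choose

lemma rightRoot_mem (z : ℂ) : rightRoot z ∈ zFiber z := (exists_mem_zFiber_re_pos z).choose_spec.1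

lemma rightRoot_re_pos (z : ℂ) : 0 < (rightRoot z).re :=
  (exists_mem_zFiber_re_pos z).choose_spec.2

lemma eq_rightRoot {z w : ℂ} (hz : z.re ≤ 0) (hw : w ∈ zFiber z) (hw0 : 0 < w.re) :
    w = rightRoot z := by
  by_contra h
  exact absurd (re_pos_of_mem_zFiber hw (rightRoot_mem z) h hw0 (rightRoot_re_pos z)) hz.not_gt

lemma rightRoot_simple {z : ℂ} (hz : z.re ≤ 0) :
    3 * z * rightRoot z ^ 2 - 2 * rightRoot z - z ≠ 0 := by
  intro h
  have h1 := deriv_mul_eq (rightRoot_mem z)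
  rw [h, zero_mul] at h1
  exact hz.not_gt (re_pos_of_critical (rightRoot_mem z) (rightRoot_re_pos z)
    (by linear_combination -h1))

lemma hasDerivAt_zMap {w : ℂ} (h : w * (w ^ 2 - 1) ≠ 0) :
    HasDerivAt zMap (-(w ^ 4 + 1 / 3) / (w * (w ^ 2 - 1)) ^ 2) w := by
  have h1 : HasDerivAt (fun w : ℂ => w ^ 2 - 1 / 3) (2 * w) w := by
    simpa using (hasDerivAt_pow 2 w).sub_const (1 / 3)
  have h2 : HasDerivAt (fun w : ℂ => w * (w ^ 2 - 1)) (1 * (w ^ 2 - 1) + w * (2 * w)) w := by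
    simpa using (hasDerivAt_id' w).fun_mul ((hasDerivAt_pow 2 w).sub_const 1)
  refine (h1.div h2 h).congr_deriv ?_
  congr 1
  ring

lemma analyticAt_zMap {w : ℂ} (h : w * (w ^ 2 - 1) ≠ 0) : AnalyticAt ℂ zMap w := by
  unfold zMap
  fun_prop (disch := assumption)

/-- A simple point of a fiber extends to an analytic local inverse. -/
lemma exists_local_branch {z w : ℂ} (h : w ∈ zFiber z) (hs : 3 * z * w ^ 2 - 2 * w - z ≠ 0) :
    ∃ φ : ℂ → ℂ, AnalyticAt ℂ φ z ∧ φ z = w ∧ ∀ᶠ x in 𝓝 z, φ x ∈ zFiber x := by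
  have hA := analyticAt_zMap h.1
  have hd : deriv zMap w ≠ 0 := by
    rw [(hasDerivAt_zMap h.1).deriv, ← deriv_mul_eq h]
    exact div_ne_zero (neg_ne_zero.2 (mul_ne_zero hs h.1)) (pow_ne_zero _ h.1)
  have h1 := hA.analyticAt_localInverse hd
  have h2 := hA.hasStrictDerivAt.eventually_right_inverse hd
  rw [h.2] at h1 h2
  set φ := hA.hasStrictDerivAt.localInverse _ _ _ hd
  have h3 : φ z = w := by
    rw [← h.2]; exact HasStrictFDerivAt.localInverse_apply_image ..
  refine ⟨φ, h1, h3, ?_⟩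
  have h4 : ∀ᶠ x in 𝓝 z, φ x * (φ x ^ 2 - 1) ≠ 0 := by
    have hc := h1.continuousAt
    have : ContinuousAt (fun x => φ x * (φ x ^ 2 - 1)) z := by fun_prop
    exact this.eventually_ne (by rw [h3]; exact h.1)
  filter_upwards [h2, h4] with x hx2 hx4 using ⟨hx4, hx2⟩

/-- The local inverse through `rightRoot z` stays in the right half-plane, hence agrees with
`rightRoot` wherever uniqueness holds. For z on the imaginary axis it also provides an analytic
continuation to the other side. -/
lemma exists_rightRoot_branch {z : ℂ} (hz : z.re ≤ 0) :
    ∃ φ : ℂ → ℂ, AnalyticAt ℂ φ z ∧ (∀ᶠ x in 𝓝 z, φ x ∈ zFiber x) ∧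
      ∀ᶠ x in 𝓝 z, x.re ≤ 0 → rightRoot x = φ x := by
  obtain ⟨φ, h1, h2, h3⟩ := exists_local_branch (rightRoot_mem z) (rightRoot_simple hz)
  refine ⟨φ, h1, h3, ?_⟩
  have h4 : ∀ᶠ x in 𝓝 z, 0 < (φ x).re := by
    have : ContinuousAt (fun x => (φ x).re) z := Complex.continuous_re.continuousAt.comp
      h1.continuousAt
    exact this.eventually (lt_mem_nhds (by simpa [h2] using rightRoot_re_pos z))
  filter_upwards [h3, h4] with x h5 h6 h7 using (eq_rightRoot h7 h5 h6).symm

lemma analyticAt_rightRoot {z : ℂ} (hz : z.re < 0) : AnalyticAt ℂ rightRoot z := by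
  obtain ⟨φ, h1, -, h2⟩ := exists_rightRoot_branch hz.le
  refine h1.congr ?_
  filter_upwards [h2, (isOpen_lt Complex.continuous_re continuous_const).mem_nhds hz] with x hx h3
  exact (hx (le_of_lt h3)).symm

lemma continuousOn_rightRoot : ContinuousOn rightRoot {z | z.re ≤ 0} := by
  intro z hz
  obtain ⟨φ, h1, -, h2⟩ := exists_rightRoot_branch hz
  refine (h1.continuousAt.continuousWithinAt).congr_of_eventuallyEq ?_ (h2.self_of_nhds hz)
  filter_upwards [mem_nhdsWithin_of_mem_nhds h2, self_mem_nhdsWithin] with x hx h3 using hx h3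

/-- The factored cubic at w = 1 shows that |z| times the product of the three distances from 1 to
the fiber is 2/3. For large |z| some fiber point is therefore closer to 1 than r ≤ 1, hence in the
right half-plane, hence equal to `rightRoot z`. -/
lemma tendsto_rightRoot :
    Tendsto rightRoot (Bornology.cobounded ℂ ⊓ 𝓟 {z | z.re ≤ 0}) (𝓝 1) := by
  rw [Metric.tendsto_nhds]
  intro ε hε
  set r := min ε 1 with hr
  have hr0 : 0 < r := lt_min hε one_pos
  rw [eventually_inf_principal]
  have hlarge : ∀ᶠ z : ℂ in Bornology.cobounded ℂ, 1 / r ^ 3 < ‖z‖ :=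
    tendsto_norm_cobounded_atTop.eventually_gt_atTop _
  filter_upwards [hlarge] with z hz hre
  have hz0 : z ≠ 0 := by
    rintro rfl
    rw [norm_zero] at hz
    exact absurd hz (not_lt.2 (by positivity))
  obtain ⟨u, v, s, h⟩ := exists_isRootTriple hz0
  have hprod : ‖z‖ * (‖1 - u‖ * ‖1 - v‖ * ‖1 - s‖) = 2 / 3 := by
    have := congrArg norm (h.factor 1)
    rw [norm_mul, norm_mul, norm_mul] at this
    rw [← this]
    norm_num
  have hmem : ∃ w ∈ zFiber z, ‖1 - w‖ < r := by
    by_contra! hc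
    have h1 := hc u (by simp [h.mem_iff])
    have h2 := hc v (by simp [h.mem_iff])
    have h3 := hc s (by simp [h.mem_iff])
    have h4 : r ^ 3 ≤ ‖1 - u‖ * ‖1 - v‖ * ‖1 - s‖ := by
      rw [pow_succ, sq]
      gcongr
    have h5 : 1 < ‖z‖ * r ^ 3 := by
      rwa [div_lt_iff₀ (by positivity)] at hz
    have h6 : ‖z‖ * r ^ 3 ≤ ‖z‖ * (‖1 - u‖ * ‖1 - v‖ * ‖1 - s‖) := by gcongr
    linarith
  obtain ⟨w, hw, hwr⟩ := hmem
  have hw1 : 0 < w.re := by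
    have : (1 - w).re ≤ ‖1 - w‖ := Complex.re_le_norm _
    have h2 : r ≤ 1 := min_le_right _ _
    simp at this
    linarith
  rw [← eq_rightRoot hre hw hw1, dist_comm, dist_eq_norm]
  exact hwr.trans_le (min_le_left _ _)

lemma rightRoot_zero : rightRoot 0 = ((1 / Real.sqrt 3 : ℝ) : ℂ) := by
  refine (eq_rightRoot (by simp) ?_ ?_).symm
  · rw [mem_zFiber_iff, inv_sqrt_three_sq]; ring
  · rw [Complex.ofReal_re]; positivity

/-! ### Integrals depending on a complex parameter -/

lemma hasDerivAt_intervalIntegral_of_continuousOn {U : Set ℂ} (hU : IsOpen U) {F F' : ℂ → ℝ → ℂ}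
    (hF : ContinuousOn (Function.uncurry F) (U ×ˢ Icc 0 1))
    (hF' : ContinuousOn (Function.uncurry F') (U ×ˢ Icc 0 1))
    (hd : ∀ z ∈ U, ∀ t ∈ Icc (0 : ℝ) 1, HasDerivAt (fun z => F z t) (F' z t) z) {z : ℂ}
    (hz : z ∈ U) :
    HasDerivAt (fun z => ∫ t in (0 : ℝ)..1, F z t) (∫ t in (0 : ℝ)..1, F' z t) z := by
  have sec : ∀ {G : ℂ → ℝ → ℂ}, ContinuousOn (Function.uncurry G) (U ×ˢ Icc 0 1) → ∀ x ∈ U,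
      ContinuousOn (G x) (Icc 0 1) := by
    intro G hG x hx
    exact hG.comp (f := fun t : ℝ => (x, t)) (by fun_prop) fun t ht => ⟨hx, ht⟩
  have hint : ∀ {G : ℂ → ℝ → ℂ}, ContinuousOn (Function.uncurry G) (U ×ˢ Icc 0 1) → ∀ x ∈ U,
      IntervalIntegrable (G x) volume 0 1 := fun hG x hx =>
    ContinuousOn.intervalIntegrable (by rw [uIcc_of_le zero_le_one]; exact sec hG x hx)
  obtain ⟨ε, hε, hball⟩ := Metric.nhds_basis_closedBall.mem_iff.1 (hU.mem_nhds hz)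
  have hK : IsCompact (Metric.closedBall z ε ×ˢ Icc (0 : ℝ) 1) :=
    (isCompact_closedBall z ε).prod isCompact_Icc
  obtain ⟨M, hM⟩ := hK.exists_bound_of_continuousOn
    (hF'.mono (prod_mono hball subset_rfl))
  have hI : ∀ t, t ∈ uIoc (0 : ℝ) 1 → t ∈ Icc (0 : ℝ) 1 := by
    intro t ht
    rw [uIoc_of_le zero_le_one] at ht
    exact Ioc_subset_Icc_self ht
  refine (intervalIntegral.hasDerivAt_integral_of_dominated_loc_of_deriv_le (bound := fun _ => M)
    (Metric.closedBall_mem_nhds z hε) ?_ (hint hF z hz) (hint hF' z hz).def'.aestronglyMeasurable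
    ?_ (by simp) ?_).2
  · filter_upwards [hU.mem_nhds hz] with x hx using (hint hF x hx).def'.aestronglyMeasurable
  · exact Eventually.of_forall fun t ht x hx => hM (x, t) ⟨hx, hI t ht⟩
  · exact Eventually.of_forall fun t ht x hx => hd x (hball hx) t (hI t ht)

/-! ### The square root of `(z - a) (z - b)` off an arc from `a` to `b` -/

/-- A branch of `log ((γ 1 - z) / (γ 0 - z))` off the trace of `γ`. -/
def arcLog (γ : ℝ → ℂ) (z : ℂ) : ℂ := ∫ t in (0 : ℝ)..1, deriv γ t / (γ t - z)

/-- A branch of `√((z - γ 0) (z - γ 1))` off the trace of `γ`. -/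
def arcSqrt (γ : ℝ → ℂ) (z : ℂ) : ℂ := (z - γ 0) * Complex.exp (arcLog γ z / 2)

namespace IsAnalyticArc

variable {γ : ℝ → ℂ} {a b : ℂ}

lemma continuousOn (h : IsAnalyticArc γ a b) : ContinuousOn γ (Icc 0 1) :=
  h.analytic.continuousOn

lemma continuousOn_deriv (h : IsAnalyticArc γ a b) : ContinuousOn (deriv γ) (Icc 0 1) :=
  h.analytic.deriv.continuousOn

lemma isCompact_trace (h : IsAnalyticArc γ a b) : IsCompact (trace γ) :=
  isCompact_Icc.image_of_continuousOn h.continuousOn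

lemma isOpen_compl_trace (h : IsAnalyticArc γ a b) : IsOpen (trace γ)ᶜ :=
  h.isCompact_trace.isClosed.isOpen_compl

lemma differentiableOn_arcLog (h : IsAnalyticArc γ a b) :
    DifferentiableOn ℂ (arcLog γ) (trace γ)ᶜ := by
  intro z hz
  have hne : ∀ p ∈ (trace γ)ᶜ ×ˢ Icc (0 : ℝ) 1, γ p.2 - p.1 ≠ 0 := by
    rintro ⟨x, t⟩ ⟨hx, ht⟩ h0
    exact hx ⟨t, ht, sub_eq_zero.1 h0⟩
  have h1 : ContinuousOn (fun p : ℂ × ℝ => γ p.2 - p.1) ((trace γ)ᶜ ×ˢ Icc (0 : ℝ) 1) :=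
    (h.continuousOn.comp continuousOn_snd fun p hp => hp.2).sub continuousOn_fst
  have h2 : ContinuousOn (fun p : ℂ × ℝ => deriv γ p.2) ((trace γ)ᶜ ×ˢ Icc (0 : ℝ) 1) :=
    h.continuousOn_deriv.comp continuousOn_snd fun p hp => hp.2
  refine (hasDerivAt_intervalIntegral_of_continuousOn h.isOpen_compl_trace
    (F := fun z t => deriv γ t / (γ t - z)) (F' := fun z t => deriv γ t / (γ t - z) ^ 2)
    (h2.div₀ h1 hne) (h2.div₀ (h1.pow 2) fun p hp => pow_ne_zero 2 (hne p hp)) ?_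
    hz).differentiableAt.differentiableWithinAt
  intro x hx t ht
  have := (hasDerivAt_const x (deriv γ t)).div ((hasDerivAt_id' x).const_sub (γ t))
    (hne (x, t) ⟨hx, ht⟩)
  refine this.congr_deriv ?_
  ring

/-- The function exp(-∫₀ᵗ γ'/(γ - z)) · (γ(t) - z) has derivative 0, so its values at the two ends
agree. -/
lemma exp_arcLog (h : IsAnalyticArc γ a b) {z : ℂ} (hz : z ∉ trace γ) :
    Complex.exp (arcLog γ z) * (a - z) = b - z := by
  have hne : ∀ t ∈ Icc (0 : ℝ) 1, γ t - z ≠ 0 := fun t ht h0 => hz ⟨t, ht, sub_eq_zero.1 h0⟩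
  set f : ℝ → ℂ := fun t => deriv γ t / (γ t - z) with hf
  have hfa : ∀ t ∈ Icc (0 : ℝ) 1, AnalyticAt ℝ f t := fun t ht =>
    (h.analytic t ht).deriv.div ((h.analytic t ht).sub analyticAt_const) (hne t ht)
  have hfc : ContinuousOn f (Icc 0 1) := fun t ht => (hfa t ht).continuousAt.continuousWithinAt
  have hI : ∀ t ∈ Icc (0 : ℝ) 1, HasDerivAt (fun t => ∫ s in (0 : ℝ)..t, f s) (f t) t := by
    intro t ht
    refine intervalIntegral.integral_hasDerivAt_right ?_ ?_ (hfa t ht).continuousAt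
    · refine (hfc.mono ?_).intervalIntegrable
      rw [uIcc_of_le ht.1]
      exact Icc_subset_Icc_right ht.2
    · obtain ⟨V, hV, hVo, htV⟩ := eventually_nhds_iff.1 (hfa t ht).eventually_analyticAt
      exact ContinuousAt.stronglyMeasurableAtFilter hVo (fun x hx => (hV x hx).continuousAt) t htV
  have hc : ∀ t ∈ Icc (0 : ℝ) 1, HasDerivAt
      (fun t => Complex.exp (-∫ s in (0 : ℝ)..t, f s) * (γ t - z)) 0 t := by
    intro t ht
    have h1 : HasDerivAt γ (deriv γ t) t := (h.analytic t ht).differentiableAt.hasDerivAt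
    refine (((hI t ht).neg.cexp).mul (h1.sub_const z)).congr_deriv ?_
    have : f t * (γ t - z) = deriv γ t := div_mul_cancel₀ _ (hne t ht)
    simp only [Pi.neg_apply]
    linear_combination (-Complex.exp (-∫ s in (0 : ℝ)..t, f s)) * this
  have hconst := constant_of_has_deriv_right_zero (a := (0 : ℝ)) (b := 1)
    (fun t ht => (hc t ht).continuousAt.continuousWithinAt)
    (fun t ht => (hc t (Ico_subset_Icc_self ht)).hasDerivWithinAt) 1 (by simp)
  simp only [intervalIntegral.integral_same, neg_zero, Complex.exp_zero, one_mul, h.source,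
    h.target] at hconst
  rw [← hconst, ← mul_assoc, ← Complex.exp_add]
  change Complex.exp (arcLog γ z + -arcLog γ z) * _ = _
  simp

lemma arcSqrt_sq (h : IsAnalyticArc γ a b) {z : ℂ} (hz : z ∉ trace γ) :
    arcSqrt γ z ^ 2 = (z - a) * (z - b) := by
  have h1 := h.exp_arcLog hz
  have h2 : Complex.exp (arcLog γ z / 2) ^ 2 = Complex.exp (arcLog γ z) := by
    rw [← Complex.exp_nat_mul]; congr 1; push_cast; ring
  rw [arcSqrt, mul_pow, h2, h.source]
  linear_combination (-(z - a)) * h1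

lemma analyticAt_arcSqrt (h : IsAnalyticArc γ a b) {z : ℂ} (hz : z ∉ trace γ) :
    AnalyticAt ℂ (arcSqrt γ) z := by
  have := h.differentiableOn_arcLog.analyticAt (h.isOpen_compl_trace.mem_nhds hz)
  unfold arcSqrt
  fun_prop

lemma tendsto_arcLog (h : IsAnalyticArc γ a b) :
    Tendsto (arcLog γ) (Bornology.cobounded ℂ) (𝓝 0) := by
  obtain ⟨M, hM⟩ := isCompact_Icc.exists_bound_of_continuousOn h.continuousOn_deriv
  obtain ⟨B, hB⟩ := isCompact_Icc.exists_bound_of_continuousOn h.continuousOn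
  have hlim : Tendsto (fun z : ℂ => M / (‖z‖ - B)) (Bornology.cobounded ℂ) (𝓝 0) :=
    (tendsto_const_nhds.div_atTop (tendsto_atTop_add_const_right _ (-B)
      tendsto_norm_cobounded_atTop))
  refine squeeze_zero_norm' ?_ hlim
  filter_upwards [tendsto_norm_cobounded_atTop.eventually_gt_atTop B] with z hz
  have := intervalIntegral.norm_integral_le_of_norm_le_const (a := (0 : ℝ)) (b := 1)
    (f := fun t => deriv γ t / (γ t - z)) (C := M / (‖z‖ - B)) ?_
  · simpa [arcLog] using this
  · intro t ht
    rw [uIoc_of_le zero_le_one] at ht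
    have ht' := Ioc_subset_Icc_self ht
    rw [norm_div]
    have h1 : ‖z‖ - B ≤ ‖γ t - z‖ := by
      have := norm_sub_norm_le z (γ t)
      rw [norm_sub_rev] at this
      linarith [hB t ht']
    have h2 : 0 ≤ M := (norm_nonneg _).trans (hM t ht')
    have h3 : 0 < ‖z‖ - B := sub_pos.2 hz
    gcongr
    exact hM t ht'

lemma tendsto_arcSqrt_div (h : IsAnalyticArc γ a b) :
    Tendsto (fun z => arcSqrt γ z / z) (Bornology.cobounded ℂ) (𝓝 1) := by
  have h1 : Tendsto (fun z => Complex.exp (arcLog γ z / 2)) (Bornology.cobounded ℂ) (𝓝 1) := by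
    have := (Complex.continuous_exp.tendsto _).comp (h.tendsto_arcLog.div_const 2)
    simpa [Function.comp_def] using this
  have h2 : Tendsto (fun z : ℂ => 1 - γ 0 * z⁻¹) (Bornology.cobounded ℂ) (𝓝 1) := by
    simpa using (tendsto_inv₀_cobounded (α := ℂ)).const_mul (γ 0) |>.const_sub 1
  have h3 := h2.mul h1
  rw [mul_one] at h3
  refine h3.congr' ?_
  filter_upwards [Bornology.eventually_ne_cobounded (0 : ℂ)] with z hz
  rw [arcSqrt]
  field_simp

end IsAnalyticArc

/-! ### The branch points -/

lemma omega24_sq : omega24 ^ 2 = (Real.sqrt 3 + Complex.I) / 2 := by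
  have : omega24 ^ 2 = Complex.exp (((Real.pi / 6 : ℝ) : ℂ) * Complex.I) := by
    rw [omega24, ← Complex.exp_nat_mul]
    congr 1
    push_cast
    ring
  rw [this, Complex.exp_mul_I, ← Complex.ofReal_cos, ← Complex.ofReal_sin, Real.cos_pi_div_six,
    Real.sin_pi_div_six]
  push_cast
  ring

lemma ofReal_sqrt_three_sq : ((Real.sqrt 3 : ℝ) : ℂ) ^ 2 = 3 := by
  rw [← Complex.ofReal_pow, Real.sq_sqrt (by norm_num)]
  norm_num

lemma omega24_pow_twelve : omega24 ^ 12 = -1 := by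
  have h : omega24 ^ 12 = Complex.exp (Real.pi * Complex.I) := by
    rw [omega24, ← Complex.exp_nat_mul]
    congr 1
    push_cast
    ring
  rw [h, Complex.exp_pi_mul_I]

lemma rho_sq : rho ^ 2 = ((1 / Real.sqrt 3 : ℝ) : ℂ) := by
  rw [rho, ← Complex.ofReal_pow, ← Real.rpow_natCast, ← Real.rpow_mul (by norm_num),
    Real.sqrt_eq_rpow, one_div (_ ^ _), ← Real.rpow_neg (by norm_num)]
  norm_num

lemma rho_sq_mul : rho ^ 2 * Real.sqrt 3 = 1 := by
  rw [rho_sq, ← Complex.ofReal_mul, one_div, inv_mul_cancel₀ (by positivity)]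
  norm_num

lemma z₁_mul_z₂ : z₁ * z₂ = rho ^ 2 := by
  have : z₁ * z₂ = rho ^ 2 * (omega24 ^ 12) ^ 2 := by unfold z₁ z₂; ring
  rw [this, omega24_pow_twelve]
  ring

lemma z₁_sq_add_z₂_sq : z₁ ^ 2 + z₂ ^ 2 = -1 := by
  have h1 : omega24 ^ 10 * omega24 ^ 2 = -1 := by rw [← pow_add, omega24_pow_twelve]
  have h2 : omega24 ^ 10 = -((Real.sqrt 3 - Complex.I) / 2) := by
    have h3 : omega24 ^ 2 * ((Real.sqrt 3 - Complex.I) / 2) = 1 := by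
      rw [omega24_sq]
      linear_combination (1 / 4) * ofReal_sqrt_three_sq - (1 / 4) * Complex.I_sq
    linear_combination ((Real.sqrt 3 - Complex.I) / 2) * h1 - omega24 ^ 10 * h3
  have : z₁ ^ 2 + z₂ ^ 2 = rho ^ 2 * (omega24 ^ 2 * omega24 ^ 12
      + omega24 ^ 10 * (omega24 ^ 12) ^ 2) := by
    unfold z₁ z₂; ring
  rw [this, omega24_pow_twelve, omega24_sq, h2]
  linear_combination -rho_sq_mul

lemma z₃_eq : z₃ = -z₁ := by
  have : z₃ = z₁ * omega24 ^ 12 := by unfold z₃ z₁; ring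
  rw [this, omega24_pow_twelve]
  ring

lemma z₄_eq : z₄ = -z₂ := by
  have : z₂ = z₄ * omega24 ^ 12 := by unfold z₄ z₂; ring
  rw [this, omega24_pow_twelve]
  ring

lemma discriminant_eq (z : ℂ) :
    (z - z₁) * (z - z₂) * ((z + z₁) * (z + z₂)) = z ^ 4 + z ^ 2 + 1 / 3 := by
  have h := inv_sqrt_three_sq
  rw [← rho_sq] at h
  linear_combination (-z ^ 2) * z₁_sq_add_z₂_sq + (z₁ * z₂ + rho ^ 2) * z₁_mul_z₂ + h

/-! ### The three inverse functions -/

lemma IsRootTriple.neg {z u v s : ℂ} (h : IsRootTriple z u v s) :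
    IsRootTriple (-z) (-u) (-v) (-s) :=
  ⟨by linear_combination h.sum, by linear_combination h.sum_mul, by linear_combination h.prod⟩

/-- If u, v are the other two fiber points, the first factor is z²(u - v)² and the second is z²(s -
u)²(s - v)². The product is the discriminant of the cubic, so (u - v)² is known once s is. -/
lemma discriminant_identity {z s : ℂ} (h : s ∈ zFiber z) :
    (1 + 2 * z * s - 3 * z ^ 2 * s ^ 2 + 4 * z ^ 2) * (3 * z * s ^ 2 - 2 * s - z) ^ 2 =
      4 * (z ^ 4 + z ^ 2 + 1 / 3) := by
  rw [mem_zFiber_iff] at h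
  linear_combination (-27 * z ^ 3 * s ^ 3 + 27 * z ^ 2 * s ^ 2 + 27 * s * z ^ 3 - 9 * z ^ 2 - 4) * h

/-- The factor 1 - zs - 2zl is z times the third fiber point minus l. In contrast to
`discriminant_identity`, this displays an actual square root, whose sign can be compared with
`discSqrt`. -/
lemma discriminant_identity_of_ne {z s l : ℂ} (h : s ∈ zFiber z) (hl : l ∈ zFiber z) (hne : l ≠ s) :
    ((3 * z * s ^ 2 - 2 * s - z) * (1 - z * s - 2 * z * l)) ^ 2 =
      4 * (z ^ 4 + z ^ 2 + 1 / 3) := by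
  rw [← discriminant_identity h]
  rw [mem_zFiber_iff] at h hl
  have h1 : z * (l ^ 2 + l * s + s ^ 2 - 1) = l + s :=
    mul_left_cancel₀ (sub_ne_zero.2 hne) (by linear_combination hl - h)
  linear_combination (4 * z * (3 * z * s ^ 2 - 2 * s - z) ^ 2) * h1

/-- A branch of `√(z⁴ + z² + 1/3)` off the trace of `γ` and its reflection. -/
def discSqrt (γ : ℝ → ℂ) (z : ℂ) : ℂ := -(arcSqrt γ z * arcSqrt γ (-z))

/-- The difference `ψ_Q - ψ_P` in the left half-plane. -/
def rootGap (γ : ℝ → ℂ) (z : ℂ) : ℂ :=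
  2 * discSqrt γ z / (z * (3 * z * rightRoot z ^ 2 - 2 * rightRoot z - z))

open Classical in
/-- The inverse function that tends to `-1` at infinity. -/
def psiP (γ : ℝ → ℂ) (z : ℂ) : ℂ :=
  if 0 ≤ z.re then -rightRoot (-z) else (1 / z - rightRoot z - rootGap γ z) / 2

/-- The inverse function that tends to `1` at infinity. -/
def psiR (γ : ℝ → ℂ) (z : ℂ) : ℂ := -psiP γ (-z)

/-- The inverse function that tends to `0` at infinity. -/
def psiQ (γ : ℝ → ℂ) (z : ℂ) : ℂ := 1 / z - psiP γ z - psiR γ z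

variable {γ : ℝ → ℂ}

lemma psiP_neg (z : ℂ) : psiP γ (-z) = -psiR γ z := by simp [psiR]

lemma psiR_neg (z : ℂ) : psiR γ (-z) = -psiP γ z := by simp [psiR]

lemma psiQ_neg (z : ℂ) : psiQ γ (-z) = -psiQ γ z := by
  rw [psiQ, psiQ, psiP_neg, psiR_neg, div_neg]
  ring

lemma psiP_of_nonneg {z : ℂ} (hz : 0 ≤ z.re) : psiP γ z = -rightRoot (-z) := if_pos hz

lemma psiP_of_neg {z : ℂ} (hz : z.re < 0) :
    psiP γ z = (1 / z - rightRoot z - rootGap γ z) / 2 := if_neg hz.not_ge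

lemma psiR_of_nonpos {z : ℂ} (hz : z.re ≤ 0) : psiR γ z = rightRoot z := by
  rw [psiR, psiP_of_nonneg (by simpa using hz)]
  simp

lemma psiQ_sub_psiP_of_neg {z : ℂ} (hz : z.re < 0) : psiQ γ z - psiP γ z = rootGap γ z := by
  rw [psiQ, psiR_of_nonpos hz.le, psiP_of_neg hz]
  ring

lemma discSqrt_sq (hγ : IsAnalyticArc γ z₁ z₂) {z : ℂ} (hz : z ∉ trace γ) (hz' : -z ∉ trace γ) :
    discSqrt γ z ^ 2 = z ^ 4 + z ^ 2 + 1 / 3 := by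
  rw [discSqrt, neg_sq, mul_pow, hγ.arcSqrt_sq hz, hγ.arcSqrt_sq hz', ← discriminant_eq]
  ring

lemma discriminant_ne_zero (hγ : IsAnalyticArc γ z₁ z₂) {z : ℂ}
    (hz : ∀ t ∈ ({0, 1} : Set ℝ), z ≠ γ t) (hz' : ∀ t ∈ ({0, 1} : Set ℝ), -z ≠ γ t) :
    z ^ 4 + z ^ 2 + 1 / 3 ≠ 0 := by
  have h1 := hz 0 (by simp)
  have h2 := hz 1 (by simp)
  have h3 := hz' 0 (by simp)
  have h4 := hz' 1 (by simp)
  rw [hγ.source] at h1 h3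
  rw [hγ.target] at h2 h4
  rw [← discriminant_eq]
  refine mul_ne_zero (mul_ne_zero (sub_ne_zero.2 h1) (sub_ne_zero.2 h2)) (mul_ne_zero ?_ ?_)
  · intro h; exact h3 (by linear_combination -h)
  · intro h; exact h4 (by linear_combination -h)

lemma ne_of_notMem_trace {z : ℂ} (hz : z ∉ trace γ) : ∀ t ∈ ({0, 1} : Set ℝ), z ≠ γ t := by
  rintro t ht rfl
  refine hz ⟨t, ?_, rfl⟩
  rcases ht with rfl | rfl <;> simp

lemma discSqrt_ne_zero (hγ : IsAnalyticArc γ z₁ z₂) {z : ℂ} (hz : z ∉ trace γ)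
    (hz' : -z ∉ trace γ) : discSqrt γ z ≠ 0 := by
  intro h
  have h1 := discSqrt_sq hγ hz hz'
  rw [h, zero_pow two_ne_zero] at h1
  exact discriminant_ne_zero hγ (ne_of_notMem_trace hz) (ne_of_notMem_trace hz') h1.symm

lemma analyticAt_discSqrt (hγ : IsAnalyticArc γ z₁ z₂) {z : ℂ} (hz : z ∉ trace γ)
    (hz' : -z ∉ trace γ) : AnalyticAt ℂ (discSqrt γ) z := by
  have h1 := hγ.analyticAt_arcSqrt hz
  have h2 := (hγ.analyticAt_arcSqrt hz').comp_of_eq (f := fun x : ℂ => -x) (by fun_prop) rfl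
  exact (h1.mul h2).neg

lemma discSqrt_zero (hγ : IsAnalyticArc γ z₁ z₂) (h0 : (0 : ℂ) ∉ trace γ) :
    discSqrt γ 0 = -((1 / Real.sqrt 3 : ℝ) : ℂ) := by
  rw [discSqrt, neg_zero, ← sq, hγ.arcSqrt_sq h0, ← rho_sq, ← z₁_mul_z₂]
  ring

/-- Each arc root is asymptotic to its argument, so the product of those at z and -z is asymptotic
to -z². The minus sign in `discSqrt` makes the limit 1, which puts ψ_P, not ψ_Q, at -1 at infinity.
-/
lemma tendsto_discSqrt (hγ : IsAnalyticArc γ z₁ z₂) :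
    Tendsto (fun z => discSqrt γ z / z ^ 2) (Bornology.cobounded ℂ) (𝓝 1) := by
  have h := hγ.tendsto_arcSqrt_div
  have h2 := h.mul (h.comp (tendsto_neg_cobounded (E := ℂ)))
  rw [mul_one] at h2
  refine h2.congr fun z => ?_
  simp only [Function.comp_apply, discSqrt]
  rw [div_mul_div_comm, mul_neg, div_neg, neg_div, sq]

lemma isRootTriple_of_re_neg (hγ : IsAnalyticArc γ z₁ z₂) {z : ℂ} (hre : z.re < 0)
    (hz : z ∉ trace γ) (hz' : -z ∉ trace γ) :
    IsRootTriple z (psiR γ z) (psiP γ z) (psiQ γ z) ∧ psiP γ z ≠ psiQ γ z := by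
  have hz0 : z ≠ 0 := by rintro rfl; simp at hre
  have hs := rightRoot_simple hre.le
  have hid := discriminant_identity (rightRoot_mem z)
  have hgap : rootGap γ z * (z * (3 * z * rightRoot z ^ 2 - 2 * rightRoot z - z)) =
      2 * discSqrt γ z := div_mul_cancel₀ _ (mul_ne_zero hz0 hs)
  have hsq := discSqrt_sq hγ hz hz'
  have hne : rootGap γ z ≠ 0 := by
    intro h
    rw [h, zero_mul] at hgap
    exact discSqrt_ne_zero hγ hz hz' (by linear_combination (-1 / 2) * hgap)
  have hPQ := psiQ_sub_psiP_of_neg (γ := γ) hre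
  refine ⟨?_, fun h => hne (by rw [← hPQ, h, sub_self])⟩
  have hsum : z * (psiR γ z + psiP γ z + psiQ γ z) = 1 := by
    rw [psiQ]; field_simp; ring
  rw [psiR_of_nonpos hre.le] at hsum ⊢
  set s := rightRoot z
  set u := psiP γ z
  set v := psiQ γ z
  have hg : z ^ 2 * (v - u) ^ 2 = 1 + 2 * z * s - 3 * z ^ 2 * s ^ 2 + 4 * z ^ 2 := by
    rw [← hPQ] at hgap
    apply mul_right_cancel₀ (pow_ne_zero 2 hs)
    linear_combination ((v - u) * (z * (3 * z * s ^ 2 - 2 * s - z)) + 2 * discSqrt γ z) * hgap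
      + 4 * hsq - hid
  have he2 : s * u + s * v + u * v = -1 := by
    apply mul_left_cancel₀ (pow_ne_zero 2 hz0)
    linear_combination (-1 / 4) * hg + (1 / 4) * (z * (u + v) + 3 * z * s + 1) * hsum
  refine ⟨hsum, he2, ?_⟩
  have hmem := mem_zFiber_iff.1 (rightRoot_mem z)
  linear_combination hmem - s ^ 2 * hsum + z * s * he2

lemma isRootTriple_of_re_zero {z : ℂ} (hre : z.re = 0) (hz0 : z ≠ 0) :
    IsRootTriple z (psiR γ z) (psiP γ z) (psiQ γ z) ∧ psiP γ z ≠ psiQ γ z := by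
  have hP := psiP_of_nonneg (γ := γ) hre.ge
  have hmP : psiP γ z ∈ zFiber z := by rw [hP]; exact neg_mem_zFiber (rightRoot_mem _)
  have hR := psiR_of_nonpos (γ := γ) hre.le
  have hmR : psiR γ z ∈ zFiber z := by rw [hR]; exact rightRoot_mem _
  have hne : psiR γ z ≠ psiP γ z := by
    intro h
    have h1 := rightRoot_re_pos z
    have h2 := rightRoot_re_pos (-z)
    rw [← hR, h, hP, Complex.neg_re] at h1
    linarith
  have hT : IsRootTriple z (psiR γ z) (psiP γ z) (psiQ γ z) :=
    isRootTriple_of_ne hz0 hmR hmP hne (by rw [psiQ]; field_simp; ring)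
  refine ⟨hT, fun h => ?_⟩
  -- If ψ_P and ψ_Q coincided, ψ_P(z) would be a double root; but it is -`rightRoot (-z)`, which is
  -- simple because Re(-z) ≤ 0 as well.
  have h1 := rightRoot_simple (z := -z) (by simp [hre])
  apply h1
  have h2 := hT.rotate.deriv_eq
  rw [← h, sub_self, zero_mul, mul_zero, hP] at h2
  linear_combination -h2

lemma IsRootTriple.ne_of_simple {z u v s : ℂ} (h : IsRootTriple z u v s)
    (hu : 3 * z * u ^ 2 - 2 * u - z ≠ 0) : u ≠ v ∧ u ≠ s := by
  rw [h.deriv_eq] at hu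
  constructor <;> rintro rfl <;> simp at hu

lemma isRootTriple_psi (hγ : IsAnalyticArc γ z₁ z₂) {z : ℂ} (hz : z ∉ trace γ)
    (hz' : -z ∉ trace γ) (hz0 : z ≠ 0) :
    IsRootTriple z (psiP γ z) (psiQ γ z) (psiR γ z) ∧ psiP γ z ≠ psiQ γ z ∧
      psiQ γ z ≠ psiR γ z ∧ psiP γ z ≠ psiR γ z := by
  have key : ∀ {x : ℂ}, x.re ≤ 0 → x ∉ trace γ → -x ∉ trace γ → x ≠ 0 →
      IsRootTriple x (psiR γ x) (psiP γ x) (psiQ γ x) ∧ psiP γ x ≠ psiQ γ x ∧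
        psiR γ x ≠ psiP γ x ∧ psiR γ x ≠ psiQ γ x := by
    intro x hre hx hx' hx0
    have h1 : IsRootTriple x (psiR γ x) (psiP γ x) (psiQ γ x) ∧ psiP γ x ≠ psiQ γ x := by
      rcases hre.lt_or_eq with h | h
      · exact isRootTriple_of_re_neg hγ h hx hx'
      · exact isRootTriple_of_re_zero h hx0
    refine ⟨h1.1, h1.2, h1.1.ne_of_simple ?_⟩
    rw [psiR_of_nonpos hre]
    exact rightRoot_simple hre
  rcases le_total z.re 0 with h | h
  · obtain ⟨h1, h2, h3, h4⟩ := key h hz hz' hz0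
    exact ⟨h1.rotate, h2, h4.symm, h3.symm⟩
  · obtain ⟨h1, h2, h3, h4⟩ := key (x := -z) (by simpa using h) hz' (by simpa using hz)
      (neg_ne_zero.2 hz0)
    have h5 := h1.neg
    simp only [psiP_neg, psiQ_neg, psiR_neg, neg_neg, ne_eq, neg_inj] at h2 h3 h4 h5
    exact ⟨h5.rotate.rotate.swap, h4, Ne.symm h2, h3⟩

/-! ### Analytic continuation across the imaginary axis -/

lemma notMem_trace_of_re_nonneg (hneg : ∀ z ∈ trace γ, z.re < 0) {z : ℂ} (hz : 0 ≤ z.re) :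
    z ∉ trace γ := fun h => (hneg z h).not_ge hz

/-- Both sides are continuous on the imaginary axis with the same square 4(z⁴ + z² + 1/3), which has
no zero there. The axis is connected, so one sign comparison suffices; at z = 0 both sides equal
-2/√3. -/
lemma discSqrt_eq_of_re_zero (hγ : IsAnalyticArc γ z₁ z₂) (hneg : ∀ z ∈ trace γ, z.re < 0) {z : ℂ}
    (hz : z.re = 0) :
    (3 * z * rightRoot z ^ 2 - 2 * rightRoot z - z) *
      (1 - z * rightRoot z - 2 * z * -rightRoot (-z)) = 2 * discSqrt γ z := by
  set S : Set ℂ := {z | z.re = 0} with hS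
  have hconv : Convex ℝ S := by
    intro x hx y hy a b _ _ _
    simp only [hS, mem_ofPred_eq] at *
    simp [hx, hy]
  have h1 : ContinuousOn rightRoot S :=
    continuousOn_rightRoot.mono fun z (hz : z.re = 0) => hz.le
  have h2 : ContinuousOn (fun z => rightRoot (-z)) S :=
    h1.comp continuous_neg.continuousOn fun z (hz : z.re = 0) => by simp [hS, hz]
  have hnot : ∀ z ∈ S, z ∉ trace γ ∧ -z ∉ trace γ := fun z (hz : z.re = 0) =>
    ⟨notMem_trace_of_re_nonneg hneg hz.ge, notMem_trace_of_re_nonneg hneg (by simp [hz])⟩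
  have h3 : ContinuousOn (discSqrt γ) S := fun z hz =>
    (analyticAt_discSqrt hγ (hnot z hz).1 (hnot z hz).2).continuousAt.continuousWithinAt
  refine hconv.isPreconnected.eq_of_sq_eq (f := fun z =>
    (3 * z * rightRoot z ^ 2 - 2 * rightRoot z - z) *
      (1 - z * rightRoot z - 2 * z * -rightRoot (-z))) (g := fun z => 2 * discSqrt γ z)
    (y := 0) (by fun_prop) (by fun_prop) ?_ ?_ (by simp [hS]) ?_ hz
  · intro z hz
    have hl : -rightRoot (-z) ∈ zFiber z := neg_mem_zFiber (rightRoot_mem _)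
    have hne : -rightRoot (-z) ≠ rightRoot z := by
      intro h
      have h4 := rightRoot_re_pos z
      have h5 := rightRoot_re_pos (-z)
      rw [← h, Complex.neg_re] at h4
      linarith
    simp only [Pi.pow_apply]
    rw [discriminant_identity_of_ne (rightRoot_mem z) hl hne, mul_pow,
      discSqrt_sq hγ (hnot z hz).1 (hnot z hz).2]
    ring
  · intro z hz
    exact mul_ne_zero two_ne_zero (discSqrt_ne_zero hγ (hnot z hz).1 (hnot z hz).2)
  · simp only [neg_zero, rightRoot_zero, discSqrt_zero hγ (hnot 0 (by simp [hS])).1]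
    ring

/-- The analytic continuation L of -`rightRoot (-x)` from the right side is shown to satisfy the
formula that defines ψ_P on the left side. -/
lemma analyticAt_psiP_of_re_zero (hγ : IsAnalyticArc γ z₁ z₂) (hneg : ∀ z ∈ trace γ, z.re < 0)
    {z : ℂ} (hz : z.re = 0) : AnalyticAt ℂ (psiP γ) z := by
  obtain ⟨φ, hφa, hφm, hφ⟩ := exists_rightRoot_branch hz.le
  obtain ⟨θ, hθa, hθm, hθ⟩ := exists_rightRoot_branch (z := -z) (by simp [hz])
  have hnega : AnalyticAt ℂ (fun x : ℂ => -x) z := by fun_prop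
  have hnegt : Tendsto (fun x : ℂ => -x) (𝓝 z) (𝓝 (-z)) := hnega.continuousAt
  have hLa : AnalyticAt ℂ (fun x => -θ (-x)) z := (hθa.comp_of_eq hnega rfl).neg
  set L : ℂ → ℂ := fun x => -θ (-x) with hL
  have hLm : ∀ᶠ x in 𝓝 z, L x ∈ zFiber x := by
    filter_upwards [hnegt.eventually hθm] with x hx using neg_mem_zFiber hx
  have hLr : ∀ᶠ x in 𝓝 z, 0 ≤ x.re → -rightRoot (-x) = L x := by
    filter_upwards [hnegt.eventually hθ] with x hx h0
    rw [hx (by simpa using h0)]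
  have hφz := hφ.self_of_nhds hz.le
  have hLz := hLr.self_of_nhds hz.ge
  have hnz : z ∉ trace γ := notMem_trace_of_re_nonneg hneg hz.ge
  have hnz' : -z ∉ trace γ := notMem_trace_of_re_nonneg hneg (by simp [hz])
  have hne : ∀ᶠ x in 𝓝 z, L x ≠ φ x := by
    refine (hLa.continuousAt.ne_iff_eventually_ne hφa.continuousAt).1 ?_
    rw [← hφz, ← hLz]
    intro h
    have h4 := rightRoot_re_pos z
    have h5 := rightRoot_re_pos (-z)
    rw [← h, Complex.neg_re] at h4
    linarith
  have hdisc : ∀ᶠ x in 𝓝 z, x ∉ trace γ ∧ -x ∉ trace γ := by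
    have ho := hγ.isOpen_compl_trace
    exact (ho.eventually_mem hnz).and (hnegt.eventually (ho.eventually_mem hnz'))
  have hDa := analyticAt_discSqrt hγ hnz hnz'
  have hD0 := discSqrt_ne_zero hγ hnz hnz'
  set G : ℂ → ℂ := fun x => (3 * x * φ x ^ 2 - 2 * φ x - x) * (1 - x * φ x - 2 * x * L x) with hG
  have hGz : G z = 2 * discSqrt γ z := by
    rw [← discSqrt_eq_of_re_zero hγ hneg hz, hφz, hLz]
  have hGc : ContinuousAt G z := by
    have h1 := hφa.continuousAt
    have h2 := hLa.continuousAt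
    fun_prop
  have hsum : ∀ᶠ x in 𝓝 z, G x + 2 * discSqrt γ x ≠ 0 := by
    refine (hGc.add (hDa.continuousAt.const_mul 2)).eventually_ne ?_
    change G z + 2 * discSqrt γ z ≠ 0
    rw [hGz, ← two_mul]
    exact mul_ne_zero two_ne_zero (mul_ne_zero two_ne_zero hD0)
  refine hLa.congr ?_
  filter_upwards [hφ, hLr, hφm, hLm, hne, hdisc, hsum] with x h1 h2 h3 h4 h5 h6 h7
  rcases le_or_gt 0 x.re with h0 | h0
  · rw [psiP_of_nonneg h0, h2 h0]
  · have hx0 : x ≠ 0 := by rintro rfl; simp at h0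
    -- Near z the squares of both sides agree, and their sum is nonzero because at z itself they are
    -- equal and nonzero; so they agree nearby.
    have hGx : G x = 2 * discSqrt γ x := by
      have h8 : (G x + 2 * discSqrt γ x) * (G x - 2 * discSqrt γ x) = 0 := by
        have h9 := discriminant_identity_of_ne h3 h4 h5
        have h10 := discSqrt_sq hγ h6.1 h6.2
        change G x ^ 2 = _ at h9
        linear_combination h9 - 4 * h10
      exact sub_eq_zero.1 ((mul_eq_zero.1 h8).resolve_left h7)
    have hs := rightRoot_simple h0.le
    rw [h1 h0.le] at hs
    have hgap : rootGap γ x = (1 - x * φ x - 2 * x * L x) / x := by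
      rw [rootGap, ← hGx, h1 h0.le, mul_comm x, mul_div_mul_left _ _ hs]
    rw [psiP_of_neg h0, hgap, h1 h0.le]
    field_simp
    ring

lemma analyticAt_rootGap (hγ : IsAnalyticArc γ z₁ z₂) {z : ℂ} (hre : z.re < 0)
    (hz : z ∉ trace γ) (hz' : -z ∉ trace γ) : AnalyticAt ℂ (rootGap γ) z := by
  have hz0 : z ≠ 0 := by rintro rfl; simp at hre
  have h1 := analyticAt_discSqrt hγ hz hz'
  have h2 := analyticAt_rightRoot hre
  have h3 := mul_ne_zero hz0 (rightRoot_simple hre.le)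
  unfold rootGap
  fun_prop (disch := assumption)

lemma analyticAt_psiP (hγ : IsAnalyticArc γ z₁ z₂) (hneg : ∀ z ∈ trace γ, z.re < 0) {z : ℂ}
    (hz : z ∉ trace γ) : AnalyticAt ℂ (psiP γ) z := by
  rcases lt_trichotomy z.re 0 with h | h | h
  · have hz0 : z ≠ 0 := by rintro rfl; simp at h
    have h1 := analyticAt_rightRoot h
    have h2 := analyticAt_rootGap hγ h hz
      (notMem_trace_of_re_nonneg hneg (by simpa using h.le))
    have h3 : AnalyticAt ℂ (fun z => (1 / z - rightRoot z - rootGap γ z) / 2) z := by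
      fun_prop (disch := assumption)
    refine h3.congr ?_
    filter_upwards [(isOpen_lt Complex.continuous_re continuous_const).mem_nhds h] with x hx
    rw [psiP_of_neg hx]
  · exact analyticAt_psiP_of_re_zero hγ hneg h
  · have h1 : AnalyticAt ℂ (fun x => -rightRoot (-x)) z :=
      ((analyticAt_rightRoot (z := -z) (by simpa using h)).comp_of_eq (f := fun x : ℂ => -x)
        (by fun_prop) rfl).neg
    refine h1.congr ?_
    filter_upwards [(isOpen_lt continuous_const Complex.continuous_re).mem_nhds h] with x hx
    rw [psiP_of_nonneg (le_of_lt hx)]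

lemma analyticAt_psiR (hγ : IsAnalyticArc γ z₁ z₂) (hneg : ∀ z ∈ trace γ, z.re < 0) {z : ℂ}
    (hz : -z ∉ trace γ) : AnalyticAt ℂ (psiR γ) z :=
  ((analyticAt_psiP hγ hneg hz).comp_of_eq (f := fun x : ℂ => -x) (by fun_prop) rfl).neg

lemma analyticAt_psiQ (hγ : IsAnalyticArc γ z₁ z₂) (hneg : ∀ z ∈ trace γ, z.re < 0) {z : ℂ}
    (hz : z ∉ trace γ) (hz' : -z ∉ trace γ) (hz0 : z ≠ 0) : AnalyticAt ℂ (psiQ γ) z := by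
  have h1 := analyticAt_psiP hγ hneg hz
  have h2 := analyticAt_psiR hγ hneg hz'
  unfold psiQ
  fun_prop (disch := assumption)

/-- ψ_P and ψ_R are analytic at 0, so z ψ_Q = 1 - z(ψ_P + ψ_R) is analytic there with value 1. -/
lemma meromorphicOrderAt_psiQ (hγ : IsAnalyticArc γ z₁ z₂) (hneg : ∀ z ∈ trace γ, z.re < 0) :
    meromorphicOrderAt (psiQ γ) 0 = -1 := by
  have hn : (0 : ℂ) ∉ trace γ := notMem_trace_of_re_nonneg hneg (by simp)
  have h1 := analyticAt_psiP hγ hneg hn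
  have h2 := analyticAt_psiR hγ hneg (z := 0) (by simpa using hn)
  have hg : AnalyticAt ℂ (fun z => 1 - z * (psiP γ z + psiR γ z)) 0 := by fun_prop
  have heq : ∀ᶠ z in 𝓝[≠] (0 : ℂ),
      psiQ γ z = (z - 0) ^ (-1 : ℤ) • (1 - z * (psiP γ z + psiR γ z)) := by
    filter_upwards [self_mem_nhdsWithin] with z hz
    have hz0 : z ≠ 0 := hz
    rw [psiQ, sub_zero, zpow_neg_one, smul_eq_mul]
    field_simp
    ring
  have hm : MeromorphicAt (psiQ γ) 0 := by
    have h3 : MeromorphicAt (fun z : ℂ => 1 / z) 0 :=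
      (MeromorphicAt.const 1 0).div (MeromorphicAt.id 0)
    exact (h3.sub h1.meromorphicAt).sub h2.meromorphicAt
  have := (meromorphicOrderAt_eq_int_iff (n := -1) hm).2 ⟨_, hg, by simp, heq⟩
  simpa using this

lemma psiP_mem (hγ : IsAnalyticArc γ z₁ z₂) (hneg : ∀ z ∈ trace γ, z.re < 0) {z : ℂ}
    (hz : z ∉ trace γ) : psiP γ z ∈ zFiber z := by
  rcases le_or_gt 0 z.re with h | h
  · rw [psiP_of_nonneg h]; exact neg_mem_zFiber (rightRoot_mem _)
  · have := (isRootTriple_of_re_neg hγ h hz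
      (notMem_trace_of_re_nonneg hneg (by simpa using h.le))).1
    simp [this.mem_iff]

lemma psiR_mem (hγ : IsAnalyticArc γ z₁ z₂) (hneg : ∀ z ∈ trace γ, z.re < 0) {z : ℂ}
    (hz : -z ∉ trace γ) : psiR γ z ∈ zFiber z := neg_mem_zFiber (psiP_mem hγ hneg hz)

/-! ### Limits at infinity -/

lemma tendsto_psiP (hγ : IsAnalyticArc γ z₁ z₂) :
    Tendsto (psiP γ) (Bornology.cobounded ℂ) (𝓝 (-1)) := by
  unfold psiP
  refine Tendsto.if ?_ ?_
  · refine (tendsto_rightRoot.comp (Tendsto.inf ?_ ?_)).neg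
    · exact tendsto_neg_cobounded
    · rw [tendsto_principal_principal]
      intro z hz
      simpa using hz
  · have hle : Bornology.cobounded ℂ ⊓ 𝓟 {z : ℂ | ¬ 0 ≤ z.re} ≤
        Bornology.cobounded ℂ ⊓ 𝓟 {z | z.re ≤ 0} := by
      refine inf_le_inf_left _ (principal_mono.2 fun z hz => ?_)
      exact le_of_not_ge hz
    have hs := tendsto_rightRoot.mono_left hle
    have hinv : Tendsto (fun z : ℂ => z⁻¹) (Bornology.cobounded ℂ ⊓ 𝓟 {z : ℂ | ¬ 0 ≤ z.re})
      (𝓝 0) := tendsto_inv₀_cobounded.mono_left inf_le_left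
    have hd := (tendsto_discSqrt hγ).mono_left
      (inf_le_left : Bornology.cobounded ℂ ⊓ 𝓟 {z : ℂ | ¬ 0 ≤ z.re} ≤ _)
    -- After division by z² the gap is a quotient with limit 2/(3 - 1) = 1, so ψ_P tends to (0 - 1 -
    -- 1)/2.
    have hden := (((hs.pow 2).const_mul 3).sub ((hs.const_mul 2).mul hinv)).sub_const 1
    have hgap := (hd.const_mul 2).div hden (by norm_num)
    have := ((hinv.sub hs).sub hgap).div_const 2
    have hval : ((0 : ℂ) - 1 - 2 * 1 / (3 * 1 ^ 2 - 2 * 1 * 0 - 1)) / 2 = -1 := by norm_num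
    rw [hval] at this
    refine this.congr' ?_
    filter_upwards [(Bornology.eventually_ne_cobounded (0 : ℂ)).filter_mono inf_le_left,
      mem_inf_of_right (mem_principal_self _)] with z hz hre
    have hsim := rightRoot_simple (le_of_not_ge hre)
    have hsim' : 3 * rightRoot z ^ 2 - 2 * rightRoot z * z⁻¹ - 1 ≠ 0 := by
      intro h
      apply hsim
      have h1 : z * z⁻¹ = 1 := mul_inv_cancel₀ hz
      linear_combination z * h + 2 * rightRoot z * h1
    have hrw : 3 * z * rightRoot z ^ 2 - 2 * rightRoot z - z =
        z * (3 * rightRoot z ^ 2 - 2 * rightRoot z * z⁻¹ - 1) := by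
      field_simp
    rw [rootGap, hrw, one_div]
    congr 2
    rw [← mul_assoc, ← sq, Pi.div_apply, ← mul_div_assoc, div_div]

lemma tendsto_psiR (hγ : IsAnalyticArc γ z₁ z₂) :
    Tendsto (psiR γ) (Bornology.cobounded ℂ) (𝓝 1) := by
  have := ((tendsto_psiP hγ).comp tendsto_neg_cobounded).neg
  rwa [neg_neg] at this

lemma tendsto_psiQ (hγ : IsAnalyticArc γ z₁ z₂) :
    Tendsto (psiQ γ) (Bornology.cobounded ℂ) (𝓝 0) := by
  have h1 : Tendsto (fun z : ℂ => 1 / z) (Bornology.cobounded ℂ) (𝓝 0) := by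
    simpa using tendsto_inv₀_cobounded (α := ℂ)
  have := (h1.sub (tendsto_psiP hγ)).sub (tendsto_psiR hγ)
  rwa [zero_sub, neg_neg, sub_self] at this

/-! ### Boundary values of square roots -/

/-- The parametrization of the left side of the arc that defines `plusSide`. -/
def sideMap (γ : ℝ → ℂ) (p : ℝ × ℝ) : ℂ := γ p.1 + (p.2 : ℂ) * (Complex.I * deriv γ p.1)

lemma plusSide_eq (γ : ℝ → ℂ) (t : ℝ) :
    plusSide γ t = map (sideMap γ) (𝓝 t ×ˢ 𝓝[>] (0 : ℝ)) := rfl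

instance plusSide_neBot (γ : ℝ → ℂ) (t : ℝ) : (plusSide γ t).NeBot := by
  unfold plusSide
  infer_instance

namespace IsAnalyticArc

variable {γ : ℝ → ℂ} {a b : ℂ}

lemma continuousAt_sideMap (h : IsAnalyticArc γ a b) {t : ℝ} (ht : t ∈ Icc (0 : ℝ) 1) (ε : ℝ) :
    ContinuousAt (sideMap γ) (t, ε) := by
  have h1 : ContinuousAt (fun p : ℝ × ℝ => γ p.1) (t, ε) :=
    (h.analytic t ht).continuousAt.comp_of_eq continuousAt_fst rfl
  have h2 : ContinuousAt (fun p : ℝ × ℝ => deriv γ p.1) (t, ε) :=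
    (h.analytic t ht).deriv.continuousAt.comp_of_eq continuousAt_fst rfl
  have h3 : ContinuousAt (fun p : ℝ × ℝ => (p.2 : ℂ)) (t, ε) :=
    Complex.continuous_ofReal.continuousAt.comp_of_eq continuousAt_snd rfl
  exact h1.add (h3.mul (continuousAt_const.mul h2))

lemma tendsto_sideMap (h : IsAnalyticArc γ a b) {t : ℝ} (ht : t ∈ Icc (0 : ℝ) 1) :
    Tendsto (sideMap γ) (𝓝 t ×ˢ 𝓝[>] (0 : ℝ)) (𝓝 (γ t)) := by
  have h1 := h.continuousAt_sideMap ht 0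
  have h2 : sideMap γ (t, 0) = γ t := by simp [sideMap]
  rw [ContinuousAt, h2, nhds_prod_eq] at h1
  exact h1.mono_left (Filter.prod_mono le_rfl nhdsWithin_le_nhds)

/-- The parts of the arc away from the parameter t are excluded by compactness and injectivity. Near
t, strict differentiability makes the arc almost straight, so a point displaced by ε along the
normal cannot be an arc point. -/
lemma eventually_sideMap_notMem (h : IsAnalyticArc γ a b) {t : ℝ} (ht : t ∈ Ioo (0 : ℝ) 1) :
    ∀ᶠ p in 𝓝 t ×ˢ 𝓝[>] (0 : ℝ), sideMap γ p ∉ trace γ := by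
  have ht' := Ioo_subset_Icc_self ht
  set d := deriv γ t with hd
  have hd0 : 0 < ‖d‖ := norm_pos_iff.2 (h.regular t ht')
  have hstrict : ∀ᶠ q : ℝ × ℝ in 𝓝 (t, t),
      ‖γ q.1 - γ q.2 - (q.1 - q.2) • d‖ ≤ ‖d‖ / 4 * ‖q.1 - q.2‖ := by
    have := (h.analytic t ht').hasStrictDerivAt.hasStrictFDerivAt.isLittleO.def
      (show 0 < ‖d‖ / 4 by positivity)
    simpa using this
  rw [nhds_prod_eq] at hstrict
  obtain ⟨V, hV, hVs⟩ := (eventually_prod_self_iff (r := fun x y : ℝ =>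
    ‖γ x - γ y - (x - y) • d‖ ≤ ‖d‖ / 4 * ‖x - y‖)).1 hstrict
  have hcd : ∀ᶠ s in 𝓝 t, ‖deriv γ s - d‖ < ‖d‖ / 4 := by
    have := (h.analytic t ht').deriv.continuousAt
    simpa [dist_eq_norm] using Metric.tendsto_nhds.1 this (‖d‖ / 4) (by positivity)
  obtain ⟨W, hWV, hWo, htW⟩ := mem_nhds_iff.1 hV
  have hK : IsCompact (γ '' (Icc 0 1 \ W)) :=
    (isCompact_Icc.diff hWo).image_of_continuousOn (h.continuousOn.mono sdiff_subset)
  have hKt : γ t ∉ γ '' (Icc 0 1 \ W) := by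
    rintro ⟨s, ⟨hs, hsW⟩, hst⟩
    rw [h.simple hs ht' hst] at hsW
    exact hsW htW
  have hfar := (h.tendsto_sideMap ht').eventually (hK.isClosed.isOpen_compl.eventually_mem hKt)
  have hWe : ∀ᶠ p in 𝓝 t ×ˢ 𝓝[>] (0 : ℝ), p.1 ∈ W :=
    (hWo.eventually_mem htW).prod_inl _
  have hpos : ∀ᶠ p in 𝓝 t ×ˢ 𝓝[>] (0 : ℝ), 0 < p.2 :=
    (eventually_mem_nhdsWithin (a := (0 : ℝ)) (s := Ioi 0)).prod_inr _
  filter_upwards [hfar, hWe, hpos, hcd.prod_inl _] with p hp1 hp2 hp3 hp4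
  rintro ⟨x, hx, hxp⟩
  by_cases hxW : x ∈ W
  · have h1 := hVs x (hWV hxW) p.1 (hWV hp2)
    rw [hxp, sideMap, add_sub_cancel_left] at h1
    set τ := x - p.1
    set ε := p.2
    have h2 : ‖(ε : ℂ) * (Complex.I * (deriv γ p.1 - d))‖ ≤ ε * (‖d‖ / 4) := by
      rw [norm_mul, norm_mul, Complex.norm_I, one_mul, Complex.norm_real, Real.norm_of_nonneg hp3.le]
      gcongr
    -- A coincidence would force |iε - τ| ≤ (|τ| + ε)/4, although |iε - τ| is at least ε > 0 and at
    -- least |τ|.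
    have h3 : ‖((ε : ℂ) * Complex.I - τ) * d‖ ≤ ‖d‖ / 4 * (‖τ‖ + ε) := by
      have e : ((ε : ℂ) * Complex.I - τ) * d = ((ε : ℂ) * (Complex.I * deriv γ p.1) - τ • d)
          - (ε : ℂ) * (Complex.I * (deriv γ p.1 - d)) := by
        rw [Complex.real_smul]; ring
      rw [e]
      refine (norm_sub_le _ _).trans ?_
      linarith
    have h4 : ε ≤ ‖(ε : ℂ) * Complex.I - τ‖ := by
      have := Complex.abs_im_le_norm ((ε : ℂ) * Complex.I - τ)
      simp at this
      exact (le_abs_self _).trans this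
    have h5 : ‖τ‖ ≤ ‖(ε : ℂ) * Complex.I - τ‖ := by
      have := Complex.abs_re_le_norm ((ε : ℂ) * Complex.I - τ)
      simpa using this
    rw [norm_mul] at h3
    have h6 : ‖(ε : ℂ) * Complex.I - τ‖ ≤ (‖τ‖ + ε) / 4 := by
      refine le_of_mul_le_mul_right ?_ hd0
      linarith
    have := norm_nonneg τ
    linarith
  · exact hp1 ⟨x, ⟨hx, hxW⟩, hxp⟩

/-- Near an interior point of the arc D has a continuous root r, and f = ±r on the image of the
connected rectangle of normal coordinates (s, ε). The sign is constant there, so f extends to the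
side as ±r does. -/
lemma exists_local_plusBoundary (h : IsAnalyticArc γ a b) {f D : ℂ → ℂ} {U : Set ℂ} (hU : IsOpen U)
    (hUγ : trace γ ⊆ U) (hf : ContinuousOn f (U \ trace γ)) (hD : ContinuousOn D U)
    (hfD : ∀ z ∈ U \ trace γ, f z ^ 2 = D z) {t : ℝ} (ht : t ∈ Ioo (0 : ℝ) 1)
    (hDt : D (γ t) ≠ 0) :
    ∃ k : ℝ → ℂ, ContinuousAt k t ∧
      ∀ᶠ s in 𝓝 t, Tendsto f (plusSide γ s) (𝓝 (k s)) ∧ k s ^ 2 = D (γ s) := by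
  have ht' := Ioo_subset_Icc_self ht
  obtain ⟨d, hd⟩ := IsAlgClosed.exists_pow_nat_eq (D (γ t)) (n := 2) (by norm_num)
  have hd0 : d ≠ 0 := by rintro rfl; exact hDt (by rw [← hd]; simp)
  -- Dividing by D(γ t) moves the base value to 1, away from the cut of the principal power.
  set r : ℂ → ℂ := fun z => d * (D z / D (γ t)) ^ ((2 : ℕ)⁻¹ : ℂ) with hr
  have hrsq : ∀ z, r z ^ 2 = D z := by
    intro z
    rw [hr]
    simp only
    rw [mul_pow, Complex.cpow_nat_inv_pow _ two_ne_zero, hd, mul_div_cancel₀ _ hDt]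
  have hγU : γ t ∈ U := hUγ ⟨t, ht', rfl⟩
  have hDc : ContinuousAt D (γ t) := hD.continuousAt (hU.mem_nhds hγU)
  have hslit : ∀ᶠ z in 𝓝 (γ t), z ∈ U ∧ D z / D (γ t) ∈ Complex.slitPlane := by
    refine (hU.eventually_mem hγU).and ((hDc.div_const _).eventually
      (Complex.isOpen_slitPlane.eventually_mem ?_))
    change D (γ t) / D (γ t) ∈ Complex.slitPlane
    rw [div_self hDt]
    exact Complex.one_mem_slitPlane
  obtain ⟨V, hV, hVo, htV⟩ := eventually_nhds_iff.1 hslit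
  have hrc : ContinuousOn r V := by
    intro z hz
    have h1 : ContinuousAt D z := hD.continuousAt (hU.mem_nhds (hV z hz).1)
    exact (continuousAt_const.mul ((h1.div_const _).cpow continuousAt_const (hV z hz).2)).continuousWithinAt
  have hr0 : ∀ z ∈ V, r z ≠ 0 := by
    intro z hz h0
    have h1 := hrsq z
    rw [h0, zero_pow two_ne_zero] at h1
    have h2 := Complex.slitPlane_ne_zero (hV z hz).2
    rw [← h1, zero_div] at h2
    exact h2 rfl
  have hev : ∀ᶠ p in 𝓝 t ×ˢ 𝓝[>] (0 : ℝ),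
      p.1 ∈ Ioo (0 : ℝ) 1 ∧ γ p.1 ∈ V ∧ sideMap γ p ∈ V ∧ sideMap γ p ∉ trace γ := by
    refine ((isOpen_Ioo.eventually_mem ht).prod_inl _).and (Eventually.and ?_ (Eventually.and ?_
      (h.eventually_sideMap_notMem ht)))
    · exact ((h.analytic t ht').continuousAt.eventually (hVo.eventually_mem htV)).prod_inl _
    · exact (h.tendsto_sideMap ht').eventually (hVo.eventually_mem htV)
  obtain ⟨A, hA, B, hB, hAB⟩ := mem_prod_iff.1 hev
  obtain ⟨δ, hδ, hδA⟩ := Metric.mem_nhds_iff.1 hA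
  obtain ⟨η, hη, hηB⟩ := (mem_nhdsGT_iff_exists_Ioo_subset).1 hB
  set S : Set (ℝ × ℝ) := Metric.ball t δ ×ˢ Ioo 0 η with hS
  have hSP : ∀ p ∈ S, p.1 ∈ Ioo (0 : ℝ) 1 ∧ γ p.1 ∈ V ∧ sideMap γ p ∈ V ∧ sideMap γ p ∉ trace γ :=
    fun p hp => hAB ⟨hδA hp.1, hηB hp.2⟩
  have hSconn : IsPreconnected S :=
    ((convex_ball t δ).prod (convex_Ioo 0 η)).isPreconnected
  have hm : ContinuousOn (sideMap γ) S := fun p hp =>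
    (h.continuousAt_sideMap (Ioo_subset_Icc_self (hSP p hp).1) p.2).continuousWithinAt
  have hfm : ContinuousOn (f ∘ sideMap γ) S := hf.comp hm fun p hp =>
    ⟨(hV _ (hSP p hp).2.2.1).1, (hSP p hp).2.2.2⟩
  have hrm : ContinuousOn (r ∘ sideMap γ) S := hrc.comp hm fun p hp => (hSP p hp).2.2.1
  have hsq : EqOn ((f ∘ sideMap γ) ^ 2) ((r ∘ sideMap γ) ^ 2) S := by
    intro p hp
    simp only [Pi.pow_apply, Function.comp_apply]
    rw [hrsq, hfD _ ⟨(hV _ (hSP p hp).2.2.1).1, (hSP p hp).2.2.2⟩]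
  have hsign : ∃ e : ℂ, e ^ 2 = 1 ∧ EqOn (f ∘ sideMap γ) (fun p => e * r (sideMap γ p)) S := by
    rcases hSconn.eq_or_eq_neg_of_sq_eq hfm hrm hsq (fun {p} hp => hr0 _ (hSP p hp).2.2.1) with h1 | h1
    · exact ⟨1, by norm_num, fun p hp => by simpa using h1 hp⟩
    · exact ⟨-1, by norm_num, fun p hp => by simpa using h1 hp⟩
  obtain ⟨e, he, hfe⟩ := hsign
  have hrat : ∀ z ∈ V, ContinuousAt r z := fun z hz => hrc.continuousAt (hVo.mem_nhds hz)
  refine ⟨fun s => e * r (γ s), ?_, ?_⟩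
  · exact continuousAt_const.mul ((hrat _ htV).comp (h.analytic t ht').continuousAt)
  · filter_upwards [Metric.ball_mem_nhds t hδ] with s hs
    have hsV : s ∈ Ioo (0 : ℝ) 1 ∧ γ s ∈ V := by
      have := hSP (s, η / 2) ⟨hs, half_pos hη, half_lt_self hη⟩
      exact ⟨this.1, this.2.1⟩
    refine ⟨?_, by rw [mul_pow, he, one_mul, hrsq]⟩
    rw [plusSide_eq, tendsto_map'_iff]
    have h1 : Tendsto (fun p => e * r (sideMap γ p)) (𝓝 s ×ˢ 𝓝[>] (0 : ℝ)) (𝓝 (e * r (γ s))) :=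
      ((hrat _ hsV.2).tendsto.comp
        (h.tendsto_sideMap (Ioo_subset_Icc_self hsV.1))).const_mul e
    refine h1.congr' ?_
    have hmem : S ∈ 𝓝 s ×ˢ 𝓝[>] (0 : ℝ) :=
      prod_mem_prod (Metric.isOpen_ball.mem_nhds hs) (Ioo_mem_nhdsGT hη)
    filter_upwards [hmem] with p hp using (hfe hp).symm

lemma exists_plusBoundary (h : IsAnalyticArc γ a b) {f D : ℂ → ℂ} {U : Set ℂ} (hU : IsOpen U)
    (hUγ : trace γ ⊆ U) (hf : ContinuousOn f (U \ trace γ)) (hD : ContinuousOn D U)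
    (hfD : ∀ z ∈ U \ trace γ, f z ^ 2 = D z) (hD0 : ∀ t ∈ Ioo (0 : ℝ) 1, D (γ t) ≠ 0) :
    ∃ g : ℝ → ℂ, IsPlusBoundaryFunction f γ g ∧ ContinuousOn g (Ioo 0 1) ∧
      (∀ t ∈ Ioo (0 : ℝ) 1, g t ^ 2 = D (γ t)) ∧ ∀ t ∉ Ioo (0 : ℝ) 1, g t = 0 := by
  classical
  choose! k hkc hk using fun t (ht : t ∈ Ioo (0 : ℝ) 1) =>
    h.exists_local_plusBoundary hU hUγ hf hD hfD ht (hD0 t ht)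
  set g : ℝ → ℂ := fun t => if t ∈ Ioo (0 : ℝ) 1 then k t t else 0 with hg
  have hgt : ∀ t ∈ Ioo (0 : ℝ) 1, g t = k t t := fun t ht => if_pos ht
  have hlim : IsPlusBoundaryFunction f γ g := by
    intro t ht
    rw [hgt t ht]
    exact (hk t ht).self_of_nhds.1
  refine ⟨g, hlim, ?_, ?_, fun t ht => if_neg ht⟩
  · intro t ht
    -- Near t the local boundary function `k t` coincides with the glued one, by uniqueness of
    -- limits along the nontrivial filter `plusSide γ s`.
    refine ((hkc t ht).congr ?_).continuousWithinAt
    filter_upwards [hk t ht, Ioo_mem_nhds ht.1 ht.2] with s hs hs'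
    exact tendsto_nhds_unique hs.1 (hlim s hs')
  · intro t ht
    rw [hgt t ht]
    exact (hk t ht).self_of_nhds.2

/-- The square of f₊ γ' is real and ≤ 0, so f₊ γ' is purely imaginary, and the factor 3/(2πi) makes
its integrals real. Integrability follows from boundedness: f₊² is the restriction of D, which is
bounded on the whole arc, ends included. -/
lemma hasRealPlusIntegrals (h : IsAnalyticArc γ a b) {f D : ℂ → ℂ} {U : Set ℂ} (hU : IsOpen U)
    (hUγ : trace γ ⊆ U) (hf : ContinuousOn f (U \ trace γ)) (hD : ContinuousOn D U)
    (hfD : ∀ z ∈ U \ trace γ, f z ^ 2 = D z) (hD0 : ∀ t ∈ Ioo (0 : ℝ) 1, D (γ t) ≠ 0)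
    (hneg : ∀ t ∈ Ioo (0 : ℝ) 1, ∃ r : ℝ, r ≤ 0 ∧ D (γ t) * deriv γ t ^ 2 = r) :
    HasRealPlusIntegrals f γ := by
  obtain ⟨g, hg, hgc, hgD, hg0⟩ := h.exists_plusBoundary hU hUγ hf hD hfD hD0
  refine ⟨g, hg, ?_, ?_⟩
  · rw [intervalIntegrable_iff_integrableOn_Ioo_of_le zero_le_one]
    have hDγ : ContinuousOn (fun t => D (γ t)) (Icc 0 1) :=
      hD.comp h.continuousOn fun t ht => hUγ ⟨t, ht, rfl⟩
    obtain ⟨M, hM⟩ := isCompact_Icc.exists_bound_of_continuousOn hDγ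
    obtain ⟨N, hN⟩ := isCompact_Icc.exists_bound_of_continuousOn h.continuousOn_deriv
    refine IntegrableOn.of_bound (C := Real.sqrt M * N) (by simp)
      (ContinuousOn.aestronglyMeasurable
        (hgc.fun_mul (h.continuousOn_deriv.mono Ioo_subset_Icc_self)) measurableSet_Ioo) ?_
    filter_upwards [ae_restrict_mem measurableSet_Ioo] with t ht
    have ht' := Ioo_subset_Icc_self ht
    rw [norm_mul]
    have h1 : ‖g t‖ ≤ Real.sqrt M := by
      apply Real.le_sqrt_of_sq_le
      rw [← norm_pow, hgD t ht]
      exact hM t ht'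
    exact mul_le_mul h1 (hN t ht') (norm_nonneg _) (Real.sqrt_nonneg _)
  · intro t ht
    have hre : ∀ s, g s * deriv γ s = (((g s * deriv γ s).im : ℝ) : ℂ) * Complex.I := by
      intro s
      have hre0 : (g s * deriv γ s).re = 0 := by
        by_cases hs : s ∈ Ioo (0 : ℝ) 1
        · obtain ⟨r, hr, hrs⟩ := hneg s hs
          rw [← hgD s hs, ← mul_pow] at hrs
          set w := g s * deriv γ s
          have h1 := congrArg Complex.re hrs
          have h2 := congrArg Complex.im hrs
          rw [sq, Complex.mul_re, Complex.ofReal_re] at h1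
          rw [sq, Complex.mul_im, Complex.ofReal_im] at h2
          have h3 : w.re * w.im = 0 := by linarith
          rcases mul_eq_zero.1 h3 with h4 | h4
          · exact h4
          · rw [h4] at h1
            nlinarith
        · rw [hg0 s hs]; simp
      apply Complex.ext <;> simp [hre0]
    refine ⟨3 * (∫ s in (0 : ℝ)..t, (g s * deriv γ s).im) / (2 * Real.pi), ?_⟩
    rw [intervalIntegral.integral_congr (g := fun s => (((g s * deriv γ s).im : ℝ) : ℂ) * Complex.I)
      fun s _ => hre s, intervalIntegral.integral_mul_const, intervalIntegral.integral_ofReal]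
    push_cast
    have := Complex.I_ne_zero
    have : (Real.pi : ℂ) ≠ 0 := by exact_mod_cast Real.pi_ne_zero
    field_simp

end IsAnalyticArc

/-! ### Reflection in the origin -/

lemma mem_trace_neg {z : ℂ} : z ∈ trace (fun t => -γ t) ↔ -z ∈ trace γ := by
  unfold trace
  constructor
  · rintro ⟨t, ht, rfl⟩; exact ⟨t, ht, by simp⟩
  · rintro ⟨t, ht, h⟩; exact ⟨t, ht, by simp [h]⟩

lemma deriv_neg_arc (t : ℝ) : deriv (fun t => -γ t) t = -deriv γ t := deriv.fun_neg

lemma IsAnalyticArc.neg {a b : ℂ} (h : IsAnalyticArc γ a b) :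
    IsAnalyticArc (fun t => -γ t) (-a) (-b) where
  analytic t ht := (h.analytic t ht).neg
  regular t ht := by
    rw [deriv_neg_arc]
    exact neg_ne_zero.2 (h.regular t ht)
  simple t ht s hs hts := h.simple ht hs (neg_inj.1 hts)
  source := by rw [h.source]
  target := by rw [h.target]

/-- Reflection in the origin is a rotation by π, so it preserves the left side of the directed arc.
-/
lemma tendsto_plusSide_neg {f : ℂ → ℂ} {t : ℝ} {l : ℂ} (h : Tendsto f (plusSide γ t) (𝓝 l)) :
    Tendsto (fun z => -f (-z)) (plusSide (fun t => -γ t) t) (𝓝 (-l)) := by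
  rw [plusSide_eq, tendsto_map'_iff] at h ⊢
  refine h.neg.congr fun p => ?_
  simp only [Function.comp_apply, sideMap, deriv_neg_arc]
  congr 2
  ring

lemma HasRealPlusIntegrals.neg {f : ℂ → ℂ} (h : HasRealPlusIntegrals f γ) :
    HasRealPlusIntegrals (fun z => -f (-z)) (fun t => -γ t) := by
  obtain ⟨g, hg, hint, hr⟩ := h
  refine ⟨fun t => -g t, fun t ht => tendsto_plusSide_neg (hg t ht), ?_, ?_⟩
  · simpa [deriv_neg_arc] using hint
  · simpa [deriv_neg_arc] using hr

/-! ### The theorem for a given arc -/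

/-- The square of the difference of the two fiber points other than `rightRoot z`. -/
def gapSq (z : ℂ) : ℂ :=
  4 * (z ^ 4 + z ^ 2 + 1 / 3) / (z * (3 * z * rightRoot z ^ 2 - 2 * rightRoot z - z)) ^ 2

lemma gapSq_eq {z : ℂ} (hz : z.re < 0) : z ^ 2 * gapSq z =
    1 + 2 * z * rightRoot z - 3 * z ^ 2 * rightRoot z ^ 2 + 4 * z ^ 2 := by
  have hz0 : z ≠ 0 := by rintro rfl; simp at hz
  have hs := rightRoot_simple hz.le
  rw [gapSq, ← discriminant_identity (rightRoot_mem z), mul_pow, ← mul_div_assoc,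
    mul_div_mul_left _ _ (pow_ne_zero 2 hz0), mul_div_assoc, div_self (pow_ne_zero 2 hs), mul_one]

/-- Near the arc ψ_Q - ψ_P is `rootGap`, whose square `gapSq` is continuous across the arc and
vanishes on it at most at its ends. -/
lemma hasRealPlusIntegrals_psi (hγ : IsAnalyticArc γ z₁ z₂) (hneg : ∀ z ∈ trace γ, z.re < 0)
    (htr : ∀ t ∈ Ioo (0 : ℝ) 1, ∃ r : ℝ, r ≤ 0 ∧ gapSq (γ t) * deriv γ t ^ 2 = r) :
    HasRealPlusIntegrals (fun s => psiQ γ s - psiP γ s) γ := by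
  have hU : IsOpen {z : ℂ | z.re < 0} := isOpen_lt Complex.continuous_re continuous_const
  have hz0 : ∀ z : ℂ, z.re < 0 → z ≠ 0 := by
    rintro z h rfl
    simp at h
  have hden : ∀ z : ℂ, z.re < 0 → z * (3 * z * rightRoot z ^ 2 - 2 * rightRoot z - z) ≠ 0 :=
    fun z hz => mul_ne_zero (hz0 z hz) (rightRoot_simple hz.le)
  have hn : ∀ z : ℂ, z.re < 0 → -z ∉ trace γ := fun z hz =>
    notMem_trace_of_re_nonneg hneg (by simpa using hz.le)
  refine hγ.hasRealPlusIntegrals hU (D := gapSq) (fun z hz => hneg z hz) ?_ ?_ ?_ ?_ htr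
  · have : ContinuousOn (rootGap γ) ({z : ℂ | z.re < 0} \ trace γ) := fun z hz =>
      (analyticAt_rootGap hγ hz.1 hz.2 (hn z hz.1)).continuousAt.continuousWithinAt
    exact this.congr fun z hz => psiQ_sub_psiP_of_neg hz.1
  · intro z hz
    have h1 := (analyticAt_rightRoot hz).continuousAt
    have h2 := pow_ne_zero 2 (hden z hz)
    have : ContinuousAt gapSq z := by
      unfold gapSq
      fun_prop (disch := assumption)
    exact this.continuousWithinAt
  · intro z hz
    rw [psiQ_sub_psiP_of_neg hz.1, rootGap, div_pow, mul_pow,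
      discSqrt_sq hγ hz.2 (hn z hz.1), gapSq]
    norm_num
  · intro t ht
    have ht' := Ioo_subset_Icc_self ht
    have hre := hneg _ ⟨t, ht', rfl⟩
    refine div_ne_zero (mul_ne_zero (by norm_num) (discriminant_ne_zero hγ ?_ ?_))
      (pow_ne_zero 2 (hden _ hre))
    · rintro s (rfl | rfl) h
      · exact ht.1.ne' (hγ.simple ht' (by simp) h)
      · exact ht.2.ne (hγ.simple ht' (by simp) h)
    · rintro s hs h
      refine hn _ hre ⟨s, ?_, h.symm⟩
      rcases hs with rfl | rfl <;> simp

/-! ### The principal square root -/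

lemma csqrt_sq (z : ℂ) : Complex.sqrt z ^ 2 = z := by
  exact_mod_cast Complex.cpow_nat_inv_pow z two_ne_zero

lemma csqrt_re_pos {z : ℂ} (hz : z ∈ Complex.slitPlane) : 0 < (Complex.sqrt z).re := by
  have h0 := Complex.slitPlane_ne_zero hz
  rw [Complex.sqrt, Complex.cpow_inv_two_re]
  apply Real.sqrt_pos.2
  rcases Complex.mem_slitPlane_iff.1 hz with h | h
  · have := norm_nonneg z
    linarith
  · have : |z.re| < ‖z‖ := Complex.abs_re_lt_norm.2 h
    have := neg_abs_le z.re
    linarith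

lemma csqrt_conj {z : ℂ} (hz : z ∈ Complex.slitPlane) :
    Complex.sqrt ((starRingEnd ℂ) z) = (starRingEnd ℂ) (Complex.sqrt z) := by
  rw [Complex.sqrt, Complex.conj_cpow _ _ (Complex.mem_slitPlane_iff_arg.1 hz).1]
  simp [Complex.sqrt, map_inv₀, map_ofNat]

lemma analyticAt_csqrt {f : ℂ → ℂ} {z : ℂ} (hf : AnalyticAt ℂ f z)
    (hz : f z ∈ Complex.slitPlane) : AnalyticAt ℂ (fun x => Complex.sqrt (f x)) z := by
  unfold Complex.sqrt
  exact hf.cpow analyticAt_const hz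

lemma mem_slitPlane_of_re_pos {z : ℂ} (hz : 0 < z.re) : z ∈ Complex.slitPlane :=
  Complex.mem_slitPlane_iff.2 (Or.inl hz)

lemma norm_sq_csqrt_lt {z : ℂ} (hz : 0 < z.re) :
    ‖Complex.sqrt z‖ ^ 2 < 2 * (Complex.sqrt z).re ^ 2 := by
  have h1 := congrArg Complex.re (csqrt_sq z)
  rw [sq, Complex.mul_re] at h1
  rw [← Complex.normSq_eq_norm_sq, Complex.normSq_apply]
  nlinarith

/-! ### The square root of the quadratic differential in a strip -/

/-- The number `√3`, as a complex number. -/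
def sqrtThree : ℂ := ((Real.sqrt 3 : ℝ) : ℂ)

lemma sqrtThree_sq : sqrtThree ^ 2 = 3 := ofReal_sqrt_three_sq

lemma sqrtThree_re : sqrtThree.re = Real.sqrt 3 := Complex.ofReal_re _

lemma sqrtThree_im : sqrtThree.im = 0 := Complex.ofReal_im _

lemma conj_sqrtThree : (starRingEnd ℂ) sqrtThree = sqrtThree := Complex.conj_ofReal _

lemma sqrt_three_pos : 0 < Real.sqrt 3 := by positivity

lemma sqrtThree_ne_zero : sqrtThree ≠ 0 := Complex.ofReal_ne_zero.2 sqrt_three_pos.ne'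

lemma add_sqrtThree_ne_zero {x : ℂ} (hx : 0 ≤ x.re) : x + sqrtThree ≠ 0 := by
  intro h
  have := congrArg Complex.re h
  rw [Complex.add_re, sqrtThree_re, Complex.zero_re] at this
  linarith [sqrt_three_pos]

lemma sqrtThree_mul_add_one_ne_zero {x : ℂ} (hx : 0 ≤ x.re) : sqrtThree * x + 1 ≠ 0 := by
  intro h
  have := congrArg Complex.re h
  simp only [Complex.add_re, Complex.mul_re, sqrtThree_re, sqrtThree_im, Complex.zero_re,
    Complex.one_re] at this
  nlinarith [mul_nonneg sqrt_three_pos.le hx]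

/-- The quadratic differential `(ψ_Q - ψ_P)² dz²` is `√3 quadDiff (exp ξ) dξ²`. -/
def quadDiff (x : ℂ) : ℂ :=
  (x ^ 2 + 1) * (x ^ 2 + sqrtThree * x + 1) ^ 2 /
    (x ^ 2 * (sqrtThree * x + 1) * (x + sqrtThree) ^ 3)

/-- A branch of `√quadDiff (exp ξ)` in the strip. -/
def sqrtDiff (ξ : ℂ) : ℂ :=
  (1 + 1 / (Complex.exp ξ * (Complex.exp ξ + sqrtThree))) /
    Complex.sqrt (sqrtThree + 4 / (Complex.exp ξ + Complex.exp (-ξ)))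

/-- The strip `|Im ξ| < π / 2`. -/
def strip : Set ℂ := {ξ | |ξ.im| < Real.pi / 2}

lemma isOpen_strip : IsOpen strip :=
  isOpen_lt (continuous_abs.comp Complex.continuous_im) continuous_const

lemma mul_mem_strip {ξ : ℂ} (hξ : ξ ∈ strip) {t : ℝ} (ht : t ∈ Icc (0 : ℝ) 1) :
    (t : ℂ) * ξ ∈ strip := by
  change |((t : ℂ) * ξ).im| < _
  rw [Complex.im_ofReal_mul, abs_mul, abs_of_nonneg ht.1]
  calc t * |ξ.im| ≤ 1 * |ξ.im| := by gcongr; exact ht.2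
    _ = |ξ.im| := one_mul _
    _ < _ := hξ

lemma cos_pos_of_mem_strip {ξ : ℂ} (hξ : ξ ∈ strip) : 0 < Real.cos ξ.im :=
  Real.cos_pos_of_mem_Ioo (abs_lt.1 hξ)

lemma exp_re_pos {ξ : ℂ} (hξ : ξ ∈ strip) : 0 < (Complex.exp ξ).re := by
  rw [Complex.exp_re]
  exact mul_pos (Real.exp_pos _) (cos_pos_of_mem_strip hξ)

lemma exp_add_exp_neg_re (ξ : ℂ) : (Complex.exp ξ + Complex.exp (-ξ)).re =
    (Real.exp ξ.re + Real.exp (-ξ.re)) * Real.cos ξ.im := by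
  rw [Complex.add_re, Complex.exp_re, Complex.exp_re, Complex.neg_re, Complex.neg_im, Real.cos_neg]
  ring

lemma exp_add_exp_neg_re_pos {ξ : ℂ} (hξ : ξ ∈ strip) :
    0 < (Complex.exp ξ + Complex.exp (-ξ)).re := by
  rw [exp_add_exp_neg_re]
  have := cos_pos_of_mem_strip hξ
  positivity

lemma ne_zero_of_re_pos {z : ℂ} (hz : 0 < z.re) : z ≠ 0 := by
  rintro rfl
  simp at hz

lemma radicand_re_pos {ξ : ℂ} (hξ : ξ ∈ strip) :
    0 < (sqrtThree + 4 / (Complex.exp ξ + Complex.exp (-ξ))).re := by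
  have h := exp_add_exp_neg_re_pos hξ
  set k := Complex.exp ξ + Complex.exp (-ξ)
  have h1 : (4 / k).re = 4 * (k.re / Complex.normSq k) := by
    rw [div_eq_mul_inv, show (4 : ℂ) = ((4 : ℝ) : ℂ) by norm_num, Complex.re_ofReal_mul,
      Complex.inv_re]
  rw [Complex.add_re, sqrtThree_re, h1]
  have := Complex.normSq_pos.2 (ne_zero_of_re_pos h)
  have := sqrt_three_pos
  positivity

lemma sqrt_radicand_ne_zero {ξ : ℂ} (hξ : ξ ∈ strip) :
    Complex.sqrt (sqrtThree + 4 / (Complex.exp ξ + Complex.exp (-ξ))) ≠ 0 :=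
  ne_zero_of_re_pos (csqrt_re_pos (mem_slitPlane_of_re_pos (radicand_re_pos hξ)))

lemma analyticAt_sqrtDiff {ξ : ℂ} (hξ : ξ ∈ strip) : AnalyticAt ℂ sqrtDiff ξ := by
  have h1 := mul_ne_zero (Complex.exp_ne_zero ξ) (add_sqrtThree_ne_zero (exp_re_pos hξ).le)
  have h2 := ne_zero_of_re_pos (exp_add_exp_neg_re_pos hξ)
  have h3 : AnalyticAt ℂ (fun ξ => sqrtThree + 4 / (Complex.exp ξ + Complex.exp (-ξ))) ξ := by
    fun_prop (disch := assumption)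
  have h4 := analyticAt_csqrt h3 (mem_slitPlane_of_re_pos (radicand_re_pos hξ))
  have h5 := sqrt_radicand_ne_zero hξ
  unfold sqrtDiff
  exact AnalyticAt.div (by fun_prop (disch := assumption)) h4 h5

/-- With x = exp ξ, the radicand is (√3x + 1)(x + √3)/(x² + 1). Written as √3 + 4/(x + 1/x) it
visibly has positive real part in the strip, so the principal root is an analytic branch. -/
lemma sqrtDiff_sq {ξ : ℂ} (hξ : ξ ∈ strip) : sqrtDiff ξ ^ 2 = quadDiff (Complex.exp ξ) := by
  rw [sqrtDiff, quadDiff, div_pow, csqrt_sq]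
  have hk := ne_zero_of_re_pos (exp_add_exp_neg_re_pos hξ)
  have hx := exp_re_pos hξ
  have hx0 := Complex.exp_ne_zero ξ
  rw [Complex.exp_neg] at hk ⊢
  set x := Complex.exp ξ
  have h1 := add_sqrtThree_ne_zero hx.le
  have h2 := sqrtThree_mul_add_one_ne_zero hx.le
  have h3 : x ^ 2 + 1 ≠ 0 := by
    intro h
    apply hk
    field_simp
    rw [h, mul_zero]
  have hr : sqrtThree + 4 / (x + x⁻¹) = (sqrtThree * x + 1) * (x + sqrtThree) / (x ^ 2 + 1) := by
    rw [show x + x⁻¹ = (x ^ 2 + 1) / x by field_simp]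
    field_simp
    linear_combination (-x) * sqrtThree_sq
  have hn : 1 + 1 / (x * (x + sqrtThree)) =
      (x ^ 2 + sqrtThree * x + 1) / (x * (x + sqrtThree)) := by
    field_simp
  rw [hr, hn]
  field_simp

lemma sqrtDiff_conj {ξ : ℂ} (hξ : ξ ∈ strip) :
    sqrtDiff ((starRingEnd ℂ) ξ) = (starRingEnd ℂ) (sqrtDiff ξ) := by
  have h := csqrt_conj (mem_slitPlane_of_re_pos (radicand_re_pos hξ))
  simp only [map_add, map_div₀, conj_sqrtThree, map_ofNat, ← Complex.exp_conj, map_neg] at h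
  simp only [sqrtDiff, h, map_add, map_div₀, map_one, map_mul, conj_sqrtThree, ← Complex.exp_conj]

/-- Positivity makes the real part of the primitive increase along horizontal rays; a bound
independent of Re ξ makes it unbounded there. -/
lemma sqrtDiff_re_lower {ξ : ℂ} (hξ : ξ ∈ strip) (hre : 0 ≤ ξ.re) :
    1 / (5 * Real.sqrt (2 + 2 / Real.cos ξ.im)) ≤ (sqrtDiff ξ).re := by
  have hcos := cos_pos_of_mem_strip hξ
  have hq := radicand_re_pos hξ
  have hS := csqrt_re_pos (mem_slitPlane_of_re_pos hq)
  have hS2 := norm_sq_csqrt_lt hq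
  have hnq : ‖Complex.sqrt (sqrtThree + 4 / (Complex.exp ξ + Complex.exp (-ξ)))‖ ^ 2 ≤
      2 + 2 / Real.cos ξ.im := by
    rw [← norm_pow, csqrt_sq]
    refine (norm_add_le _ _).trans ?_
    have h1 : ‖sqrtThree‖ ≤ 2 := by
      rw [sqrtThree, Complex.norm_real, Real.norm_of_nonneg sqrt_three_pos.le]
      exact Real.sqrt_le_iff.2 ⟨by norm_num, by norm_num⟩
    have h2 : 2 * Real.cos ξ.im ≤ ‖Complex.exp ξ + Complex.exp (-ξ)‖ := by
      refine le_trans ?_ (Complex.re_le_norm _)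
      rw [exp_add_exp_neg_re]
      have : 2 ≤ Real.exp ξ.re + Real.exp (-ξ.re) := by
        linarith [Real.add_one_le_exp ξ.re, Real.add_one_le_exp (-ξ.re)]
      gcongr
    have h3 : ‖4 / (Complex.exp ξ + Complex.exp (-ξ))‖ ≤ 2 / Real.cos ξ.im := by
      rw [norm_div, show ‖(4 : ℂ)‖ = 4 by norm_num, div_le_div_iff₀ (by linarith) hcos]
      linarith
    linarith
  -- Since Re ξ ≥ 0, |x| ≥ 1, and |x + √3|² ≥ |x|² + 3 ≥ 4.
  have hn : ‖1 / (Complex.exp ξ * (Complex.exp ξ + sqrtThree))‖ ≤ 1 / 2 := by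
    have hx := exp_re_pos hξ
    have hx1 : 1 ≤ ‖Complex.exp ξ‖ := by
      rw [Complex.norm_exp]; exact Real.one_le_exp hre
    have h2 : 2 ≤ ‖Complex.exp ξ + sqrtThree‖ := by
      have h3 : ‖Complex.exp ξ‖ ^ 2 + 3 ≤ ‖Complex.exp ξ + sqrtThree‖ ^ 2 := by
        rw [← Complex.normSq_eq_norm_sq, ← Complex.normSq_eq_norm_sq, Complex.normSq_apply,
          Complex.normSq_apply, Complex.add_re, Complex.add_im, sqrtThree_re, sqrtThree_im]
        have h4 : Real.sqrt 3 ^ 2 = 3 := Real.sq_sqrt (by norm_num)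
        nlinarith [mul_pos hx sqrt_three_pos]
      nlinarith [norm_nonneg (Complex.exp ξ + sqrtThree)]
    rw [norm_div, norm_mul, norm_one]
    apply one_div_le_one_div_of_le (by norm_num)
    nlinarith
  rw [sqrtDiff]
  set S := Complex.sqrt (sqrtThree + 4 / (Complex.exp ξ + Complex.exp (-ξ)))
  set e := 1 / (Complex.exp ξ * (Complex.exp ξ + sqrtThree))
  have hS0 := ne_zero_of_re_pos hS
  have hSn : 0 < ‖S‖ := norm_pos_iff.2 hS0
  -- The radicand has positive real part, so |arg S| < π/4 and Re S > |S|/√2. The perturbation e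
  -- costs at most |S|/2, which leaves |S|/5.
  have h1 : (7 / 10) * ‖S‖ ≤ S.re := by nlinarith
  have h2 : (1 / 5) * ‖S‖ ≤ ((1 + e) * (starRingEnd ℂ) S).re := by
    have h3 : ((1 + e) * (starRingEnd ℂ) S).re = S.re + (e * (starRingEnd ℂ) S).re := by
      rw [add_mul, one_mul, Complex.add_re, Complex.conj_re]
    have h4 : -(1 / 2 * ‖S‖) ≤ (e * (starRingEnd ℂ) S).re := by
      have h5 := neg_le_of_abs_le (Complex.abs_re_le_norm (e * (starRingEnd ℂ) S))
      rw [norm_mul, RCLike.norm_conj] at h5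
      have : ‖e‖ * ‖S‖ ≤ 1 / 2 * ‖S‖ := by gcongr
      linarith
    rw [h3]
    linarith
  have h3 : ((1 + e) / S).re = ((1 + e) * (starRingEnd ℂ) S).re / ‖S‖ ^ 2 := by
    rw [div_eq_mul_inv, Complex.inv_def, ← mul_assoc, Complex.re_mul_ofReal,
      Complex.normSq_eq_norm_sq, div_eq_mul_inv]
  have h4 : ‖S‖ ≤ Real.sqrt (2 + 2 / Real.cos ξ.im) := Real.le_sqrt_of_sq_le hnq
  rw [h3]
  calc 1 / (5 * Real.sqrt (2 + 2 / Real.cos ξ.im)) ≤ 1 / (5 * ‖S‖) := by gcongr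
    _ = 1 / 5 * ‖S‖ / ‖S‖ ^ 2 := by field_simp
    _ ≤ _ := by gcongr

lemma sqrtDiff_re_pos {ξ : ℂ} (hξ : ξ ∈ strip) (hre : 0 ≤ ξ.re) : 0 < (sqrtDiff ξ).re := by
  refine lt_of_lt_of_le ?_ (sqrtDiff_re_lower hξ hre)
  have := cos_pos_of_mem_strip hξ
  positivity

/-- For |x| = 1 the sum x + 1/x = 2 cos θ is real, so the denominator is a positive real, and only
the argument of 1/(x(x + √3)) matters. -/
lemma sqrtDiff_im_neg {θ : ℝ} (hθ : θ ∈ Ioo 0 (Real.pi / 2)) :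
    (sqrtDiff (θ * Complex.I)).im < 0 := by
  have hmem : (θ : ℂ) * Complex.I ∈ strip := by
    change |((θ : ℂ) * Complex.I).im| < _
    simp only [Complex.im_ofReal_mul, Complex.I_im, mul_one]
    rw [abs_of_pos hθ.1]
    exact hθ.2
  have hq := radicand_re_pos hmem
  have hS := csqrt_re_pos (mem_slitPlane_of_re_pos hq)
  have hx := exp_re_pos hmem
  have hk : Complex.exp (θ * Complex.I) + Complex.exp (-(θ * Complex.I)) =
      ((2 * Real.cos θ : ℝ) : ℂ) := by
    rw [← neg_mul, ← Complex.two_cos]; push_cast; ring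
  have hSreal : (Complex.sqrt (sqrtThree + 4 / (Complex.exp (θ * Complex.I) +
      Complex.exp (-(θ * Complex.I))))).im = 0 := by
    have h := csqrt_conj (mem_slitPlane_of_re_pos hq)
    rw [hk] at h ⊢
    simp only [map_add, map_div₀, conj_sqrtThree, map_ofNat, Complex.conj_ofReal] at h
    have := congrArg Complex.im h
    rw [Complex.conj_im] at this
    linarith
  rw [sqrtDiff]
  set S := Complex.sqrt (sqrtThree + 4 / (Complex.exp (θ * Complex.I) +
      Complex.exp (-(θ * Complex.I))))
  have hSr : S = (S.re : ℂ) := Complex.ext (by simp) (by simp [hSreal])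
  rw [hSr, Complex.div_ofReal_im]
  apply div_neg_of_neg_of_pos _ hS
  set x := Complex.exp (θ * Complex.I) with hxdef
  have hne := mul_ne_zero (Complex.exp_ne_zero (θ * Complex.I)) (add_sqrtThree_ne_zero hx.le)
  have hxim : 0 < x.im := by
    rw [hxdef, Complex.exp_ofReal_mul_I_im]
    exact Real.sin_pos_of_pos_of_lt_pi hθ.1 (by linarith [hθ.2, Real.pi_pos])
  rw [Complex.add_im, Complex.one_im, zero_add, one_div, Complex.inv_im]
  apply div_neg_of_neg_of_pos _ (Complex.normSq_pos.2 hne)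
  rw [Complex.mul_im, Complex.add_im, Complex.add_re, sqrtThree_re, sqrtThree_im]
  have := sqrt_three_pos
  nlinarith [mul_pos hx hxim, mul_pos hxim this]

/-! ### Primitives by integration along rays -/

lemma hasDerivAt_integral_ray {U : Set ℂ} (hU : IsOpen U) {l : ℂ → ℂ}
    (hl : ∀ z ∈ U, AnalyticAt ℂ l z) {p q : ℝ → ℂ} (hp : Continuous p) (hq : Continuous q)
    (hstar : ∀ z ∈ U, ∀ t ∈ Icc (0 : ℝ) 1, q t * z ∈ U) {z : ℂ} (hz : z ∈ U) :
    HasDerivAt (fun z => ∫ t in (0 : ℝ)..1, p t * l (q t * z))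
      (∫ t in (0 : ℝ)..1, p t * (deriv l (q t * z) * q t)) z := by
  have hlc : ContinuousOn l U := fun z hz => (hl z hz).continuousAt.continuousWithinAt
  have hlc' : ContinuousOn (deriv l) U := fun z hz =>
    (hl z hz).deriv.continuousAt.continuousWithinAt
  have hm : ContinuousOn (fun x : ℂ × ℝ => q x.2 * x.1) (U ×ˢ Icc (0 : ℝ) 1) := by fun_prop
  have hmaps : MapsTo (fun x : ℂ × ℝ => q x.2 * x.1) (U ×ˢ Icc (0 : ℝ) 1) U := fun x hx =>
    hstar x.1 hx.1 x.2 hx.2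
  have hpc : ContinuousOn (fun x : ℂ × ℝ => p x.2) (U ×ˢ Icc (0 : ℝ) 1) := by fun_prop
  have hqc : ContinuousOn (fun x : ℂ × ℝ => q x.2) (U ×ˢ Icc (0 : ℝ) 1) := by fun_prop
  refine hasDerivAt_intervalIntegral_of_continuousOn hU
    (F := fun z t => p t * l (q t * z)) (F' := fun z t => p t * (deriv l (q t * z) * q t))
    (hpc.mul (hlc.comp hm hmaps)) (hpc.mul ((hlc'.comp hm hmaps).mul hqc)) ?_ hz
  intro x hx t ht
  have h1 : HasDerivAt (fun z : ℂ => q t * z) (q t) x := by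
    simpa using (hasDerivAt_id' x).const_mul (q t)
  have h2 := (hl _ (hstar x hx t ht)).differentiableAt.hasDerivAt
  exact (h2.comp x h1).const_mul (p t)

lemma hasDerivAt_ray {l : ℂ → ℂ} {q : ℝ → ℂ} {z q' : ℂ} {t : ℝ} (hl : AnalyticAt ℂ l (q t * z))
    (hq : HasDerivAt q q' t) :
    HasDerivAt (fun t => l (q t * z)) (deriv l (q t * z) * (q' * z)) t :=
  hl.differentiableAt.hasDerivAt.comp t (hq.mul_const z)

/-- The primitive of `sqrtDiff` in the strip that vanishes at `0`. -/
def primDiff (ξ : ℂ) : ℂ := ξ * ∫ t in (0 : ℝ)..1, 1 * sqrtDiff ((t : ℂ) * ξ)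

lemma hasDerivAt_primDiff {ξ : ℂ} (hξ : ξ ∈ strip) : HasDerivAt primDiff (sqrtDiff ξ) ξ := by
  have h1 := hasDerivAt_integral_ray isOpen_strip (fun z hz => analyticAt_sqrtDiff hz)
    (p := fun _ => 1) (q := fun t => (t : ℂ)) continuous_const Complex.continuous_ofReal
    (fun z hz t ht => mul_mem_strip hz ht) hξ
  refine ((hasDerivAt_id' ξ).mul h1).congr_deriv ?_
  -- The integrand of the differentiated formula is the t-derivative of t · `sqrtDiff (tξ)`, so its
  -- integral is the value at t = 1.
  have hd : ∀ t ∈ Icc (0 : ℝ) 1, HasDerivAt (fun t : ℝ => (t : ℂ) * sqrtDiff ((t : ℂ) * ξ))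
      (1 * sqrtDiff (t * ξ) + ξ * (1 * (deriv sqrtDiff (t * ξ) * t))) t := by
    intro t ht
    have h2 : HasDerivAt (fun t : ℝ => (t : ℂ)) 1 t := Complex.ofRealCLM.hasDerivAt
    have h3 := hasDerivAt_ray (z := ξ) (analyticAt_sqrtDiff (mul_mem_strip hξ ht)) h2
    refine (h2.mul h3).congr_deriv ?_
    ring
  have hray : ContinuousOn (fun t : ℝ => (t : ℂ) * ξ) (Icc 0 1) := by fun_prop
  have hc1 : ContinuousOn (fun t : ℝ => 1 * sqrtDiff (t * ξ)) (uIcc 0 1) := by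
    rw [uIcc_of_le zero_le_one]
    have : ContinuousOn sqrtDiff strip := fun z hz =>
      (analyticAt_sqrtDiff hz).continuousAt.continuousWithinAt
    exact continuousOn_const.mul (this.comp hray fun t ht => mul_mem_strip hξ ht)
  have hc2 : ContinuousOn (fun t : ℝ => 1 * (deriv sqrtDiff (t * ξ) * t)) (uIcc 0 1) := by
    rw [uIcc_of_le zero_le_one]
    have : ContinuousOn (deriv sqrtDiff) strip := fun z hz =>
      (analyticAt_sqrtDiff hz).deriv.continuousAt.continuousWithinAt
    exact continuousOn_const.mul ((this.comp hray fun t ht => mul_mem_strip hξ ht).mul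
      Complex.continuous_ofReal.continuousOn)
  have hFTC := intervalIntegral.integral_eq_sub_of_hasDerivAt (a := (0 : ℝ)) (b := 1)
    (fun t ht => hd t (by rwa [uIcc_of_le zero_le_one] at ht))
    (hc1.intervalIntegrable.add (hc2.intervalIntegrable.const_mul ξ))
  rw [intervalIntegral.integral_add hc1.intervalIntegrable
    (hc2.intervalIntegrable.const_mul ξ)] at hFTC
  rw [intervalIntegral.integral_const_mul] at hFTC
  simpa using hFTC

lemma primDiff_conj {ξ : ℂ} (hξ : ξ ∈ strip) :
    primDiff ((starRingEnd ℂ) ξ) = (starRingEnd ℂ) (primDiff ξ) := by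
  rw [primDiff, primDiff, map_mul, intervalIntegral.integral_of_le zero_le_one,
    intervalIntegral.integral_of_le zero_le_one, ← integral_conj]
  congr 1
  refine setIntegral_congr_fun measurableSet_Ioc fun t ht => ?_
  have := sqrtDiff_conj (mul_mem_strip hξ (Ioc_subset_Icc_self ht))
  simpa using this

/-- The real part of the primitive, as a function of the two real coordinates. -/
def level (ρ θ : ℝ) : ℝ := (primDiff (ρ + θ * Complex.I)).re

lemma mem_strip_iff {ρ θ : ℝ} :
    (ρ : ℂ) + θ * Complex.I ∈ strip ↔ |θ| < Real.pi / 2 := by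
  change |((ρ : ℂ) + θ * Complex.I).im| < _ ↔ _
  simp

lemma level_neg {ρ θ : ℝ} (hθ : |θ| < Real.pi / 2) : level ρ (-θ) = level ρ θ := by
  rw [level, level]
  have h := primDiff_conj (mem_strip_iff (ρ := ρ).2 hθ)
  have : (starRingEnd ℂ) ((ρ : ℂ) + θ * Complex.I) = ρ + ((-θ : ℝ) : ℂ) * Complex.I := by
    simp
  rw [this] at h
  rw [h, Complex.conj_re]

lemma hasDerivAt_re_primDiff_comp {η : ℝ → ℂ} {η' : ℂ} {t : ℝ} (hη : HasDerivAt η η' t)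
    (hs : η t ∈ strip) :
    HasDerivAt (fun t => (primDiff (η t)).re) (sqrtDiff (η t) * η').re t := by
  have h1 : HasDerivAt (fun t => primDiff (η t)) (sqrtDiff (η t) * η') t :=
    (hasDerivAt_primDiff hs).comp t hη
  exact Complex.reCLM.hasFDerivAt.comp_hasDerivAt t h1

lemma hasDerivAt_ofReal (t : ℝ) : HasDerivAt (fun t : ℝ => (t : ℂ)) 1 t :=
  Complex.ofRealCLM.hasDerivAt

lemma hasDerivAt_level_left {ρ θ : ℝ} (hθ : |θ| < Real.pi / 2) :
    HasDerivAt (fun ρ => level ρ θ) (sqrtDiff (ρ + θ * Complex.I)).re ρ := by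
  have := hasDerivAt_re_primDiff_comp ((hasDerivAt_ofReal ρ).add_const (θ * Complex.I))
    (mem_strip_iff.2 hθ)
  simpa [level] using this

lemma strictMonoOn_level {θ : ℝ} (hθ : |θ| < Real.pi / 2) :
    StrictMonoOn (fun ρ => level ρ θ) (Ici 0) := by
  refine strictMonoOn_of_deriv_pos (convex_Ici 0)
    (fun ρ _ => (hasDerivAt_level_left hθ).continuousAt.continuousWithinAt) ?_
  intro ρ hρ
  rw [interior_Ici] at hρ
  rw [(hasDerivAt_level_left hθ).deriv]
  refine sqrtDiff_re_pos (mem_strip_iff.2 hθ) ?_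
  simpa using le_of_lt hρ

lemma exists_level_eq {θ c : ℝ} (hθ : |θ| < Real.pi / 2) (hc : level 0 θ < c) :
    ∃ ρ, 0 < ρ ∧ level ρ θ = c := by
  set ε := 1 / (5 * Real.sqrt (2 + 2 / Real.cos θ)) with hε
  have hε0 : 0 < ε := by
    have : 0 < Real.cos θ := Real.cos_pos_of_mem_Ioo (abs_lt.1 hθ)
    positivity
  have hcont : ∀ ρ, ContinuousAt (fun ρ => level ρ θ) ρ := fun ρ =>
    (hasDerivAt_level_left hθ).continuousAt
  -- With slope at least ε, the level c is reached by this abscissa.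
  set R := (c - level 0 θ) / ε with hR
  have hR0 : 0 < R := div_pos (sub_pos.2 hc) hε0
  have hgrow : ε * (R - 0) ≤ level R θ - level 0 θ := by
    refine (convex_Ici (0 : ℝ)).mul_sub_le_image_sub_of_le_deriv
      (f := fun ρ => level ρ θ) (fun ρ _ => (hcont ρ).continuousWithinAt)
      (fun ρ _ => (hasDerivAt_level_left hθ).differentiableAt.differentiableWithinAt) ?_
      0 self_mem_Ici R hR0.le hR0.le
    intro ρ hρ
    rw [interior_Ici] at hρ
    rw [(hasDerivAt_level_left hθ).deriv]
    have := sqrtDiff_re_lower (mem_strip_iff (ρ := ρ).2 hθ) (by simpa using le_of_lt hρ)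
    simpa [hε] using this
  have hRc : c ≤ level R θ := by
    rw [sub_zero, hR, mul_div_cancel₀ _ hε0.ne'] at hgrow
    linarith
  obtain ⟨ρ, hρ, hρc⟩ := intermediate_value_Icc hR0.le
    (fun x _ => (hcont x).continuousWithinAt) ⟨hc.le, hRc⟩
  refine ⟨ρ, lt_of_le_of_ne hρ.1 ?_, hρc⟩
  rintro rfl
  exact hc.ne hρc

lemma hasDerivAt_level_right {θ : ℝ} (hθ : |θ| < Real.pi / 2) :
    HasDerivAt (fun θ => level 0 θ) (-(sqrtDiff (θ * Complex.I)).im) θ := by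
  have := hasDerivAt_re_primDiff_comp
    (((hasDerivAt_ofReal θ).mul_const Complex.I).const_add ((0 : ℝ) : ℂ)) (mem_strip_iff.2 hθ)
  simpa [level] using this

lemma strictMonoOn_level_zero : StrictMonoOn (fun θ => level 0 θ) (Ico 0 (Real.pi / 2)) := by
  have habs : ∀ θ ∈ Ico 0 (Real.pi / 2), |θ| < Real.pi / 2 := fun θ h => by
    rw [abs_of_nonneg h.1]; exact h.2
  refine strictMonoOn_of_deriv_pos (convex_Ico _ _)
    (fun θ h => (hasDerivAt_level_right (habs θ h)).continuousAt.continuousWithinAt) ?_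
  intro θ hθ
  rw [interior_Ico] at hθ
  rw [(hasDerivAt_level_right (habs θ (Ioo_subset_Ico_self hθ))).deriv, neg_pos]
  exact sqrtDiff_im_neg hθ

/-! ### Trajectories at a simple zero -/

/-- The choice is A(y) = y^(-3/2) ∫₀^y √s l(s) ds, so the equation is d/dy (y^(3/2) A) = √y l. The
substitution s = t²y gives the integral used below, in which no root of y appears. -/
lemma exists_halfIntegral {l : ℂ → ℂ} (hl : AnalyticAt ℂ l 0) :
    ∃ A : ℂ → ℂ, AnalyticAt ℂ A 0 ∧ ∀ᶠ y in 𝓝 0, 3 / 2 * A y + y * deriv A y = l y := by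
  obtain ⟨R, hR, hball⟩ := Metric.eventually_nhds_iff_ball.1 hl.eventually_analyticAt
  set U := Metric.ball (0 : ℂ) R with hU
  have hp : Continuous fun t : ℝ => 2 * (t : ℂ) ^ 2 := by fun_prop
  have hq : Continuous fun t : ℝ => (t : ℂ) ^ 2 := by fun_prop
  have hstar : ∀ z ∈ U, ∀ t ∈ Icc (0 : ℝ) 1, (t : ℂ) ^ 2 * z ∈ U := by
    intro z hz t ht
    rw [hU, mem_ball_zero_iff] at hz ⊢
    rw [norm_mul, norm_pow, Complex.norm_real, Real.norm_of_nonneg ht.1]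
    have : t ^ 2 ≤ 1 := pow_le_one₀ ht.1 ht.2
    calc t ^ 2 * ‖z‖ ≤ 1 * ‖z‖ := by gcongr
      _ < R := by rwa [one_mul]
  have hd : ∀ y ∈ U, HasDerivAt (fun z => ∫ t in (0 : ℝ)..1, 2 * (t : ℂ) ^ 2 * l ((t : ℂ) ^ 2 * z))
      (∫ t in (0 : ℝ)..1, 2 * (t : ℂ) ^ 2 * (deriv l ((t : ℂ) ^ 2 * y) * (t : ℂ) ^ 2)) y :=
    fun y hy => hasDerivAt_integral_ray (p := fun t => 2 * (t : ℂ) ^ 2) (q := fun t => (t : ℂ) ^ 2)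
      Metric.isOpen_ball hball hp hq hstar hy
  refine ⟨fun z => ∫ t in (0 : ℝ)..1, 2 * (t : ℂ) ^ 2 * l ((t : ℂ) ^ 2 * z), ?_, ?_⟩
  · have : DifferentiableOn ℂ (fun z => ∫ t in (0 : ℝ)..1, 2 * (t : ℂ) ^ 2 * l ((t : ℂ) ^ 2 * z)) U :=
      fun y hy => (hd y hy).differentiableAt.differentiableWithinAt
    exact this.analyticAt (Metric.ball_mem_nhds 0 hR)
  · filter_upwards [Metric.ball_mem_nhds (0 : ℂ) hR] with y hy
    rw [(hd y hy).deriv]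
    have hft : ∀ t ∈ Icc (0 : ℝ) 1, HasDerivAt (fun t : ℝ => (t : ℂ) ^ 3 * l ((t : ℂ) ^ 2 * y))
        (3 / 2 * (2 * (t : ℂ) ^ 2 * l ((t : ℂ) ^ 2 * y)) +
          y * (2 * (t : ℂ) ^ 2 * (deriv l ((t : ℂ) ^ 2 * y) * (t : ℂ) ^ 2))) t := by
      intro t ht
      have h2 : HasDerivAt (fun t : ℝ => (t : ℂ) ^ 2) (2 * t) t := by
        simpa using (hasDerivAt_ofReal t).fun_pow 2
      have h3 : HasDerivAt (fun t : ℝ => (t : ℂ) ^ 3) (3 * t ^ 2) t := by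
        simpa using (hasDerivAt_ofReal t).fun_pow 3
      refine (h3.mul (hasDerivAt_ray (q := fun t : ℝ => (t : ℂ) ^ 2) (z := y) (hball _ (hstar y hy t ht)) h2)).congr_deriv ?_
      ring
    have hray : ContinuousOn (fun t : ℝ => (t : ℂ) ^ 2 * y) (Icc 0 1) := by fun_prop
    have hc1 : ContinuousOn (fun t : ℝ => 2 * (t : ℂ) ^ 2 * l ((t : ℂ) ^ 2 * y)) (uIcc 0 1) := by
      rw [uIcc_of_le zero_le_one]
      have : ContinuousOn l U := fun z hz => (hball z hz).continuousAt.continuousWithinAt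
      exact hp.continuousOn.mul (this.comp hray fun t ht => hstar y hy t ht)
    have hc2 : ContinuousOn
        (fun t : ℝ => 2 * (t : ℂ) ^ 2 * (deriv l ((t : ℂ) ^ 2 * y) * (t : ℂ) ^ 2)) (uIcc 0 1) := by
      rw [uIcc_of_le zero_le_one]
      have : ContinuousOn (deriv l) U := fun z hz =>
        (hball z hz).deriv.continuousAt.continuousWithinAt
      exact hp.continuousOn.mul ((this.comp hray fun t ht => hstar y hy t ht).mul hq.continuousOn)
    have hFTC := intervalIntegral.integral_eq_sub_of_hasDerivAt (a := (0 : ℝ)) (b := 1)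
      (fun t ht => hft t (by rwa [uIcc_of_le zero_le_one] at ht))
      ((hc1.intervalIntegrable.const_mul (3 / 2)).add (hc2.intervalIntegrable.const_mul y))
    rw [intervalIntegral.integral_add (hc1.intervalIntegrable.const_mul (3 / 2))
      (hc2.intervalIntegrable.const_mul y)] at hFTC
    rw [intervalIntegral.integral_const_mul, intervalIntegral.integral_const_mul] at hFTC
    simpa using hFTC

/-- A quadratic differential has near a simple zero a local coordinate in which it is `-ζ dζ²`. -/
lemma exists_trajectory_of_simple_zero {χ : ℂ → ℂ} {p v : ℂ} (hχ : AnalyticAt ℂ χ p)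
    (h0 : χ p = 0) (hv : deriv χ p * v ^ 3 = -1) :
    ∃ G : ℂ → ℂ, AnalyticAt ℂ G 0 ∧ G 0 = p ∧ deriv G 0 = v ∧
      ∀ᶠ τ in 𝓝 0, χ (G τ) * deriv G τ ^ 2 = -τ := by
  have hk0 : deriv χ p ≠ 0 := by
    intro h
    rw [h, zero_mul] at hv
    norm_num at hv
  have hv0 : v ≠ 0 := by
    rintro rfl
    norm_num at hv
  obtain ⟨k, hka, hk⟩ : ∃ k : ℂ → ℂ, AnalyticAt ℂ k 0 ∧ ∀ y, χ (p + y) = y * k y := by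
    obtain ⟨P, hP⟩ := hχ
    refine ⟨fun y => dslope χ p (p + y), ?_, fun y => ?_⟩
    · exact AnalyticAt.comp_of_eq (g := dslope χ p) (f := fun y : ℂ => p + y)
        hP.has_fpower_series_dslope_fslope.analyticAt (by fun_prop) (by simp)
    · have := sub_smul_dslope χ p (p + y)
      rw [h0, sub_zero, add_sub_cancel_left, smul_eq_mul] at this
      exact this.symm
  have hk00 : k 0 = deriv χ p := by
    have h1 : HasDerivAt (fun y : ℂ => χ (p + y)) (deriv χ p) 0 := by
      have h2 : HasDerivAt χ (deriv χ p) (p + 0) := by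
        rw [add_zero]; exact hχ.differentiableAt.hasDerivAt
      simpa using h2.comp_const_add p 0
    have h2 : HasDerivAt (fun y : ℂ => y * k y) (k 0) 0 := by
      simpa using (hasDerivAt_id' (0 : ℂ)).fun_mul hka.differentiableAt.hasDerivAt
    rw [funext hk] at h1
    exact h2.unique h1
  obtain ⟨d, hd⟩ := IsAlgClosed.exists_pow_nat_eq (k 0) (n := 2) (by norm_num)
  have hk0' : k 0 ≠ 0 := by rwa [hk00]
  -- A root of k makes √y l(y) a root of χ(p + y), with primitive y^(3/2) A(y).
  set l : ℂ → ℂ := fun y => d * Complex.sqrt (k y / k 0) with hl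
  have hla : AnalyticAt ℂ l 0 := by
    refine analyticAt_const.mul (analyticAt_csqrt (hka.div_const) ?_)
    rw [div_self hk0']
    exact Complex.one_mem_slitPlane
  have hlsq : ∀ y, l y ^ 2 = k y := by
    intro y
    rw [hl]
    simp only
    rw [mul_pow, csqrt_sq, hd, mul_div_cancel₀ _ hk0']
  obtain ⟨A, hAa, hA⟩ := exists_halfIntegral hla
  have hA0 : A 0 = 2 / 3 * l 0 := by
    have := hA.self_of_nhds
    linear_combination (2 / 3) * this
  have hA0sq : A 0 ^ 2 = 4 / 9 * deriv χ p := by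
    rw [hA0, mul_pow, hlsq, hk00]; norm_num
  have hA0' : A 0 ^ 2 ≠ 0 := by
    rw [hA0sq]; exact mul_ne_zero (by norm_num) hk0
  -- A coordinate ζ with χ dy² = -ζ dζ² must satisfy -(4/9)ζ³ = y³A². Writing ζ = y m turns this
  -- into m³ = -(9/4)A², solved by the cube root with m(0) = 1/v, which is what gives the inverse
  -- the derivative v.
  set m : ℂ → ℂ := fun y => 1 / v * (A y ^ 2 / A 0 ^ 2) ^ ((3 : ℕ)⁻¹ : ℂ) with hm
  have hma : AnalyticAt ℂ m 0 := by
    refine analyticAt_const.mul (((hAa.pow 2).div_const).cpow analyticAt_const ?_)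
    simp only [Pi.pow_apply]
    rw [div_self hA0']
    exact Complex.one_mem_slitPlane
  have hm0 : m 0 = 1 / v := by
    rw [hm]
    simp only
    rw [div_self hA0', Complex.one_cpow, mul_one]
  have hmcube : ∀ y, m y ^ 3 = -(9 / 4) * A y ^ 2 := by
    intro y
    rw [hm]
    simp only
    rw [mul_pow, Complex.cpow_nat_inv_pow _ (by norm_num), hA0sq]
    field_simp
    linear_combination A y ^ 2 * hv
  set ζ : ℂ → ℂ := fun y => y * m y with hζ
  have hζa : AnalyticAt ℂ ζ 0 := by fun_prop
  have hζ' : ∀ᶠ y in 𝓝 0, HasDerivAt ζ (m y + y * deriv m y) y := by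
    filter_upwards [hma.eventually_analyticAt] with y hy
    simpa using (hasDerivAt_id' y).fun_mul hy.differentiableAt.hasDerivAt
  have hζd0 : deriv ζ 0 = 1 / v := by
    rw [hζ'.self_of_nhds.deriv, hm0]; ring
  have hζd0' : deriv ζ 0 ≠ 0 := by rw [hζd0]; exact one_div_ne_zero hv0
  have hm_ne : ∀ᶠ y in 𝓝 0, m y ≠ 0 :=
    hma.continuousAt.eventually_ne (by rw [hm0]; exact one_div_ne_zero hv0)
  have hkey : ∀ᶠ y in 𝓝 0, χ (p + y) = -(ζ y) * deriv ζ y ^ 2 := by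
    filter_upwards [hζ', hA, hAa.eventually_analyticAt, hma.eventually_analyticAt, hm_ne] with
      y h1 h2 h3 h4 h5
    have h6 : 3 * m y ^ 2 * deriv m y = -(9 / 4) * (2 * A y * deriv A y) := by
      have h7 : HasDerivAt (fun y => m y ^ 3) (3 * m y ^ 2 * deriv m y) y := by
        simpa using h4.differentiableAt.hasDerivAt.fun_pow 3
      have h8 : HasDerivAt (fun y => -(9 / 4) * A y ^ 2) (-(9 / 4) * (2 * A y * deriv A y)) y := by
        simpa using (h3.differentiableAt.hasDerivAt.fun_pow 2).const_mul (-(9 / 4) : ℂ)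
      rw [funext hmcube] at h7
      exact h7.unique h8
    have h9 : m y ^ 2 * (m y + y * deriv m y) = -(3 / 2) * A y * l y := by
      linear_combination hmcube y + (1 / 3) * y * h6 - (3 / 2) * A y * h2
    rw [hk, h1.deriv, hζ, ← hlsq]
    -- The factor m⁴ lets the relation for m²(m + y m') be squared and the relation for m³ be used,
    -- without division.
    apply mul_left_cancel₀ (pow_ne_zero 4 h5)
    have h10 : (m y ^ 2 * (m y + y * deriv m y)) ^ 2 = (-(3 / 2) * A y * l y) ^ 2 := by rw [h9]
    linear_combination (y * m y) * h10 + (y * l y ^ 2 * m y) * hmcube y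
  set g := hζa.hasStrictDerivAt.localInverse _ _ _ hζd0' with hg
  have hζ0 : ζ 0 = 0 := by simp [hζ]
  have hga : AnalyticAt ℂ g 0 := by
    have := hζa.analyticAt_localInverse hζd0'
    rwa [hζ0] at this
  have hg0 : g 0 = 0 := by
    have : g (ζ 0) = 0 := HasStrictFDerivAt.localInverse_apply_image ..
    rwa [hζ0] at this
  have hright : ∀ᶠ τ in 𝓝 (0 : ℂ), ζ (g τ) = τ := by
    have := hζa.hasStrictDerivAt.eventually_right_inverse hζd0'
    rwa [hζ0] at this
  have hgt : Tendsto g (𝓝 0) (𝓝 0) := by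
    have := hga.continuousAt.tendsto
    rwa [hg0] at this
  have hder : ∀ᶠ τ in 𝓝 (0 : ℂ), deriv ζ (g τ) * deriv g τ = 1 := by
    filter_upwards [hright.eventually_nhds, hga.eventually_analyticAt,
      hgt.eventually hζa.eventually_analyticAt] with τ h1 h2 h3
    have h4 := h3.differentiableAt.hasDerivAt.comp τ h2.differentiableAt.hasDerivAt
    have h5 : HasDerivAt (ζ ∘ g) 1 τ := (hasDerivAt_id τ).congr_of_eventuallyEq h1
    exact h4.unique h5
  have hderG : ∀ τ, deriv (fun τ => p + g τ) τ = deriv g τ := fun τ => deriv_const_add p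
  refine ⟨fun τ => p + g τ, analyticAt_const.add hga, by simp [hg0], ?_, ?_⟩
  · rw [hderG]
    have h1 := hder.self_of_nhds
    rw [hg0, hζd0] at h1
    field_simp at h1
    exact h1
  · filter_upwards [hgt.eventually hkey, hright, hder] with τ h1 h2 h3
    rw [h1, hderG, h2]
    linear_combination (-τ * (deriv ζ (g τ) * deriv g τ + 1)) * h3

/-! ### The critical trajectory as a graph in the strip -/

lemma eventually_lt_of_deriv_pos {f : ℝ → ℝ} {f' a : ℝ} (h : HasDerivAt f f' a) (hf' : 0 < f') :
    ∀ᶠ x in 𝓝[>] a, f a < f x := by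
  have h1 := (hasDerivAt_iff_tendsto_slope.1 h).mono_left
    (nhdsWithin_mono a fun x (hx : a < x) => hx.ne')
  filter_upwards [h1.eventually (lt_mem_nhds hf'), self_mem_nhdsWithin] with x hx hax
  have hax' : 0 < x - a := sub_pos.2 hax
  rw [slope_def_field] at hx
  have := (div_pos_iff_of_pos_right hax').1 hx
  linarith

lemma eventually_gt_of_deriv_neg_left {f : ℝ → ℝ} {f' a : ℝ} (h : HasDerivAt f f' a)
    (hf' : f' < 0) : ∀ᶠ x in 𝓝[<] a, f a < f x := by
  have h1 := (hasDerivAt_iff_tendsto_slope.1 h).mono_left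
    (nhdsWithin_mono a fun x (hx : x < a) => hx.ne)
  filter_upwards [h1.eventually (gt_mem_nhds hf'), self_mem_nhdsWithin] with x hx hax
  have hax' : x - a < 0 := sub_neg.2 hax
  rw [slope_def_field, div_neg_iff] at hx
  rcases hx with hx | hx
  · linarith [hx.1]
  · linarith [hx.2]

lemma analyticAt_re_comp {η : ℝ → ℂ} {τ : ℝ} (h : AnalyticAt ℝ η τ) :
    AnalyticAt ℝ (fun τ => (η τ).re) τ :=
  AnalyticAt.fun_comp (Complex.reCLM.analyticAt _) h

lemma analyticAt_im_comp {η : ℝ → ℂ} {τ : ℝ} (h : AnalyticAt ℝ η τ) :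
    AnalyticAt ℝ (fun τ => (η τ).im) τ :=
  AnalyticAt.fun_comp (Complex.imCLM.analyticAt _) h

lemma analyticAt_comp_ofReal {G : ℂ → ℂ} {τ : ℝ} (h : AnalyticAt ℂ G τ) :
    AnalyticAt ℝ (fun τ : ℝ => G τ) τ :=
  AnalyticAt.fun_comp (g := G) (f := fun τ : ℝ => (τ : ℂ)) h.restrictScalars
    (Complex.ofRealCLM.analyticAt τ)

lemma hasDerivAt_comp_ofReal' {G : ℂ → ℂ} {τ : ℝ} (h : AnalyticAt ℂ G τ) :
    HasDerivAt (fun τ : ℝ => G τ) (deriv G τ) τ :=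
  h.differentiableAt.hasDerivAt.comp_ofReal

/-- A path that is not horizontal at a point can be parametrized by the imaginary part. -/
lemma exists_graph_param {η : ℝ → ℂ} {η' : ℂ} {τ : ℝ} (hη : AnalyticAt ℝ η τ)
    (hd : HasDerivAt η η' τ) (him : η'.im ≠ 0) :
    ∃ σ : ℝ → ℝ, AnalyticAt ℝ σ (η τ).im ∧ σ (η τ).im = τ ∧
      HasDerivAt σ (η'.im)⁻¹ (η τ).im ∧ ∀ᶠ θ in 𝓝 (η τ).im, (η (σ θ)).im = θ := by
  have ha := analyticAt_im_comp hη
  have hd' : HasDerivAt (fun τ => (η τ).im) η'.im τ :=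
    Complex.imCLM.hasFDerivAt.comp_hasDerivAt τ hd
  have hne : deriv (fun τ => (η τ).im) τ ≠ 0 := by rwa [hd'.deriv]
  refine ⟨ha.hasStrictDerivAt.localInverse _ _ _ hne, ha.analyticAt_localInverse hne,
    HasStrictFDerivAt.localInverse_apply_image .., ?_,
    ha.hasStrictDerivAt.eventually_right_inverse hne⟩
  exact (ha.hasStrictDerivAt.to_localInverse hne).hasDerivAt.congr_deriv (by rw [hd'.deriv])

lemma analyticAt_quadDiff_exp {ξ : ℂ} (h : 0 ≤ (Complex.exp ξ).re) :
    AnalyticAt ℂ (fun ξ => quadDiff (Complex.exp ξ)) ξ := by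
  have h1 := add_sqrtThree_ne_zero h
  have h2 := sqrtThree_mul_add_one_ne_zero h
  have h3 : Complex.exp ξ ^ 2 * (sqrtThree * Complex.exp ξ + 1) * (Complex.exp ξ + sqrtThree) ^ 3 ≠ 0 :=
    mul_ne_zero (mul_ne_zero (pow_ne_zero 2 (Complex.exp_ne_zero ξ)) h2) (pow_ne_zero 3 h1)
  unfold quadDiff
  fun_prop (disch := assumption)

lemma exp_pi_div_two_mul_I : Complex.exp (Real.pi / 2 * Complex.I) = Complex.I := by
  rw [Complex.exp_mul_I, Complex.cos_pi_div_two, Complex.sin_pi_div_two]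
  ring

lemma deriv_quadDiff_exp :
    deriv (fun ξ => quadDiff (Complex.exp ξ)) (Real.pi / 2 * Complex.I) =
      6 / ((1 + sqrtThree * Complex.I) * (-(Complex.I + sqrtThree) ^ 3)) := by
  set p : ℂ := Real.pi / 2 * Complex.I
  have hp : Complex.exp p = Complex.I := exp_pi_div_two_mul_I
  set H : ℂ → ℂ := fun x => (x ^ 2 + sqrtThree * x + 1) ^ 2 /
    (x ^ 2 * (sqrtThree * x + 1) * (x + sqrtThree) ^ 3) with hH
  have h1 : Complex.I + sqrtThree ≠ 0 := add_sqrtThree_ne_zero (by simp)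
  have h2 : sqrtThree * Complex.I + 1 ≠ 0 := sqrtThree_mul_add_one_ne_zero (by simp)
  have h3 : Complex.I ^ 2 * (sqrtThree * Complex.I + 1) * (Complex.I + sqrtThree) ^ 3 ≠ 0 :=
    mul_ne_zero (mul_ne_zero (pow_ne_zero 2 Complex.I_ne_zero) h2) (pow_ne_zero 3 h1)
  have hHd : DifferentiableAt ℂ (fun ξ => H (Complex.exp ξ)) p := by
    have : Complex.exp p ^ 2 * (sqrtThree * Complex.exp p + 1) *
      (Complex.exp p + sqrtThree) ^ 3 ≠ 0 := by rwa [hp]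
    simp only [hH]
    fun_prop (disch := assumption)
  have hf : HasDerivAt (fun ξ => Complex.exp ξ ^ 2 + 1) (-2) p := by
    have := ((Complex.hasDerivAt_exp p).fun_pow 2).add_const 1
    rw [hp] at this
    refine this.congr_deriv ?_
    linear_combination 2 * Complex.I_sq
  have hq : (fun ξ => quadDiff (Complex.exp ξ)) =
      fun ξ => (Complex.exp ξ ^ 2 + 1) * H (Complex.exp ξ) := by
    funext ξ
    rw [quadDiff, hH, mul_div_assoc]
  rw [hq, (hf.fun_mul hHd.hasDerivAt).deriv, hp, hH]
  simp only [Complex.I_sq]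
  have h4 : 1 + sqrtThree * Complex.I ≠ 0 := by rwa [add_comm]
  field_simp
  linear_combination (2 * Complex.I ^ 2 * (1 + Complex.I * sqrtThree)) * sqrtThree_sq
    + (6 * (1 + Complex.I * sqrtThree)) * Complex.I_sq

/-- The derivative of the differential at iπ/2 has modulus 3/8, and -1 divided by it has argument
5π/6, equivalently -7π/6. Of the three cube roots, the one with argument -7π/18 points down into the
strip and to the right. -/
lemma exists_initial_direction : ∃ v : ℂ, 0 < v.re ∧ v.im < 0 ∧
    deriv (fun ξ => quadDiff (Complex.exp ξ)) (Real.pi / 2 * Complex.I) * v ^ 3 = -1 := by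
  set a : ℝ := (8 / 3 : ℝ) ^ ((3 : ℕ) : ℝ)⁻¹ with ha
  have ha0 : 0 < a := by positivity
  have ha3 : a ^ 3 = 8 / 3 := Real.rpow_inv_natCast_pow (by norm_num) (by norm_num)
  set φ : ℝ := 7 * Real.pi / 18 with hφ
  have hpi := Real.pi_pos
  refine ⟨a * Complex.exp (((-φ : ℝ) : ℂ) * Complex.I), ?_, ?_, ?_⟩
  · rw [Complex.re_ofReal_mul, Complex.exp_ofReal_mul_I_re, Real.cos_neg]
    exact mul_pos ha0 (Real.cos_pos_of_mem_Ioo ⟨by linarith, by linarith⟩)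
  · rw [Complex.im_ofReal_mul, Complex.exp_ofReal_mul_I_im, Real.sin_neg]
    have := Real.sin_pos_of_pos_of_lt_pi (x := φ) (by positivity) (by linarith)
    nlinarith
  · have h1 : Complex.exp (((-φ : ℝ) : ℂ) * Complex.I) ^ 3 = (Complex.I - sqrtThree) / 2 := by
      rw [← Complex.exp_nat_mul]
      have e : ((3 : ℕ) : ℂ) * (((-φ : ℝ) : ℂ) * Complex.I) =
          (((-(Real.pi / 6 + Real.pi)) : ℝ) : ℂ) * Complex.I := by
        rw [hφ]; push_cast; ring
      rw [e, Complex.exp_mul_I, ← Complex.ofReal_cos, ← Complex.ofReal_sin, Real.cos_neg,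
        Real.sin_neg, Real.cos_add_pi, Real.sin_add_pi, Real.cos_pi_div_six, Real.sin_pi_div_six,
        sqrtThree]
      push_cast
      ring
    have h2 : (a : ℂ) ^ 3 = 8 / 3 := by
      rw [← Complex.ofReal_pow, ha3]; norm_num
    have h3 : 1 + sqrtThree * Complex.I ≠ 0 := by
      rw [add_comm]; exact sqrtThree_mul_add_one_ne_zero (by simp)
    have h4 : (Complex.I + sqrtThree) ^ 3 = 8 * Complex.I := by
      linear_combination (3 * Complex.I + sqrtThree) * sqrtThree_sq
        + (Complex.I + 3 * sqrtThree) * Complex.I_sq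
    have hI := Complex.I_ne_zero
    rw [deriv_quadDiff_exp, mul_pow, h1, h2, h4]
    field_simp
    linear_combination (6 * sqrtThree) * Complex.I_sq

/-- On the local trajectory through iπ/2 the square of d(`primDiff`)/dτ is -τ < 0, so the real part
of `primDiff` is constant. Since the initial direction is not horizontal, the trajectory can be
parametrized by the imaginary part, analytically at the zero itself, where `sqrtDiff` has a branch
point. -/
lemma exists_endpoint_graph : ∃ (c : ℝ) (r : ℝ → ℝ), AnalyticAt ℝ r (Real.pi / 2) ∧
    r (Real.pi / 2) = 0 ∧ ∀ᶠ θ in 𝓝[<] (Real.pi / 2), 0 < r θ ∧ level (r θ) θ = c := by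
  obtain ⟨v, hvre, hvim, hv⟩ := exists_initial_direction
  have hpi := Real.pi_pos
  set p : ℂ := Real.pi / 2 * Complex.I with hp
  have hpe : p = ((Real.pi / 2 : ℝ) : ℂ) * Complex.I := by rw [hp]; push_cast; ring
  have hpre : p.re = 0 := by rw [hpe]; simp
  have hpim : p.im = Real.pi / 2 := by
    rw [hpe, Complex.im_ofReal_mul, Complex.I_im, mul_one]
  have hexp : Complex.exp p = Complex.I := exp_pi_div_two_mul_I
  obtain ⟨G, hGa, hG0, hGd, hG⟩ := exists_trajectory_of_simple_zero
    (χ := fun ξ => quadDiff (Complex.exp ξ)) (p := p)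
    (analyticAt_quadDiff_exp (by rw [hexp]; simp)) (by simp [hexp, quadDiff]) hv
  set η : ℝ → ℂ := fun τ => G τ with hη
  have hcoe : Tendsto (fun τ : ℝ => (τ : ℂ)) (𝓝 0) (𝓝 0) := by
    simpa using Complex.continuous_ofReal.tendsto 0
  have hGev : ∀ᶠ τ : ℝ in 𝓝 0, AnalyticAt ℂ G τ ∧
      quadDiff (Complex.exp (η τ)) * deriv G τ ^ 2 = -τ :=
    (hcoe.eventually hGa.eventually_analyticAt).and (hcoe.eventually hG)
  have hη0 : η 0 = p := by simp [hη, hG0]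
  have hηd : HasDerivAt η v 0 := by
    have := hasDerivAt_comp_ofReal' (G := G) (τ := 0) (by simpa using hGa)
    simpa [hGd] using this
  have hηa : AnalyticAt ℝ η 0 := analyticAt_comp_ofReal (by simpa using hGa)
  have hre : ∀ᶠ τ in 𝓝[>] (0 : ℝ), 0 < (η τ).re := by
    have := eventually_lt_of_deriv_pos (Complex.reCLM.hasFDerivAt.comp_hasDerivAt 0 hηd) hvre
    simpa [hη0, hpre] using this
  have him : ∀ᶠ τ in 𝓝[>] (0 : ℝ), (η τ).im < Real.pi / 2 := by
    have := eventually_lt_of_deriv_pos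
      (Complex.imCLM.hasFDerivAt.comp_hasDerivAt 0 hηd).neg (neg_pos.2 hvim)
    simpa [hη0, hpim] using this
  have him0 : ∀ᶠ τ in 𝓝[>] (0 : ℝ), 0 < (η τ).im := by
    have h1 : ContinuousAt (fun τ => (η τ).im) 0 := (analyticAt_im_comp hηa).continuousAt
    refine (h1.eventually (lt_mem_nhds ?_)).filter_mono nhdsWithin_le_nhds
    simp only [hη0, hpim]
    positivity
  have hall := (hGev.filter_mono (nhdsWithin_le_nhds (s := Ioi 0))).and (hre.and (him.and him0))
  obtain ⟨δ, hδ, hδs⟩ := (mem_nhdsGT_iff_exists_Ioo_subset).1 hall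
  have hδ0 : (0 : ℝ) < δ := hδ
  have hstrip : ∀ τ ∈ Ioo 0 δ, η τ ∈ strip := by
    intro τ hτ
    obtain ⟨-, -, h1, h2⟩ := hδs hτ
    change |(η τ).im| < _
    rw [abs_of_pos h2]
    exact h1
  have hder : ∀ τ ∈ Ioo 0 δ, HasDerivAt (fun τ => (primDiff (η τ)).re) 0 τ := by
    intro τ hτ
    obtain ⟨⟨h1, h2⟩, -⟩ := hδs hτ
    refine (hasDerivAt_re_primDiff_comp (hasDerivAt_comp_ofReal' h1) (hstrip τ hτ)).congr_deriv ?_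
    rw [← sqrtDiff_sq (hstrip τ hτ), ← mul_pow] at h2
    change (sqrtDiff (η τ) * deriv G τ) ^ 2 = _ at h2
    set w := sqrtDiff (η τ) * deriv G τ
    have h3 := congrArg Complex.re h2
    have h4 := congrArg Complex.im h2
    rw [sq, Complex.mul_re, Complex.neg_re, Complex.ofReal_re] at h3
    rw [sq, Complex.mul_im, Complex.neg_im, Complex.ofReal_im] at h4
    have h5 : w.re * w.im = 0 := by linarith
    rcases mul_eq_zero.1 h5 with h6 | h6
    · exact h6
    · rw [h6] at h3
      nlinarith [hτ.1]
  -- The level is read off at an interior parameter because `primDiff` is controlled only inside the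
  -- strip, not at its boundary point iπ/2.
  set c := (primDiff (η (δ / 2))).re with hc
  have hconst : ∀ τ ∈ Ioo 0 δ, (primDiff (η τ)).re = c := by
    intro τ hτ
    exact isOpen_Ioo.is_const_of_deriv_eq_zero isPreconnected_Ioo
      (fun x hx => (hder x hx).differentiableAt.differentiableWithinAt)
      (fun x hx => (hder x hx).deriv) hτ ⟨half_pos hδ0, half_lt_self hδ0⟩
  obtain ⟨σ, hσa, hσ0, hσd, hσ⟩ := exists_graph_param hηa hηd hvim.ne
  rw [hη0, hpim] at hσa hσ0 hσd hσ
  refine ⟨c, fun θ => (η (σ θ)).re, ?_, ?_, ?_⟩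
  · exact analyticAt_re_comp (AnalyticAt.fun_comp_of_eq hηa hσa hσ0)
  · simp [hσ0, hη0, hpre]
  · have h1 : ∀ᶠ θ in 𝓝[<] (Real.pi / 2), 0 < σ θ := by
      have := eventually_gt_of_deriv_neg_left hσd (inv_lt_zero.2 hvim)
      rwa [hσ0] at this
    have h2 : ∀ᶠ θ in 𝓝[<] (Real.pi / 2), σ θ < δ := by
      refine (hσa.continuousAt.eventually (gt_mem_nhds ?_)).filter_mono nhdsWithin_le_nhds
      rwa [hσ0]
    filter_upwards [h1, h2, hσ.filter_mono nhdsWithin_le_nhds] with θ h3 h4 h5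
    refine ⟨(hδs ⟨h3, h4⟩).2.1, ?_⟩
    rw [← hconst (σ θ) ⟨h3, h4⟩, level]
    congr 2
    apply Complex.ext <;> simp [h5]

/-- The vertical line through the value of `primDiff` is pulled back by a local inverse. Its
velocity i/`sqrtDiff` has nonzero imaginary part since `sqrtDiff` has positive real part, so the
curve is a graph over Im ξ. -/
lemma exists_level_branch {ρ θ : ℝ} (hρ : 0 < ρ) (hθ : |θ| < Real.pi / 2) :
    ∃ k : ℝ → ℝ, AnalyticAt ℝ k θ ∧ ∀ᶠ x in 𝓝 θ, 0 < k x ∧ level (k x) x = level ρ θ := by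
  set ξ : ℂ := ρ + θ * Complex.I with hξ
  have hre : ξ.re = ρ := by simp [hξ]
  have him : ξ.im = θ := by simp [hξ]
  have hs : ξ ∈ strip := mem_strip_iff.2 hθ
  have hk := sqrtDiff_re_pos hs (by rw [hre]; exact hρ.le)
  have hk0 := ne_zero_of_re_pos hk
  have hWa : AnalyticAt ℂ primDiff ξ := by
    have : DifferentiableOn ℂ primDiff strip := fun z hz =>
      (hasDerivAt_primDiff hz).differentiableAt.differentiableWithinAt
    exact this.analyticAt (isOpen_strip.mem_nhds hs)
  have hWd : deriv primDiff ξ = sqrtDiff ξ := (hasDerivAt_primDiff hs).deriv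
  have hWd0 : deriv primDiff ξ ≠ 0 := by rwa [hWd]
  set V := hWa.hasStrictDerivAt.localInverse _ _ _ hWd0 with hV
  have hVa : AnalyticAt ℂ V (primDiff ξ) := hWa.analyticAt_localInverse hWd0
  have hV0 : V (primDiff ξ) = ξ := HasStrictFDerivAt.localInverse_apply_image ..
  have hVr : ∀ᶠ w in 𝓝 (primDiff ξ), primDiff (V w) = w :=
    hWa.hasStrictDerivAt.eventually_right_inverse hWd0
  have hVd : HasDerivAt V (sqrtDiff ξ)⁻¹ (primDiff ξ) := 
    (hWa.hasStrictDerivAt.to_localInverse hWd0).hasDerivAt.congr_deriv (by rw [hWd])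
  set y₀ := (primDiff ξ).im with hy₀
  set e : ℂ → ℂ := fun y => (level ρ θ : ℂ) + y * Complex.I with he
  have he0 : e y₀ = primDiff ξ := Complex.re_add_im _
  set η : ℝ → ℂ := fun y => V (e y) with hη
  have hη0 : η y₀ = ξ := by rw [hη]; simp only [he0, hV0]
  have hηa : AnalyticAt ℝ η y₀ := by
    refine analyticAt_comp_ofReal (G := fun y => V (e y)) ?_
    exact AnalyticAt.fun_comp_of_eq hVa (by fun_prop) he0
  have hηd : HasDerivAt η ((sqrtDiff ξ)⁻¹ * Complex.I) y₀ := by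
    have h1 : HasDerivAt e Complex.I y₀ := 
      (((hasDerivAt_id' (y₀ : ℂ)).mul_const Complex.I).const_add (level ρ θ : ℂ)).congr_deriv
        (one_mul _)
    exact (HasDerivAt.comp_of_eq (y₀ : ℂ) hVd h1 he0.symm).comp_ofReal
  have hIm : ((sqrtDiff ξ)⁻¹ * Complex.I).im ≠ 0 := by
    rw [Complex.mul_I_im, Complex.inv_re]
    exact (div_pos hk (Complex.normSq_pos.2 hk0)).ne'
  obtain ⟨σ, hσa, hσ0, -, hσ⟩ := exists_graph_param hηa hηd hIm
  rw [hη0, him] at hσa hσ0 hσ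
  have hka : AnalyticAt ℝ (fun x => (η (σ x)).re) θ :=
    analyticAt_re_comp (AnalyticAt.fun_comp_of_eq hηa hσa hσ0)
  refine ⟨fun x => (η (σ x)).re, hka, ?_⟩
  have hpos : ∀ᶠ x in 𝓝 θ, 0 < (η (σ x)).re := by
    refine hka.continuousAt.eventually (lt_mem_nhds ?_)
    simpa [hσ0, hη0, hre] using hρ
  have hright : ∀ᶠ x in 𝓝 θ, primDiff (η (σ x)) = e (σ x) := by
    have h1 : ContinuousAt (fun x => e (σ x)) θ := by
      have h2 : Continuous e := by fun_prop
      exact h2.continuousAt.comp (Complex.continuous_ofReal.continuousAt.comp hσa.continuousAt)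
    exact h1.tendsto.eventually (p := fun w => primDiff (V w) = w) (by simpa only [hσ0, he0] using hVr)
  filter_upwards [hσ, hpos, hright] with x h1 h2 h3
  refine ⟨h2, ?_⟩
  have h4 : (((η (σ x)).re : ℝ) : ℂ) + x * Complex.I = η (σ x) := by
    apply Complex.ext <;> simp [h1]
  rw [level, h4, h3]
  simp [he]

/-- The curve is the level set of the real part of `primDiff` at the level c supplied by
`exists_endpoint_graph`, a graph by strict monotonicity along horizontal rays. The same uniqueness
identifies it with the analytic local branches inside the strip and with r at π/2; evenness in θ
settles the end -π/2. -/
lemma exists_trajectory : ∃ ρ : ℝ → ℝ, AnalyticOnNhd ℝ ρ (Icc (-(Real.pi / 2)) (Real.pi / 2)) ∧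
    ρ (-(Real.pi / 2)) = 0 ∧ ρ (Real.pi / 2) = 0 ∧
    (∀ θ ∈ Icc (-(Real.pi / 2)) (Real.pi / 2), 0 ≤ ρ θ) ∧
    ∀ θ ∈ Ioo (-(Real.pi / 2)) (Real.pi / 2), ∃ s : ℝ, s ≤ 0 ∧
      quadDiff (Complex.exp (ρ θ + θ * Complex.I)) * (deriv ρ θ + Complex.I) ^ 2 = s := by
  classical
  obtain ⟨c, r, hra, hr0, hr⟩ := exists_endpoint_graph
  have hpi := Real.pi_pos
  -- On the imaginary segment the level increases with |θ|, and near π/2 the endpoint trajectory,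
  -- which has level c, lies strictly to the right of the segment.
  have hlow : ∀ θ, |θ| < Real.pi / 2 → level 0 θ < c := by
    have hnn : ∀ θ ∈ Ico 0 (Real.pi / 2), level 0 θ < c := by
      intro θ hθ
      have hev : ∀ᶠ x in 𝓝[<] (Real.pi / 2), θ < x ∧ x < Real.pi / 2 :=
        Ioo_mem_nhdsLT hθ.2
      obtain ⟨x, ⟨h1, h2⟩, h3, h4⟩ := (hev.and hr).exists
      have hx : x ∈ Ico 0 (Real.pi / 2) := ⟨hθ.1.trans h1.le, h2⟩
      calc level 0 θ < level 0 x := strictMonoOn_level_zero hθ hx h1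
        _ < level (r x) x := strictMonoOn_level (by rwa [abs_of_nonneg hx.1]) self_mem_Ici h3.le h3
        _ = c := h4
    intro θ hθ
    rcases le_total 0 θ with h | h
    · rw [abs_of_nonneg h] at hθ
      exact hnn θ ⟨h, hθ⟩
    · rw [← level_neg hθ]
      rw [abs_of_nonpos h] at hθ
      exact hnn (-θ) ⟨by linarith, hθ⟩
  choose! k hk0 hkc using fun θ (hθ : |θ| < Real.pi / 2) => exists_level_eq hθ (hlow θ hθ)
  have huniq : ∀ θ, |θ| < Real.pi / 2 → ∀ x, 0 < x → level x θ = c → x = k θ := by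
    intro θ hθ x hx hxc
    exact (strictMonoOn_level hθ).injOn (mem_Ici.2 hx.le) (mem_Ici.2 (hk0 θ hθ).le)
      (hxc.trans (hkc θ hθ).symm)
  -- Beyond the strip ρ is continued by r, because analyticity at ±π/2 requires a full
  -- neighbourhood.
  set ρ : ℝ → ℝ := fun θ => if |θ| < Real.pi / 2 then k θ else r |θ| with hρ
  have hin : ∀ θ, |θ| < Real.pi / 2 → ρ θ = k θ := fun θ hθ => if_pos hθ
  have heven : ∀ θ, ρ (-θ) = ρ θ := by
    intro θ
    simp only [hρ, abs_neg]
    split_ifs with h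
    · exact huniq θ h _ (hk0 _ (by rwa [abs_neg])) (by
        rw [← level_neg h]; exact hkc _ (by rwa [abs_neg]))
    · rfl
  have hend : ρ (Real.pi / 2) = 0 := by
    simp only [hρ]
    rw [abs_of_pos (by positivity), if_neg (lt_irrefl _), hr0]
  have hinterior : ∀ θ, |θ| < Real.pi / 2 → AnalyticAt ℝ ρ θ := by
    intro θ hθ
    obtain ⟨b, hba, hb⟩ := exists_level_branch (hk0 θ hθ) hθ
    refine hba.congr ?_
    have hopen : ∀ᶠ x in 𝓝 θ, |x| < Real.pi / 2 :=
      continuous_abs.continuousAt.eventually (gt_mem_nhds hθ)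
    filter_upwards [hb, hopen] with x h1 h2
    rw [hin x h2]
    exact huniq x h2 _ h1.1 (h1.2.trans (hkc θ hθ))
  have hright : AnalyticAt ℝ ρ (Real.pi / 2) := by
    refine hra.congr ?_
    have hpos : ∀ᶠ x in 𝓝 (Real.pi / 2), 0 < x := lt_mem_nhds (by positivity)
    filter_upwards [eventually_nhdsWithin_iff.1 hr, hpos] with x h1 h2
    by_cases hx : x < Real.pi / 2
    · have hx' : |x| < Real.pi / 2 := by rwa [abs_of_pos h2]
      rw [hin x hx']
      exact huniq x hx' _ (h1 hx).1 (h1 hx).2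
    · simp only [hρ]
      rw [abs_of_pos h2, if_neg hx]
  have hleft : AnalyticAt ℝ ρ (-(Real.pi / 2)) := by
    have h1 : AnalyticAt ℝ (fun x => ρ (-x)) (-(Real.pi / 2)) :=
      AnalyticAt.fun_comp_of_eq hright (by fun_prop) (neg_neg _)
    exact h1.congr (Eventually.of_forall heven)
  refine ⟨ρ, ?_, by rw [heven, hend], hend, ?_, ?_⟩
  · intro θ hθ
    rcases hθ.1.eq_or_lt with h | h
    · rw [← h]; exact hleft
    · rcases hθ.2.eq_or_lt with h' | h'
      · rw [h']; exact hright
      · exact hinterior θ (abs_lt.2 ⟨h, h'⟩)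
  · intro θ hθ
    rcases hθ.1.eq_or_lt with h | h
    · rw [← h, heven, hend]
    · rcases hθ.2.eq_or_lt with h' | h'
      · rw [h', hend]
      · rw [hin θ (abs_lt.2 ⟨h, h'⟩)]
        exact (hk0 θ (abs_lt.2 ⟨h, h'⟩)).le
  · intro θ hθ
    have hθ' : |θ| < Real.pi / 2 := abs_lt.2 hθ
    have hs : (ρ θ : ℂ) + θ * Complex.I ∈ strip := mem_strip_iff.2 hθ'
    have hpath : HasDerivAt (fun θ : ℝ => (ρ θ : ℂ) + θ * Complex.I) (deriv ρ θ + Complex.I) θ := by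
      have h1 := (hinterior θ hθ').differentiableAt.hasDerivAt.ofReal_comp
      simpa using h1.fun_add ((hasDerivAt_ofReal θ).mul_const Complex.I)
    have h1 := hasDerivAt_re_primDiff_comp hpath hs
    have h2 : HasDerivAt (fun θ : ℝ => (primDiff ((ρ θ : ℂ) + θ * Complex.I)).re) 0 θ := by
      refine (hasDerivAt_const θ c).congr_of_eventuallyEq ?_
      have hopen : ∀ᶠ x in 𝓝 θ, |x| < Real.pi / 2 :=
        continuous_abs.continuousAt.eventually (gt_mem_nhds hθ')
      filter_upwards [hopen] with x hx
      rw [hin x hx]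
      exact hkc x hx
    have h3 := h1.unique h2
    rw [← sqrtDiff_sq hs, ← mul_pow]
    set w := sqrtDiff ((ρ θ : ℂ) + θ * Complex.I) * (deriv ρ θ + Complex.I)
    refine ⟨-w.im ^ 2, by nlinarith [sq_nonneg w.im], ?_⟩
    apply Complex.ext
    · rw [sq, Complex.mul_re, h3, Complex.ofReal_re]; ring
    · rw [sq, Complex.mul_im, h3, Complex.ofReal_im]; ring

/-! ### The branch arc -/

/-- The square of the root in the right half-plane, in the uniformizing coordinate. -/
def rootSq (x : ℂ) : ℂ := (1 + 2 / (sqrtThree * x + 1)) / 3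

/-- The root in the right half-plane, in the uniformizing coordinate. -/
def branchRoot (x : ℂ) : ℂ := Complex.sqrt (rootSq x)

/-- The point of the left half-plane with a given uniformizing coordinate. -/
def branchPoint (x : ℂ) : ℂ := -1 / (sqrtThree * x * branchRoot x)

lemma rootSq_eq (x : ℂ) :
    rootSq x = ((1 / 3 : ℝ) : ℂ) + ((2 / 3 : ℝ) : ℂ) * (sqrtThree * x + 1)⁻¹ := by
  rw [rootSq]; push_cast; ring

lemma rootSq_re_pos {x : ℂ} (hx : 0 ≤ x.re) : 0 < (rootSq x).re := by
  have h : 0 ≤ ((sqrtThree * x + 1)⁻¹).re := by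
    rw [Complex.inv_re]
    refine div_nonneg ?_ (Complex.normSq_nonneg _)
    simp only [Complex.add_re, Complex.mul_re, sqrtThree_re, sqrtThree_im, Complex.one_re]
    nlinarith [sqrt_three_pos]
  rw [rootSq_eq, Complex.add_re, Complex.ofReal_re, Complex.re_ofReal_mul]
  linarith

lemma rootSq_im (x : ℂ) : (rootSq x).im =
    -(2 / 3 * Real.sqrt 3 / Complex.normSq (sqrtThree * x + 1)) * x.im := by
  rw [rootSq_eq, Complex.add_im, Complex.ofReal_im, Complex.im_ofReal_mul, Complex.inv_im]
  simp only [Complex.add_im, Complex.mul_im, sqrtThree_re, sqrtThree_im, Complex.one_im]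
  ring

lemma branchRoot_sq (x : ℂ) : branchRoot x ^ 2 = rootSq x := csqrt_sq _

lemma branchRoot_re_pos {x : ℂ} (hx : 0 ≤ x.re) : 0 < (branchRoot x).re :=
  csqrt_re_pos (mem_slitPlane_of_re_pos (rootSq_re_pos hx))

lemma branchRoot_sq_mul {x : ℂ} (hx : 0 ≤ x.re) :
    3 * branchRoot x ^ 2 * (sqrtThree * x + 1) = sqrtThree * x + 3 := by
  have := sqrtThree_mul_add_one_ne_zero hx
  rw [branchRoot_sq, rootSq]
  field_simp
  ring

/-- The imaginary part of `rootSq x` is a negative multiple of Im x, so the root, with positive real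
part, has imaginary part of sign opposite to that of x. Hence -Im x · Im s only helps. -/
lemma mul_branchRoot_re_pos {x : ℂ} (hx : 0 ≤ x.re) (hx0 : x ≠ 0) : 0 < (x * branchRoot x).re := by
  have hs := branchRoot_re_pos hx
  have h1 : 0 < 2 / 3 * Real.sqrt 3 / Complex.normSq (sqrtThree * x + 1) :=
    div_pos (mul_pos (by norm_num) sqrt_three_pos)
      (Complex.normSq_pos.2 (sqrtThree_mul_add_one_ne_zero hx))
  have h2 := congrArg Complex.im (branchRoot_sq x)
  rw [rootSq_im, sq, Complex.mul_im] at h2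
  set k := 2 / 3 * Real.sqrt 3 / Complex.normSq (sqrtThree * x + 1)
  rw [Complex.mul_re]
  have h3 : 2 * (branchRoot x).re * (-(x.im * (branchRoot x).im)) = k * x.im ^ 2 := by
    linear_combination (-x.im) * h2
  rcases eq_or_ne x.im 0 with h | h
  · have : 0 < x.re := hx.lt_of_ne fun h' => hx0 (Complex.ext h'.symm h)
    rw [h]
    nlinarith [mul_pos this hs]
  · have h4 : 0 < 2 * (branchRoot x).re * (-(x.im * (branchRoot x).im)) := by
      rw [h3]; positivity
    have h5 := pos_of_mul_pos_right h4 (by positivity)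
    nlinarith [mul_nonneg hx hs.le]

lemma branchPoint_re_neg {x : ℂ} (hx : 0 ≤ x.re) (hx0 : x ≠ 0) : (branchPoint x).re < 0 := by
  have h := mul_branchRoot_re_pos hx hx0
  have e : branchPoint x = ((-(1 / Real.sqrt 3) : ℝ) : ℂ) * (x * branchRoot x)⁻¹ := by
    rw [branchPoint, mul_assoc, sqrtThree]; push_cast; ring
  rw [e, Complex.re_ofReal_mul, Complex.inv_re]
  have h1 := div_pos h (Complex.normSq_pos.2 (ne_zero_of_re_pos h))
  have h2 : 0 < 1 / Real.sqrt 3 := by positivity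
  nlinarith [mul_pos h2 h1]

lemma branchPoint_mul_branchRoot {x : ℂ} (hx : 0 ≤ x.re) (hx0 : x ≠ 0) :
    branchPoint x * branchRoot x * (sqrtThree * x) = -1 := by
  have hs := ne_zero_of_re_pos (branchRoot_re_pos hx)
  have hT := sqrtThree_ne_zero
  rw [branchPoint]
  field_simp

/-- Put s = `branchRoot x`. Substituting √3xzs = -1 into the cubic gives exactly the relation that
defines s², and s is in the right half-plane, so uniqueness applies. -/
lemma rightRoot_branchPoint {x : ℂ} (hx : 0 ≤ x.re) (hx0 : x ≠ 0) :
    rightRoot (branchPoint x) = branchRoot x := by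
  refine (eq_rightRoot (branchPoint_re_neg hx hx0).le (mem_zFiber_iff.2 ?_)
    (branchRoot_re_pos hx)).symm
  have h0 : sqrtThree * x ≠ 0 := mul_ne_zero sqrtThree_ne_zero hx0
  refine mul_right_cancel₀ h0 ?_
  linear_combination (branchRoot x ^ 2 - 1) * branchPoint_mul_branchRoot hx hx0
    - 1 / 3 * branchRoot_sq_mul hx

/-- By Vieta the other two fiber points have product -1/(3zs) = x/√3; expressing the square of their
difference through x leaves x² + 1, so the zeros are at x = ±i. -/
lemma gapSq_branchPoint {x : ℂ} (hx : 0 ≤ x.re) (hx0 : x ≠ 0) :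
    gapSq (branchPoint x) = x ^ 2 + 1 := by
  have hneg := branchPoint_re_neg hx hx0
  have hZ : branchPoint x ≠ 0 := by
    intro h; rw [h] at hneg; simp at hneg
  have h1 := gapSq_eq hneg
  rw [rightRoot_branchPoint hx hx0] at h1
  have hs := ne_zero_of_re_pos (branchRoot_re_pos hx)
  have hT := sqrtThree_ne_zero
  have h2 := branchRoot_sq_mul hx
  have h3 := branchPoint_mul_branchRoot hx hx0
  have h4 : (3 * x ^ 2 - 2 * sqrtThree * x - 3) * branchRoot x ^ 2 = x ^ 2 - 3 := by
    linear_combination (sqrtThree * x - 3) / 3 * h2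
      + (-branchRoot x ^ 2 * x ^ 2 + x ^ 2 / 3) * sqrtThree_sq
  have h0 : (sqrtThree * x * branchRoot x) ^ 2 ≠ 0 :=
    pow_ne_zero 2 (mul_ne_zero (mul_ne_zero hT hx0) hs)
  refine mul_left_cancel₀ (pow_ne_zero 2 hZ) (h1.trans ?_)
  have hb : branchPoint x = -1 / (sqrtThree * x * branchRoot x) := rfl
  rw [hb]
  field_simp
  linear_combination h4 + x ^ 2 * branchRoot x ^ 2 * sqrtThree_sq

lemma branchPoint_sq {x : ℂ} (hx : 0 ≤ x.re) (hx0 : x ≠ 0) :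
    branchPoint x ^ 2 = (sqrtThree * x + 1) * sqrtThree / (3 * x ^ 2 * (x + sqrtThree)) := by
  have hs := ne_zero_of_re_pos (branchRoot_re_pos hx)
  have hT := sqrtThree_ne_zero
  have h1 := add_sqrtThree_ne_zero hx
  have h2 := branchRoot_sq_mul hx
  rw [branchPoint]
  field_simp
  linear_combination (-sqrtThree) * h2
    - (x + x * sqrtThree ^ 2 * branchRoot x ^ 2 + sqrtThree * branchRoot x ^ 2) * sqrtThree_sq

lemma analyticAt_branchRoot_exp {ξ : ℂ} (h : 0 ≤ (Complex.exp ξ).re) :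
    AnalyticAt ℂ (fun ξ => branchRoot (Complex.exp ξ)) ξ := by
  refine analyticAt_csqrt ?_ (mem_slitPlane_of_re_pos (rootSq_re_pos h))
  have := sqrtThree_mul_add_one_ne_zero h
  unfold rootSq
  fun_prop (disch := assumption)

lemma analyticAt_branchPoint_exp {ξ : ℂ} (h : 0 ≤ (Complex.exp ξ).re) :
    AnalyticAt ℂ (fun ξ => branchPoint (Complex.exp ξ)) ξ := by
  have h1 := analyticAt_branchRoot_exp h
  have h2 : sqrtThree * Complex.exp ξ * branchRoot (Complex.exp ξ) ≠ 0 :=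
    mul_ne_zero (mul_ne_zero sqrtThree_ne_zero (Complex.exp_ne_zero ξ))
      (ne_zero_of_re_pos (branchRoot_re_pos h))
  unfold branchPoint
  fun_prop (disch := assumption)

/-- The logarithmic derivative of `branchPoint`. -/
def branchFactor (x : ℂ) : ℂ :=
  -(sqrtThree * (x ^ 2 + sqrtThree * x + 1) / ((sqrtThree * x + 1) * (x + sqrtThree)))

/-- Implicit differentiation of the relation for s², then of √3xzs = -1, expresses both derivatives
rationally in x up to the factors s and z. -/
lemma hasDerivAt_branchPoint_exp {ξ : ℂ} (h : 0 ≤ (Complex.exp ξ).re) :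
    HasDerivAt (fun ξ => branchPoint (Complex.exp ξ))
      (branchPoint (Complex.exp ξ) * branchFactor (Complex.exp ξ)) ξ := by
  have hZ := (analyticAt_branchPoint_exp h).differentiableAt.hasDerivAt
  have hT := sqrtThree_ne_zero
  have hx0 := Complex.exp_ne_zero ξ
  have h1 := sqrtThree_mul_add_one_ne_zero h
  have h2 := add_sqrtThree_ne_zero h
  have hS := (analyticAt_branchRoot_exp h).differentiableAt.hasDerivAt
  have hs0 := ne_zero_of_re_pos (branchRoot_re_pos h)
  have hsq := branchRoot_sq_mul h
  have hden : HasDerivAt (fun ξ => sqrtThree * Complex.exp ξ + 1) (sqrtThree * Complex.exp ξ) ξ :=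
    ((Complex.hasDerivAt_exp ξ).const_mul sqrtThree).add_const 1
  have hq : HasDerivAt (fun ξ => 3 * branchRoot (Complex.exp ξ) ^ 2 * (sqrtThree * Complex.exp ξ + 1))
      (3 * (2 * branchRoot (Complex.exp ξ) * deriv (fun ξ => branchRoot (Complex.exp ξ)) ξ) *
        (sqrtThree * Complex.exp ξ + 1) +
        3 * branchRoot (Complex.exp ξ) ^ 2 * (sqrtThree * Complex.exp ξ)) ξ := by
    refine (((hS.fun_pow 2).const_mul 3).fun_mul hden).congr_deriv ?_
    norm_num
  have hq' : HasDerivAt (fun ξ => 3 * branchRoot (Complex.exp ξ) ^ 2 * (sqrtThree * Complex.exp ξ + 1))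
      (sqrtThree * Complex.exp ξ) ξ := by
    have h3 : HasDerivAt (fun ξ => sqrtThree * Complex.exp ξ + 3) (sqrtThree * Complex.exp ξ) ξ :=
      ((Complex.hasDerivAt_exp ξ).const_mul sqrtThree).add_const 3
    refine h3.congr_of_eventuallyEq ?_
    have h4 : ∀ᶠ ζ in 𝓝 ξ, sqrtThree * Complex.exp ζ + 1 ≠ 0 :=
      hden.continuousAt.eventually_ne h1
    filter_upwards [h4] with ζ hζ
    rw [branchRoot_sq, rootSq]
    field_simp
    ring
  have hd := hq.unique hq'
  have hZd : HasDerivAt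
      (fun ξ => branchPoint (Complex.exp ξ) * (sqrtThree * Complex.exp ξ * branchRoot (Complex.exp ξ)))
      (deriv (fun ξ => branchPoint (Complex.exp ξ)) ξ *
          (sqrtThree * Complex.exp ξ * branchRoot (Complex.exp ξ)) +
        branchPoint (Complex.exp ξ) * (sqrtThree * Complex.exp ξ * branchRoot (Complex.exp ξ) +
          sqrtThree * Complex.exp ξ * deriv (fun ξ => branchRoot (Complex.exp ξ)) ξ)) ξ :=
    hZ.fun_mul (((Complex.hasDerivAt_exp ξ).const_mul sqrtThree).fun_mul hS)
  have hZd' : HasDerivAt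
      (fun ξ => branchPoint (Complex.exp ξ) * (sqrtThree * Complex.exp ξ * branchRoot (Complex.exp ξ)))
      0 ξ := by
    refine (hasDerivAt_const ξ (-1 : ℂ)).congr_of_eventuallyEq ?_
    have h4 : ∀ᶠ ζ in 𝓝 ξ, branchRoot (Complex.exp ζ) ≠ 0 :=
      hS.continuousAt.eventually_ne hs0
    filter_upwards [h4] with ζ hζ
    have := Complex.exp_ne_zero ζ
    rw [branchPoint]
    field_simp
  have hd' := hZd.unique hZd'
  refine hZ.congr_deriv ?_
  set x := Complex.exp ξ
  set s := branchRoot x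
  set D := deriv (fun ξ => branchRoot (Complex.exp ξ)) ξ
  set Z := branchPoint x
  set Y := deriv (fun ξ => branchPoint (Complex.exp ξ)) ξ
  rw [branchFactor]
  have hY : Y * s = -Z * (s + D) := by
    refine mul_left_cancel₀ (mul_ne_zero hT hx0) ?_
    linear_combination hd'
  have hD : D * (sqrtThree * (x + sqrtThree) * (sqrtThree * x + 1)) = -(s * sqrtThree * x) := by
    refine mul_left_cancel₀ (mul_ne_zero hs0 (by norm_num : (2 : ℂ) ≠ 0)) ?_
    refine mul_left_cancel₀ h1 ?_
    linear_combination (sqrtThree * x + 3) / 3 * (sqrtThree * x + 1) * hd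
      + (2 * sqrtThree * x / 3 - (sqrtThree * x + 3) / 3 * (sqrtThree * x)) * hsq
      + 2 * s * D * (sqrtThree * x + 1) ^ 2 * sqrtThree_sq
  refine mul_right_cancel₀ hs0 (hY.trans ?_)
  field_simp
  refine mul_left_cancel₀ hT ?_
  linear_combination (-Z) * hD

lemma branchFactor_ne_zero {x : ℂ} (hx : 0 ≤ x.re) (hx0 : x ≠ 0) : branchFactor x ≠ 0 := by
  rw [branchFactor, neg_ne_zero]
  refine div_ne_zero (mul_ne_zero sqrtThree_ne_zero ?_)
    (mul_ne_zero (sqrtThree_mul_add_one_ne_zero hx) (add_sqrtThree_ne_zero hx))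
  intro h
  have h1 : x + x⁻¹ + sqrtThree = 0 := by
    field_simp
    linear_combination h
  have h2 := congrArg Complex.re h1
  simp only [Complex.add_re, Complex.inv_re, sqrtThree_re, Complex.zero_re] at h2
  have := div_nonneg hx (Complex.normSq_nonneg x)
  linarith [sqrt_three_pos]

lemma gapSq_mul_branchFactor_sq {x : ℂ} (hx : 0 ≤ x.re) (hx0 : x ≠ 0) :
    gapSq (branchPoint x) * (branchPoint x * branchFactor x) ^ 2 = sqrtThree * quadDiff x := by
  have h1 := sqrtThree_mul_add_one_ne_zero hx
  have h2 := add_sqrtThree_ne_zero hx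
  rw [gapSq_branchPoint hx hx0, mul_pow, branchPoint_sq hx hx0, branchFactor, quadDiff]
  generalize x ^ 2 + sqrtThree * x + 1 = c
  generalize sqrtThree * x + 1 = a at *
  generalize x + sqrtThree = b at *
  field_simp
  linear_combination sqrtThree * c ^ 2 * (x ^ 2 + 1) * sqrtThree_sq

lemma branchPoint_injOn {x y : ℂ} (hx : 0 ≤ x.re) (hx0 : x ≠ 0) (hy : 0 ≤ y.re) (hy0 : y ≠ 0)
    (h : branchPoint x = branchPoint y) : x = y := by
  have h1 : branchRoot x = branchRoot y := by
    rw [← rightRoot_branchPoint hx hx0, h, rightRoot_branchPoint hy hy0]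
  have h2 : rootSq x = rootSq y := by rw [← branchRoot_sq, h1, branchRoot_sq]
  have h3 := sqrtThree_mul_add_one_ne_zero hx
  have h4 := sqrtThree_mul_add_one_ne_zero hy
  have hT := sqrtThree_ne_zero
  rw [rootSq, rootSq] at h2
  field_simp at h2
  refine mul_left_cancel₀ (mul_ne_zero (by norm_num : (2 : ℂ) ≠ 0) hT) ?_
  linear_combination (-1 : ℂ) * h2

lemma eq_of_sq_eq_of_re_neg {a b : ℂ} (h : a ^ 2 = b ^ 2) (ha : a.re < 0) (hb : b.re < 0) :
    a = b := by
  rcases sq_eq_sq_iff_eq_or_eq_neg.1 h with h | h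
  · exact h
  · rw [h, Complex.neg_re] at ha
    linarith

lemma rho_mul_omega24_pow_re_neg {n : ℕ} (h1 : 6 < n) (h2 : n < 18) :
    (rho * omega24 ^ n).re < 0 := by
  have e : omega24 ^ n = Complex.exp (((n * Real.pi / 12 : ℝ) : ℂ) * Complex.I) := by
    rw [omega24, ← Complex.exp_nat_mul]
    congr 1
    push_cast
    ring
  rw [rho, e, Complex.re_ofReal_mul, Complex.exp_ofReal_mul_I_re]
  have h1' : (6 : ℝ) < n := by exact_mod_cast h1
  have h2' : (n : ℝ) < 18 := by exact_mod_cast h2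
  have hpi := Real.pi_pos
  refine mul_neg_of_pos_of_neg (by positivity) (Real.cos_neg_of_pi_div_two_lt_of_lt ?_ ?_) <;>
    nlinarith

lemma rho_sq_eq : rho ^ 2 = sqrtThree / 3 := by
  have := rho_sq_mul
  change rho ^ 2 * sqrtThree = 1 at this
  linear_combination sqrtThree / 3 * this - rho ^ 2 / 3 * sqrtThree_sq

/-- Only squares are compared, which avoids evaluating the square root; the sign is fixed because
both points lie in the left half-plane. -/
lemma branchPoint_I : branchPoint Complex.I = z₁ := by
  refine eq_of_sq_eq_of_re_neg ?_ (branchPoint_re_neg (by simp) Complex.I_ne_zero)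
    (rho_mul_omega24_pow_re_neg (by norm_num) (by norm_num))
  have h : Complex.I + sqrtThree ≠ 0 := add_sqrtThree_ne_zero (by simp)
  have e : z₁ ^ 2 = -(rho ^ 2 * omega24 ^ 2) := by
    rw [z₁]; linear_combination rho ^ 2 * omega24 ^ 2 * omega24_pow_twelve
  have ho : omega24 ^ 2 = (sqrtThree + Complex.I) / 2 := omega24_sq
  rw [e, ho, rho_sq_eq, branchPoint_sq (by simp) Complex.I_ne_zero, Complex.I_sq]
  field_simp
  linear_combination sqrtThree * sqrtThree_sq + sqrtThree * Complex.I_sq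

lemma branchPoint_neg_I : branchPoint (-Complex.I) = z₂ := by
  have hI : -Complex.I ≠ 0 := neg_ne_zero.2 Complex.I_ne_zero
  refine eq_of_sq_eq_of_re_neg ?_ (branchPoint_re_neg (by simp) hI)
    (rho_mul_omega24_pow_re_neg (by norm_num) (by norm_num))
  have h : -Complex.I + sqrtThree ≠ 0 := add_sqrtThree_ne_zero (by simp)
  have ho : omega24 ^ 2 = (sqrtThree + Complex.I) / 2 := omega24_sq
  have hc : (sqrtThree + Complex.I) * (sqrtThree - Complex.I) = 4 := by
    linear_combination sqrtThree_sq - Complex.I_sq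
  have h10 : omega24 ^ 10 = -((sqrtThree - Complex.I) / 2) := by
    have h12 := omega24_pow_twelve
    linear_combination (-omega24 ^ 10 / 4) * hc - (omega24 ^ 10 * (sqrtThree - Complex.I) / 2) * ho
      + (sqrtThree - Complex.I) / 2 * h12
  have e : z₂ ^ 2 = rho ^ 2 * omega24 ^ 10 := by
    rw [z₂]
    linear_combination rho ^ 2 * omega24 ^ 10 * (omega24 ^ 12 - 1) * omega24_pow_twelve
  rw [e, h10, rho_sq_eq, branchPoint_sq (by simp) hI, neg_sq, Complex.I_sq]
  field_simp
  linear_combination sqrtThree * sqrtThree_sq + sqrtThree * Complex.I_sq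

lemma exp_re_nonneg {ξ : ℂ} (h : ξ.im ∈ Icc (-(Real.pi / 2)) (Real.pi / 2)) :
    0 ≤ (Complex.exp ξ).re := by
  rw [Complex.exp_re]
  exact mul_nonneg (Real.exp_pos _).le (Real.cos_nonneg_of_mem_Icc h)

lemma exists_arc : ∃ γ : ℝ → ℂ, IsAnalyticArc γ z₁ z₂ ∧ (∀ z ∈ trace γ, z.re < 0) ∧
    ∀ t ∈ Ioo (0 : ℝ) 1, ∃ r : ℝ, r ≤ 0 ∧ gapSq (γ t) * deriv γ t ^ 2 = r := by
  obtain ⟨ρ, hρ, hρl, hρr, -, htr⟩ := exists_trajectory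
  have hpi := Real.pi_pos
  -- The angle decreases from π/2 to -π/2, so that the arc starts at the image z₁ of x = i.
  set ϑ : ℝ → ℝ := fun t => Real.pi / 2 - Real.pi * t with hϑ
  set ξ : ℝ → ℂ := fun t => ρ (ϑ t) + ϑ t * Complex.I with hξ
  have him (t : ℝ) : (ξ t).im = ϑ t := by simp [hξ]
  have hmem : ∀ t ∈ Icc (0 : ℝ) 1, ϑ t ∈ Icc (-(Real.pi / 2)) (Real.pi / 2) := by
    intro t ht
    constructor <;> simp only [hϑ] <;> nlinarith [ht.1, ht.2]
  have hmem' : ∀ t ∈ Ioo (0 : ℝ) 1, ϑ t ∈ Ioo (-(Real.pi / 2)) (Real.pi / 2) := by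
    intro t ht
    constructor <;> simp only [hϑ] <;> nlinarith [ht.1, ht.2]
  have hre : ∀ t ∈ Icc (0 : ℝ) 1, 0 ≤ (Complex.exp (ξ t)).re := fun t ht =>
    exp_re_nonneg (by rw [him]; exact hmem t ht)
  have hϑd (t : ℝ) : HasDerivAt ϑ (-Real.pi) t :=
    (((hasDerivAt_id' t).const_mul Real.pi).const_sub (Real.pi / 2)).congr_deriv (by simp)
  have hξa : ∀ t ∈ Icc (0 : ℝ) 1, AnalyticAt ℝ ξ t := by
    intro t ht
    have h1 : AnalyticAt ℝ ϑ t := by fun_prop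
    have h2 : AnalyticAt ℝ (fun t => ρ (ϑ t)) t := AnalyticAt.fun_comp (hρ _ (hmem t ht)) h1
    have h3 : AnalyticAt ℝ (fun t => (ρ (ϑ t) : ℂ)) t :=
      AnalyticAt.fun_comp (Complex.ofRealCLM.analyticAt _) h2
    have h4 : AnalyticAt ℝ (fun t => (ϑ t : ℂ)) t :=
      AnalyticAt.fun_comp (Complex.ofRealCLM.analyticAt _) h1
    exact h3.fun_add (h4.fun_mul analyticAt_const)
  have hξd : ∀ t ∈ Icc (0 : ℝ) 1,
      HasDerivAt ξ (-Real.pi * (deriv ρ (ϑ t) + Complex.I)) t := by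
    intro t ht
    have h1 : HasDerivAt (fun t => ρ (ϑ t)) (deriv ρ (ϑ t) * -Real.pi) t :=
      (hρ _ (hmem t ht)).differentiableAt.hasDerivAt.comp t (hϑd t)
    refine (h1.ofReal_comp.fun_add ((hϑd t).ofReal_comp.mul_const Complex.I)).congr_deriv ?_
    push_cast
    ring
  set γ : ℝ → ℂ := fun t => branchPoint (Complex.exp (ξ t)) with hγ
  have hγd : ∀ t ∈ Icc (0 : ℝ) 1, HasDerivAt γ (branchPoint (Complex.exp (ξ t)) *
      branchFactor (Complex.exp (ξ t)) * (-Real.pi * (deriv ρ (ϑ t) + Complex.I))) t :=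
    fun t ht => (hasDerivAt_branchPoint_exp (hre t ht)).comp t (hξd t ht)
  have hneg : ∀ t ∈ Icc (0 : ℝ) 1, (γ t).re < 0 := fun t ht =>
    branchPoint_re_neg (hre t ht) (Complex.exp_ne_zero _)
  refine ⟨γ, ⟨?_, ?_, ?_, ?_, ?_⟩, ?_, ?_⟩
  · intro t ht
    exact AnalyticAt.fun_comp (g := fun ξ => branchPoint (Complex.exp ξ)) (f := ξ)
      (analyticAt_branchPoint_exp (hre t ht)).restrictScalars (hξa t ht)
  · intro t ht
    rw [(hγd t ht).deriv]
    refine mul_ne_zero (mul_ne_zero ?_ (branchFactor_ne_zero (hre t ht) (Complex.exp_ne_zero _)))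
      (mul_ne_zero (neg_ne_zero.2 (Complex.ofReal_ne_zero.2 hpi.ne')) ?_)
    · intro h
      have := hneg t ht
      simp only [hγ, h, Complex.zero_re, lt_irrefl] at this
    · intro h
      have := congrArg Complex.im h
      simp at this
  · intro t ht u hu h
    have h1 := branchPoint_injOn (hre t ht) (Complex.exp_ne_zero _) (hre u hu)
      (Complex.exp_ne_zero _) h
    have ht' := hmem t ht
    have hu' := hmem u hu
    -- The imaginary parts lie in [-π/2, π/2], where exp is injective; equal points then have equal
    -- angles, hence equal parameters.
    have h2 := Complex.exp_inj_of_neg_pi_lt_of_le_pi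
      (by rw [him]; linarith [ht'.1]) (by rw [him]; linarith [ht'.2])
      (by rw [him]; linarith [hu'.1]) (by rw [him]; linarith [hu'.2]) h1
    have h3 := congrArg Complex.im h2
    rw [him, him] at h3
    simp only [hϑ] at h3
    exact mul_left_cancel₀ hpi.ne' (by linarith)
  · have e : ξ 0 = Real.pi / 2 * Complex.I := by
      simp only [hξ, hϑ, mul_zero, sub_zero, hρr]
      push_cast
      ring
    simp only [hγ, e, exp_pi_div_two_mul_I, branchPoint_I]
  · have e : ξ 1 = -(Real.pi / 2 * Complex.I) := by
      have h1 : Real.pi / 2 - Real.pi * 1 = -(Real.pi / 2) := by ring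
      simp only [hξ, hϑ, h1, hρl]
      push_cast
      ring
    simp only [hγ, e, Complex.exp_neg, exp_pi_div_two_mul_I, Complex.inv_I, branchPoint_neg_I]
  · rintro _ ⟨t, ht, rfl⟩
    exact hneg t ht
  · intro t ht
    have ht' := Ioo_subset_Icc_self ht
    obtain ⟨s, hs, hs'⟩ := htr _ (hmem' t ht)
    refine ⟨Real.pi ^ 2 * Real.sqrt 3 * s, mul_nonpos_of_nonneg_of_nonpos (by positivity) hs, ?_⟩
    have h1 := gapSq_mul_branchFactor_sq (hre t ht') (Complex.exp_ne_zero _)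
    rw [(hγd t ht').deriv]
    change gapSq (branchPoint (Complex.exp (ξ t))) * _ = _
    change quadDiff (Complex.exp (ξ t)) * _ = _ at hs'
    rw [mul_pow, ← mul_assoc, h1]
    push_cast
    rw [← hs', sqrtThree]
    ring

end HermitePade

end

theorem mainTheorem9 :
    ∃ γP γR : ℝ → ℂ,
      HermitePade.IsAnalyticArc γP HermitePade.z₁ HermitePade.z₂ ∧
      HermitePade.IsAnalyticArc γR HermitePade.z₃ HermitePade.z₄ ∧
      (∀ z ∈ HermitePade.trace γP, z.re < 0) ∧
      (∀ z ∈ HermitePade.trace γR, 0 < z.re) ∧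
      ∃ ψP ψQ ψR : ℂ → ℂ,
        -- analyticity on the cut planes; `ψQ` takes the value `∞` at `0`, with a simple pole
        AnalyticOnNhd ℂ ψP (HermitePade.trace γP)ᶜ ∧
        AnalyticOnNhd ℂ ψQ (HermitePade.trace γP ∪ HermitePade.trace γR ∪ {0})ᶜ ∧
        meromorphicOrderAt ψQ 0 = -1 ∧
        AnalyticOnNhd ℂ ψR (HermitePade.trace γR)ᶜ ∧
        -- each is an inverse of `z(w)`
        (∀ z ∉ HermitePade.trace γP, ψP z ∈ HermitePade.zFiber z) ∧
        (∀ z ∉ HermitePade.trace γP ∪ HermitePade.trace γR ∪ {0},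
          ψQ z ∈ HermitePade.zFiber z) ∧
        (∀ z ∉ HermitePade.trace γR, ψR z ∈ HermitePade.zFiber z) ∧
        -- together they are all the three inverses, and these are distinct
        (∀ z ∉ HermitePade.trace γP ∪ HermitePade.trace γR, ψP z ≠ ψR z) ∧
        (∀ z ∉ HermitePade.trace γP ∪ HermitePade.trace γR ∪ {0},
          ψP z ≠ ψQ z ∧ ψQ z ≠ ψR z ∧ HermitePade.zFiber z = {ψP z, ψQ z, ψR z}) ∧
        -- values at infinity
        Tendsto ψP (Bornology.cobounded ℂ) (𝓝 (-1)) ∧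
        Tendsto ψQ (Bornology.cobounded ℂ) (𝓝 0) ∧
        Tendsto ψR (Bornology.cobounded ℂ) (𝓝 1) ∧
        -- the integrals along the `+` sides of the arcs are real
        HermitePade.HasRealPlusIntegrals (fun s => ψQ s - ψP s) γP ∧
        HermitePade.HasRealPlusIntegrals (fun s => ψQ s - ψR s) γR := by
  obtain ⟨γ, hγ, hneg, htr⟩ := HermitePade.exists_arc
  have hmem {z : ℂ} : z ∈ HermitePade.trace (fun t => -γ t) ↔ -z ∈ HermitePade.trace γ :=
    HermitePade.mem_trace_neg
  have hR : HermitePade.IsAnalyticArc (fun t => -γ t) HermitePade.z₃ HermitePade.z₄ := by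
    rw [HermitePade.z₃_eq, HermitePade.z₄_eq]
    exact hγ.neg
  have hsplit {z : ℂ}
      (hz : z ∉ HermitePade.trace γ ∪ HermitePade.trace (fun t => -γ t) ∪ {0}) :
      z ∉ HermitePade.trace γ ∧ -z ∉ HermitePade.trace γ ∧ z ≠ 0 :=
    ⟨fun h => hz (.inl (.inl h)), fun h => hz (.inl (.inr (hmem.2 h))), fun h => hz (.inr h)⟩
  have hP := HermitePade.hasRealPlusIntegrals_psi hγ hneg htr
  refine ⟨γ, fun t => -γ t, hγ, hR, hneg, fun z hz => ?_, HermitePade.psiP γ, HermitePade.psiQ γ,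
    HermitePade.psiR γ, fun z hz => HermitePade.analyticAt_psiP hγ hneg hz, fun z hz => ?_,
    HermitePade.meromorphicOrderAt_psiQ hγ hneg,
    fun z hz => HermitePade.analyticAt_psiR hγ hneg (mt hmem.2 hz),
    fun z hz => HermitePade.psiP_mem hγ hneg hz, fun z hz => ?_,
    fun z hz => HermitePade.psiR_mem hγ hneg (mt hmem.2 hz), fun z hz => ?_, fun z hz => ?_,
    HermitePade.tendsto_psiP hγ, HermitePade.tendsto_psiQ hγ, HermitePade.tendsto_psiR hγ, hP, ?_⟩
  · simpa using hneg _ (hmem.1 hz)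
  · obtain ⟨h1, h2, h3⟩ := hsplit hz
    exact HermitePade.analyticAt_psiQ hγ hneg h1 h2 h3
  · obtain ⟨h1, h2, h3⟩ := hsplit hz
    exact ((HermitePade.isRootTriple_psi hγ h1 h2 h3).1.mem_iff _).2 (.inr (.inl rfl))
  · rcases eq_or_ne z 0 with rfl | h0
    · rw [HermitePade.psiP_of_nonneg (by simp), HermitePade.psiR_of_nonpos (by simp), neg_zero]
      have hpos := HermitePade.rightRoot_re_pos 0
      intro h
      have := congrArg Complex.re h
      rw [Complex.neg_re] at this
      linarith
    · exact (HermitePade.isRootTriple_psi hγ (fun h => hz (.inl h))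
        (fun h => hz (.inr (hmem.2 h))) h0).2.2.2
  · obtain ⟨h1, h2, h3⟩ := hsplit hz
    obtain ⟨h4, h5, h6, -⟩ := HermitePade.isRootTriple_psi hγ h1 h2 h3
    exact ⟨h5, h6, h4.zFiber_eq⟩
  -- Reflection carries ψ_Q - ψ_P on Γ_P to ψ_Q - ψ_R on Γ_R, so (d) is (c) reflected.
  · convert hP.neg using 2 with z
    rw [HermitePade.psiQ_neg, HermitePade.psiP_neg]
    ring
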